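/- Let $S\subset\mathbb R^d$ be an oriented triangulated polyhedral surface homeomorphic to a closed disk, with three distinct marked boundary vertices $v_1,v_2,v_3$ in positive cyclic order, and let $S^q$ ($q\ge 2$) be its $q$-th regular 1-4 subdivision, with faces $f_j$. Let $T$ be the equilateral triangle with corners $t_\ell=e^{2\pi i(\ell-1)/3}$, $\ell=1,2,3$, and put $t_4=t_1$, $v_4=v_1$. *Local coordinates.* For a vertex $v$ of $S$ let $\theta_v$ be the sum of the angles of the faces of $S$ at $v$, let $\Theta_v=2\pi$ if $v$ is interior, $\Theta_v=\pi/3$ if $v$ is marked, $\Theta_v=\pi$ if $v$ is any other boundary vertex, and let $\gamma_v=\Theta_v/\theta_v$. Fix $0<\zeta<1/4$. The chart $\varphi_v$ is defined on the part $\Omega_v$ of the star of $v$ which in each face $v,b,c$ is the triangle cut off at $v$ by the segment from $\zeta v+(1-\zeta)b$ to $\zeta v+(1-\zeta)c$, without that segment; on each such face it is a rigid orientation-preserving unfolding into $\mathbb C$ sending $v$ to $0$, followed by $z\mapsto z^{\gamma_v}$ and a rotation, so that $\varphi_v$ is well defined and continuous on $\Omega_v$. Each face $f$ of $S^2$ is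 associated to a vertex $v$ of the face of $S$ containing it, such that $f\subset\Omega_v$; each face $f_j$ of $S^q$ is associated to the vertex of its ancestor in $S^2$. If $v_{j_1},v_{j_2},v_{j_3}$ are the vertices of $f_j$, in positive order, let $z_{j_\ell}=\varphi_v(v_{j_\ell})$ for the associated vertex $v$. Assume that the triangulation $S$ is fine enough: for every face of $S$ and every vertex $v$ of it, either $\gamma_v=1$, or the angle $\theta$ of the face at $v$ satisfies $\theta<\pi/2$ and $\gamma_v\theta<\pi/2$. *Equations.* Let $K_j\ge 1$, let $\alpha_j,\beta_j,\delta_j\in\mathbb C$ for every face $f_j$ of $S^q$, let $\mathcal A_j(z)=\alpha_jz+\beta_j\bar z+\delta_j$, and let $u_i\in\mathbb C$ for every vertex $v_i$ of $S^q$. Suppose that 1. $|\beta_j|\le\frac{K_j-1}{K_j+1}|\alpha_j|$ and $\alpha_j\ne0$ for every $j$; 2. $\mathcal A_j(z_{j_\ell})=u_{j_\ell}$ for every $j$ and $\ell=1,2,3$; 3. $\mathcal A_j(z_{j_\ell})=t_k$ whenever the vertex $v_{j_\ell}$ of $f_j$ is the marked vertex $v_k$; 4. for $k=1,2,3$, if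 $v_k=w_1,w_2,\dots,w_n=v_{k+1}$ are the boundary vertices of $S^q$ from $v_k$ to $v_{k+1}$ in positive order, there are reals $0\le\lambda_2\le\dots\le\lambda_{n-1}\le1$ such that the value $u$ at $w_\ell$ is $(1-\lambda_\ell)t_k+\lambda_\ell t_{k+1}$ for $1<\ell<n$. Then there is exactly one map $\Phi^q:S\to\mathbb C$ that is, on every closed face $f_j$, the affine map of $f_j$ onto the triangle with vertices $z_{j_1},z_{j_2},z_{j_3}$ (taking $v_{j_\ell}$ to $z_{j_\ell}$) followed by $\mathcal A_j$. This map belongs to $\mathcal F^{S^q}_K$: it is continuous and affine on every face of $S^q$, maps $\partial S$ bijectively onto $\partial T$ and $v_k$ to $t_k$ for $k=1,2,3$, is an orientation-preserving homeomorphism of $S$ onto $T$, and for every $j$ the affine map of the plane taking $z_{j_\ell}$ to $\Phi^q(v_{j_\ell})$, $\ell=1,2,3$, is uniquely determined and orientation preserving, and the ratio of its larger to its smaller singular value is at most $K_j$. -/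

import Mathlib

open scoped BigOperators ComplexConjugate

noncomputable section

namespace PolyUnif

/-- The ambient Euclidean space `ℝ^d`. -/
abbrev Pt (d : ℕ) : Type := EuclideanSpace ℝ (Fin d)

/-- The corners `t₁, t₂, t₃` of the target triangle (numbered `0, 1, 2`). -/
def corner (k : Fin 3) : ℂ := Complex.exp (2 * Real.pi * Complex.I * ((k : ℕ) : ℂ) / 3)

/-- The closed equilateral triangle `T`. -/
def target : Set ℂ := convexHull ℝ (Set.range corner)

/-- Twice the signed area of the planar triangle `(a, b, c)`. -/
def signedArea (a b c : ℂ) : ℝ := (conj (b - a) * (c - a)).im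

/-- Conformal distortion of a real-linear map of the plane: the ratio of its larger singular value
to its smaller one. -/
def distortion (L : ℂ →ₗ[ℝ] ℂ) : ℝ := L.singularValues 0 / L.singularValues 1

/-! ### Oriented triangles and 1-4 subdivision -/

/-- The four triangles of the regular subdivision of an oriented triangle `t`: for `some k` the one
at the corner `t k`, for `none` the middle one. Their orientations are those of `t`. -/
def child {d : ℕ} (t : Fin 3 → Pt d) : Option (Fin 3) → Fin 3 → Pt d
  | some k => fun l => midpoint ℝ (t k) (t l)
  | none => fun l => midpoint ℝ (t (l + 1)) (t (l + 2))

/-- The triangle reached from `t` by iterated subdivision, choosing one child at every level;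
the first letter of the word is the choice at the coarsest level. -/
def descend {d : ℕ} : (Fin 3 → Pt d) → List (Option (Fin 3)) → (Fin 3 → Pt d)
  | t, [] => t
  | t, k :: w => descend (child t k) w

theorem child_mem {d : ℕ} (t : Fin 3 → Pt d) (k : Option (Fin 3)) (l : Fin 3) :
    child t k l ∈ convexHull ℝ (Set.range t) := by
  have h : ∀ i, t i ∈ convexHull ℝ (Set.range t) := fun i =>
    subset_convexHull ℝ _ (Set.mem_range_self i)
  cases k with
  | none => exact (convex_convexHull ℝ _).midpoint_mem (h _) (h _)
  | some k => exact (convex_convexHull ℝ _).midpoint_mem (h _) (h _)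

theorem descend_mem {d : ℕ} (w : List (Option (Fin 3))) :
    ∀ (t : Fin 3 → Pt d) (l : Fin 3), descend t w l ∈ convexHull ℝ (Set.range t) := by
  induction w with
  | nil => exact fun t l => subset_convexHull ℝ _ (Set.mem_range_self l)
  | cons k w ih =>
    intro t l
    refine convexHull_min ?_ (convex_convexHull ℝ _) (ih (child t k) l)
    rintro _ ⟨i, rfl⟩
    exact child_mem t k i

/-! ### Polyhedral surfaces of disk type with three marked boundary vertices -/

/-- `(a, b)` is a directed edge of the oriented triangle `f`. -/
def IsDirEdge {d : ℕ} (f : Fin 3 → Pt d) (a b : Pt d) : Prop :=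
  ∃ k : Fin 3, f k = a ∧ f (k + 1) = b

/-- An oriented triangulated polyhedral surface of disk type in `ℝ^d`, with its vertices on the
boundary enumerated in positive order and three of them marked. A face is the ordered triple of its
vertices (each face is listed once, with one of the three cyclic orderings giving its
orientation). -/
structure MarkedDisk (d : ℕ) where
  faces : Finset (Fin 3 → Pt d)
  /-- Faces are nondegenerate triangles. -/
  indep : ∀ f ∈ faces, AffineIndependent ℝ f
  /-- Each triangle is listed once. -/
  listed_once : ∀ f ∈ faces, ∀ g ∈ faces, Set.range f = Set.range g → f = g
  /-- Two faces meet in a common vertex, a common edge, or not at all. -/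
  inter : ∀ f ∈ faces, ∀ g ∈ faces, f ≠ g →
    convexHull ℝ (Set.range f) ∩ convexHull ℝ (Set.range g) ⊆
      convexHull ℝ (Set.range f ∩ Set.range g)
  /-- The orientations of the faces are consistent: a directed edge belongs to at most one face. -/
  oriented : ∀ f ∈ faces, ∀ g ∈ faces, ∀ a b : Pt d, IsDirEdge f a b → IsDirEdge g a b → f = g
  /-- The surface is a topological closed disk. -/
  disk : Nonempty ((⋃ f ∈ faces, convexHull ℝ (Set.range f) : Set (Pt d)) ≃ₜ
    Metric.closedBall (0 : ℂ) 1)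
  /-- Number of boundary vertices. -/
  m : ℕ
  /-- The boundary vertices in the positive cyclic order. -/
  bd : ZMod m → Pt d
  bd_injective : Function.Injective bd
  /-- The directed edges that belong to a face and whose reverse belongs to no face are exactly
  those from a boundary vertex to the next one. -/
  bd_spec : ∀ a b : Pt d,
    ((∃ f ∈ faces, IsDirEdge f a b) ∧ ¬ ∃ f ∈ faces, IsDirEdge f b a) ↔
      ∃ i : ZMod m, bd i = a ∧ bd (i + 1) = b
  /-- The marked vertices `v₁, v₂, v₃` are the boundary vertices number `c 0 = 0`, `c 1` and `c 2`;
  `c 3 = m` closes the cycle. -/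
  c : Fin 4 → ℕ
  c_strictMono : StrictMono c
  c_zero : c 0 = 0
  c_three : c 3 = m

namespace MarkedDisk

variable {d : ℕ} (S : MarkedDisk d)

/-- The surface as a set of points. -/
def carrier : Set (Pt d) := ⋃ f ∈ S.faces, convexHull ℝ (Set.range f)

/-- The boundary curve `∂S`. -/
def boundary : Set (Pt d) := ⋃ i : ZMod S.m, segment ℝ (S.bd i) (S.bd (i + 1))

/-- The marked vertices `v₁, v₂, v₃`. -/
def marked (k : Fin 3) : Pt d := S.bd (S.c k.castSucc : ZMod S.m)

/-- The faces of the `q`-th subdivision: a face of `S` and a word of length `q`. -/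
abbrev Face (q : ℕ) : Type :=
  {f : Fin 3 → Pt d // f ∈ S.faces} × {w : List (Option (Fin 3)) // w.length = q}

/-- The three vertices of a face of the `q`-th subdivision, in positive order. -/
def verts {q : ℕ} (j : S.Face q) : Fin 3 → Pt d := descend j.1.1 j.2.1

theorem verts_mem {q : ℕ} (j : S.Face q) (l : Fin 3) : S.verts j l ∈ S.carrier :=
  Set.mem_iUnion₂.2 ⟨j.1.1, j.1.2, descend_mem _ _ l⟩

/-- The vertices of a face as points of the surface. -/
def vertPt {q : ℕ} (j : S.Face q) (l : Fin 3) : S.carrier := ⟨S.verts j l, S.verts_mem j l⟩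

/-- The ancestor of a face in the second subdivision. -/
def ancestor {q : ℕ} (hq : 2 ≤ q) (j : S.Face q) : S.Face 2 :=
  (j.1, ⟨j.2.1.take 2, by simp [j.2.2, hq]⟩)

/-- The boundary vertices of the `q`-th subdivision in positive order, starting at `v₁`: each
boundary edge of `S` is divided into `2 ^ q` equal parts. -/
def bdVertex (q n : ℕ) : Pt d :=
  AffineMap.lineMap (S.bd ((n / 2 ^ q : ℕ) : ZMod S.m)) (S.bd ((n / 2 ^ q : ℕ) + 1 : ZMod S.m))
    (((n % 2 ^ q : ℕ) : ℝ) / 2 ^ q)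

/-! ### The smooth conformal structure: angles, exponents and charts -/

/-- The angle of the triangle `f` at its vertex `f k`. -/
def faceAngle (f : Fin 3 → Pt d) (k : Fin 3) : ℝ :=
  EuclideanGeometry.angle (f (k + 1)) (f k) (f (k + 2))

open Classical in
/-- The angle sum `θ` at the vertex `v`. -/
def angleSum (v : Pt d) : ℝ :=
  ∑ f ∈ S.faces, ∑ k : Fin 3, if f k = v then faceAngle f k else 0

open Classical in
/-- The target angle `Θ`: `π / 3` at marked vertices, `π` at the other boundary vertices and
`2 π` at interior vertices. -/
def targetAngle (v : Pt d) : ℝ :=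
  if v ∈ Set.range S.marked then Real.pi / 3
  else if v ∈ Set.range S.bd then Real.pi
  else 2 * Real.pi

/-- The exponent `γ = Θ / θ`. -/
def gam (v : Pt d) : ℝ := S.targetAngle v / S.angleSum v

/-- Rigid, orientation-preserving unfolding of the face `f` into `ℂ`, taking `f k` to the origin
and `f (k + 1)` to the positive real axis. -/
def unfold (f : Fin 3 → Pt d) (k : Fin 3) (p : Pt d) : ℂ :=
  let x : Pt d := f (k + 1) - f k
  let y : Pt d := f (k + 2) - f k
  let e₁ : Pt d := ‖x‖⁻¹ • x
  let y' : Pt d := y - (inner ℝ e₁ y) • e₁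
  let e₂ : Pt d := ‖y'‖⁻¹ • y'
  ⟨inner ℝ e₁ (p - f k), inner ℝ e₂ (p - f k)⟩

/-- The domain of the chart at the vertex `v`: inside each face `v, b, c` it is the triangle cut off
at `v` by the segment from `ζ v + (1 - ζ) b` to `ζ v + (1 - ζ) c`, without that segment. -/
def chartDomain (ζ : ℝ) (v : Pt d) : Set (Pt d) :=
  {p | ∃ f ∈ S.faces, ∃ k : Fin 3, f k = v ∧ ∃ s t : ℝ, 0 ≤ s ∧ 0 ≤ t ∧ s + t < 1 - ζ ∧
    p = v + s • (f (k + 1) - v) + t • (f (k + 2) - v)}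

/-- `φ` is the chart at the vertex `v`: on each face around `v` it is the rigid unfolding followed
by the power `z ↦ z ^ γ` and a rotation. (Since `φ` is a function on the surface, the pieces agree
on common edges.) -/
def IsChart (ζ : ℝ) (v : Pt d) (φ : Pt d → ℂ) : Prop :=
  ∀ f ∈ S.faces, ∀ k : Fin 3, f k = v → ∃ ω : ℂ, ‖ω‖ = 1 ∧
    ∀ p ∈ S.chartDomain ζ v ∩ convexHull ℝ (Set.range f),
      φ p = ω * (unfold f k p) ^ ((S.gam v : ℝ) : ℂ)

/-- The standing assumption on the triangulation: at each corner of a face, either the chart is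
rigid (`γ = 1`), or the angle `θ` of the face satisfies `θ < π / 2` and `γ θ < π / 2`. -/
def FineAngles : Prop :=
  ∀ f ∈ S.faces, ∀ k : Fin 3, S.gam (f k) = 1 ∨
    (faceAngle f k < Real.pi / 2 ∧ S.gam (f k) * faceAngle f k < Real.pi / 2)

/-- A choice of the charts and of an association of the faces of the second subdivision to charts
that contain them. -/
structure Atlas where
  ζ : ℝ
  ζ_pos : 0 < ζ
  ζ_lt : ζ < 1 / 4
  φ : Pt d → Pt d → ℂ
  chart : ∀ f ∈ S.faces, ∀ k : Fin 3, S.IsChart ζ (f k) (φ (f k))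
  /-- The face `j` is associated to the chart at this corner of the face of `S` containing it. -/
  assoc : S.Face 2 → Fin 3
  assoc_spec : ∀ j : S.Face 2,
    convexHull ℝ (Set.range (S.verts j)) ⊆ S.chartDomain ζ (j.1.1 (assoc j))

variable {S}

/-- The vertex whose chart is associated to the face `j`, through the ancestor of `j`. -/
def Atlas.chartVertex (𝒜 : S.Atlas) {q : ℕ} (hq : 2 ≤ q) (j : S.Face q) : Pt d :=
  j.1.1 (𝒜.assoc (S.ancestor hq j))

/-- The vertices `z₁, z₂, z₃` of the face `j` in local coordinates; the triangles with these
vertices form the discrete conformal structure. -/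
def Atlas.z (𝒜 : S.Atlas) {q : ℕ} (hq : 2 ≤ q) (j : S.Face q) (l : Fin 3) : ℂ :=
  𝒜.φ (𝒜.chartVertex hq j) (S.verts j l)

variable (S)

/-! ### Simplicial maps and the space of quasiconformal simplicial homeomorphisms -/

/-- Membership in `𝓕^{S^q}`: simplicial maps of the `q`-th subdivision to the plane that take the
boundary bijectively to the boundary of `T` and the marked vertices to the corners. -/
structure IsSimplicialMap (q : ℕ) (Φ : S.carrier → ℂ) : Prop where
  continuous : Continuous Φ
  affine : ∀ (j : S.Face q) (p : S.carrier), ∀ w ∈ stdSimplex ℝ (Fin 3),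
    (p : Pt d) = ∑ l, w l • S.verts j l → Φ p = ∑ l, w l • Φ (S.vertPt j l)
  boundary : Set.BijOn Φ {p | (p : Pt d) ∈ S.boundary} (frontier target)
  corners : ∀ (k : Fin 3) (p : S.carrier), (p : Pt d) = S.marked k → Φ p = corner k

variable {S}

/-- Membership in `𝓕^{S^q}_K`: simplicial maps that are orientation-preserving homeomorphisms onto
`T` and whose discrete conformal distortion on each face `j` is at most `K j`. -/
structure IsQCSimplicialHomeo (𝒜 : S.Atlas) {q : ℕ} (hq : 2 ≤ q) (K : S.Face q → ℝ)
    (Φ : S.carrier → ℂ) : Prop where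
  simplicial : S.IsSimplicialMap q Φ
  homeo : ∃ e : S.carrier ≃ₜ target, ∀ p, ((e p : target) : ℂ) = Φ p
  /-- Positively oriented faces have positively oriented images. -/
  orientation : ∀ j : S.Face q,
    0 < signedArea (Φ (S.vertPt j 0)) (Φ (S.vertPt j 1)) (Φ (S.vertPt j 2))
  /-- In local coordinates `Φ` is on each face given by a unique affine map, which preserves
  orientation and has distortion at most `K j`. -/
  distortion_le : ∀ j : S.Face q, ∃ A : ℂ →ᵃ[ℝ] ℂ,
    (∀ A' : ℂ →ᵃ[ℝ] ℂ, (∀ l, A' (𝒜.z hq j l) = Φ (S.vertPt j l)) ↔ A' = A) ∧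
      0 < LinearMap.det A.linear ∧ distortion A.linear ≤ K j

/-! ### The equations -/

/-- The affine map `z ↦ α z + β z̄ + δ`. -/
def affineForm (α β δ z : ℂ) : ℂ := α * z + β * conj z + δ

/-- The system of equations for the pieces `z ↦ α j * z + β j * conj z + δ j`, one for each
face, and the values `u` at the vertices. -/
structure Equations (𝒜 : S.Atlas) {q : ℕ} (hq : 2 ≤ q) (K : S.Face q → ℝ)
    (α β δ : S.Face q → ℂ) (u : Pt d → ℂ) : Prop where
  /-- Distortion bounds. -/
  dist_bound : ∀ j, ‖β j‖ ≤ (K j - 1) / (K j + 1) * ‖α j‖ ∧ α j ≠ 0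
  /-- Compatibility at the vertices. -/
  compat : ∀ j l, affineForm (α j) (β j) (δ j) (𝒜.z hq j l) = u (S.verts j l)
  /-- Marked vertices go to the corners. -/
  corners : ∀ j l k, S.verts j l = S.marked k →
    affineForm (α j) (β j) (δ j) (𝒜.z hq j l) = corner k
  /-- The boundary vertices strictly between two consecutive marked ones go to the edge of `T`
  between the two corners, in weakly monotone order. -/
  sides : ∀ k : Fin 3, ∃ lam : ℕ → ℝ,
    MonotoneOn lam (Set.Ioo (S.c k.castSucc * 2 ^ q) (S.c k.succ * 2 ^ q)) ∧
    ∀ n ∈ Set.Ioo (S.c k.castSucc * 2 ^ q) (S.c k.succ * 2 ^ q),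
      0 ≤ lam n ∧ lam n ≤ 1 ∧
      u (S.bdVertex q n) = (1 - (lam n : ℂ)) * corner k + (lam n : ℂ) * corner (k + 1)

/-- `Φ` is the piecewise-affine map whose expression in local coordinates on the closed face `j`
is `z ↦ α j * z + β j * conj z + δ j`. -/
def HasPieces (𝒜 : S.Atlas) {q : ℕ} (hq : 2 ≤ q) (α β δ : S.Face q → ℂ)
    (Φ : S.carrier → ℂ) : Prop :=
  ∀ (j : S.Face q) (p : S.carrier), ∀ w ∈ stdSimplex ℝ (Fin 3),
    (p : Pt d) = ∑ l, w l • S.verts j l →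
      Φ p = affineForm (α j) (β j) (δ j) (∑ l, w l • 𝒜.z hq j l)

end MarkedDisk

end PolyUnif

end

open scoped BigOperators ComplexConjugate

noncomputable section

namespace PolyUnif

/-! The theorem is an argument principle for piecewise affine maps all of whose pieces preserve
orientation.

Orientation: a face of `S^q` is a homothetic copy, of positive or negative ratio, of the face of `S`
containing it. The angle condition makes `z ↦ z ^ γ` carry both kinds of triangle to positively
oriented ones (`area_z_pos`). The dilatation bound gives `|β| < |α|`, so the piece has determinant
`|α|² - |β|² > 0` and every image triangle is positive (`area_img_pos`). It also bounds the singular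
values by `|α| + |β|` and `|α| - |β|`, whence the distortion bound.

Well-definedness: by compatibility the pieces are linear interpolations of the vertex values `u`,
and interpolation does not depend on the face chosen to represent a point (`interp_eq`). This is
inherited under subdivision.

Degree: seen from a point `y` off all image edges, the edges of a positive triangle turn by `2π` in
total if `y` is inside and by `0` otherwise. In the sum over all faces the inner edges cancel
(`sum_edges`), and the boundary, which runs monotonically along the sides, turns as `∂T` does
(`sum_turn_boundary`). All contributions being nonnegative, a generic point is covered exactly once
if it lies in `T` and never otherwise (`card_cover`). By density the images lie in `T` and fill it.

Injectivity: the same count restricted to the faces around a point `p` off the boundary shows that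
their images cover a neighbourhood of the image of `p` (`star_mem_nhds`). A second preimage would
then create a generic point covered twice. On the boundary, positivity of the image triangles makes
the weakly increasing side parameters strictly increasing, so the boundary map is injective too.
Compactness turns the continuous bijection onto `T` into a homeomorphism. -/

theorem mem_convexHull_range_iff {E : Type*} [AddCommGroup E] [Module ℝ E] (t : Fin 3 → E) (x : E) :
    x ∈ convexHull ℝ (Set.range t) ↔ ∃ w ∈ stdSimplex ℝ (Fin 3), x = ∑ l, w l • t l := by
  classical
  have h := (Fintype.linearCombination ℝ t).image_convexHull
    (Set.range (fun i : Fin 3 => (Pi.single i 1 : Fin 3 → ℝ)))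
  rw [convexHull_rangle_single_eq_stdSimplex, ← Set.range_comp] at h
  have h2 : (⇑(Fintype.linearCombination ℝ t) ∘ fun i : Fin 3 => (Pi.single i 1 : Fin 3 → ℝ)) = t := by
    ext i
    simp [Fintype.linearCombination_apply_single]
  rw [h2] at h
  rw [← h]
  constructor
  · rintro ⟨w, hw, rfl⟩
    exact ⟨w, hw, Fintype.linearCombination_apply ℝ t w⟩
  · rintro ⟨w, hw, rfl⟩
    exact ⟨w, hw, Fintype.linearCombination_apply ℝ t w⟩

/-! ### Signed area and barycentric coordinates in the plane -/

theorem signedArea_eq (a b c : ℂ) :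
    signedArea a b c = (b.re - a.re) * (c.im - a.im) - (b.im - a.im) * (c.re - a.re) := by
  simp [signedArea, Complex.mul_im]
  ring

theorem signedArea_rotate (a b c : ℂ) : signedArea b c a = signedArea a b c := by
  simp only [signedArea_eq]; ring

theorem signedArea_cyclic (t : Fin 3 → ℂ) (k : Fin 3) :
    signedArea (t k) (t (k + 1)) (t (k + 2)) = signedArea (t 0) (t 1) (t 2) := by
  fin_cases k
  · rfl
  · exact signedArea_rotate (t 0) (t 1) (t 2)
  · exact (signedArea_rotate (t 1) (t 2) (t 0)).trans (signedArea_rotate _ _ _)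

/-- Twice the signed area of a triangle given as a family. -/
def area (t : Fin 3 → ℂ) : ℝ := signedArea (t 0) (t 1) (t 2)

/-- The `k`-th barycentric coordinate of `y` with respect to the triangle `t`. -/
def bary (t : Fin 3 → ℂ) (k : Fin 3) (y : ℂ) : ℝ :=
  signedArea y (t (k + 1)) (t (k + 2)) / area t

theorem sum_bary {t : Fin 3 → ℂ} (ht : 0 < area t) (y : ℂ) : ∑ k, bary t k y = 1 := by
  have : area t ≠ 0 := ht.ne'
  simp only [bary, Fin.sum_univ_three]
  rw [← add_div, ← add_div, div_eq_one_iff_eq this]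
  simp only [area, signedArea_eq, Fin.isValue, zero_add, Fin.reduceAdd]
  ring

theorem sum_bary_smul {t : Fin 3 → ℂ} (ht : 0 < area t) (y : ℂ) : ∑ k, bary t k y • t k = y := by
  have h0 : area t ≠ 0 := ht.ne'
  have key : ∀ k, bary t k y • t k = (area t)⁻¹ • (signedArea y (t (k + 1)) (t (k + 2)) • t k) := by
    intro k
    rw [smul_smul, bary, div_eq_inv_mul]
  rw [Finset.sum_congr rfl fun k _ => key k, ← Finset.smul_sum, inv_smul_eq_iff₀ h0]
  simp only [Fin.sum_univ_three, area, signedArea_eq, Fin.isValue, zero_add, Fin.reduceAdd]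
  apply Complex.ext <;> simp <;> ring

theorem bary_sum_smul {t : Fin 3 → ℂ} (ht : 0 < area t) {w : Fin 3 → ℝ} (hw : ∑ l, w l = 1)
    (k : Fin 3) : bary t k (∑ l, w l • t l) = w k := by
  rw [bary, div_eq_iff ht.ne']
  have h0 : w 0 = 1 - w 1 - w 2 := by
    rw [Fin.sum_univ_three] at hw; linarith
  simp only [Fin.sum_univ_three, area, signedArea_eq]
  fin_cases k <;> simp [h0] <;> ring

theorem mem_convexHull_iff_bary {t : Fin 3 → ℂ} (ht : 0 < area t) (y : ℂ) :
    y ∈ convexHull ℝ (Set.range t) ↔ ∀ k, 0 ≤ bary t k y := by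
  rw [mem_convexHull_range_iff]
  constructor
  · rintro ⟨w, hw, rfl⟩ k
    rw [bary_sum_smul ht hw.2]
    exact hw.1 k
  · intro h
    exact ⟨fun k => bary t k y, ⟨h, sum_bary ht y⟩, (sum_bary_smul ht y).symm⟩

theorem weights_unique {t : Fin 3 → ℂ} (ht : 0 < area t) {w w' : Fin 3 → ℝ} (hw : ∑ l, w l = 1)
    (hw' : ∑ l, w' l = 1) (h : ∑ l, w l • t l = ∑ l, w' l • t l) : w = w' := by
  ext k
  rw [← bary_sum_smul ht hw k, h, bary_sum_smul ht hw' k]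

theorem continuous_bary (t : Fin 3 → ℂ) (k : Fin 3) : Continuous (bary t k) := by
  unfold bary
  simp only [signedArea_eq]
  fun_prop

theorem isClosed_hull {E : Type*} [NormedAddCommGroup E] [NormedSpace ℝ E]
    (t : Fin 3 → E) : IsClosed (convexHull ℝ (Set.range t)) :=
  (Set.finite_range t).isClosed_convexHull _

theorem mem_interior_hull {t : Fin 3 → ℂ} (ht : 0 < area t) {y : ℂ} (h : ∀ k, 0 < bary t k y) :
    y ∈ interior (convexHull ℝ (Set.range t)) := by
  have ho : IsOpen {y | ∀ k, 0 < bary t k y} := by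
    simp only [Set.ofPred_forall]
    exact isOpen_iInter_of_finite fun k => isOpen_lt continuous_const (continuous_bary t k)
  exact interior_maximal (fun z hz => (mem_convexHull_iff_bary ht z).2 fun k => (hz k).le) ho h

theorem hull_subset_closure_interior {t : Fin 3 → ℂ} (ht : 0 < area t) :
    convexHull ℝ (Set.range t) ⊆ closure (interior (convexHull ℝ (Set.range t))) := by
  rw [(convex_convexHull ℝ _).closure_interior_eq_closure_of_nonempty_interior]
  · exact subset_closure
  · refine ⟨∑ l, (1 / 3 : ℝ) • t l, mem_interior_hull ht fun k => ?_⟩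
    rw [bary_sum_smul ht (w := fun _ => 1 / 3) (by norm_num [Fin.sum_univ_three])]
    norm_num

/-- Pushing `y` away from the vertex `t k` by a factor `1 + e` lowers the `k`-th coordinate from `0`
to `-e`, so there are points outside the triangle arbitrarily near `y`. -/
theorem notMem_interior_hull {t : Fin 3 → ℂ} (ht : 0 < area t) {y : ℂ} {k : Fin 3}
    (h : bary t k y = 0) : y ∉ interior (convexHull ℝ (Set.range t)) := by
  intro hy
  have hc : ContinuousAt (fun e : ℝ => y + e • (y - t k)) 0 := by fun_prop
  have hn : convexHull ℝ (Set.range t) ∈ nhds (y + (0 : ℝ) • (y - t k)) := by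
    simpa using mem_interior_iff_mem_nhds.1 hy
  obtain ⟨e, he, he'⟩ : ∃ e : ℝ, 0 < e ∧ y + e • (y - t k) ∈ convexHull ℝ (Set.range t) := by
    have := (hc.eventually hn).filter_mono (nhdsWithin_le_nhds (s := Set.Ioi 0))
    exact ((eventually_mem_nhdsWithin (s := Set.Ioi (0 : ℝ))).and this).exists
  have h1 := (mem_convexHull_iff_bary ht _).1 he' k
  have h2 : bary t k (y + e • (y - t k)) = (1 + e) * bary t k y - e := by
    unfold bary
    rw [div_eq_iff ht.ne', sub_mul, mul_assoc, div_mul_cancel₀ _ ht.ne', area,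
      ← signedArea_cyclic t k]
    simp only [signedArea_eq]
    simp
    ring
  rw [h2, h] at h1
  linarith

/-! ### The angle under which a segment is seen -/

/-- The oriented angle under which the segment from `a` to `b` is seen from `y`
(for `y` off the segment). -/
def turn (y a b : ℂ) : ℝ := (((b - y) / (a - y)).arg - ((a - y) / (b - y)).arg) / 2

/-- The half-difference in `turn` makes antisymmetry unconditional, even for a negative real ratio,
where both arguments equal `π`. Cancellation over directed edges needs it for all pairs of points.
-/
theorem turn_swap (y a b : ℂ) : turn y b a = -turn y a b := by
  unfold turn; ring

/-- A ratio `-s` with `s ≥ 0` means `y = (s a + b) / (1 + s)`, a point of the segment. Off the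
segment the ratio therefore avoids the cut of `arg`. -/
theorem ratio_mem_slitPlane {y a b : ℂ} (hy : y ∉ segment ℝ a b) :
    (b - y) / (a - y) ∈ Complex.slitPlane := by
  have ha : a - y ≠ 0 := fun h => hy (by rw [← sub_eq_zero.1 h]; exact left_mem_segment ℝ a b)
  by_contra hs
  rw [Complex.mem_slitPlane_iff_not_le_zero, not_not] at hs
  obtain ⟨s, hs0, hs⟩ : ∃ s : ℝ, 0 ≤ s ∧ (b - y) / (a - y) = -(s : ℂ) := by
    refine ⟨-((b - y) / (a - y)).re, by have := hs.1; simpa using this, ?_⟩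
    apply Complex.ext
    · simp
    · simpa using hs.2
  rw [div_eq_iff ha] at hs
  apply hy
  have h1 : (0 : ℝ) < 1 + s := by linarith
  refine ⟨s / (1 + s), 1 / (1 + s), by positivity, by positivity, by field_simp; ring, ?_⟩
  have h2 : (1 + s : ℂ) ≠ 0 := by exact_mod_cast h1.ne'
  have h3 : b = y - s * (a - y) := by linear_combination hs
  rw [h3]
  simp only [Complex.real_smul]
  push_cast
  field_simp
  ring

theorem turn_eq_arg {y a b : ℂ} (hy : y ∉ segment ℝ a b) :
    turn y a b = ((b - y) / (a - y)).arg := by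
  have h := Complex.slitPlane_arg_ne_pi (ratio_mem_slitPlane hy)
  have h2 : (a - y) / (b - y) = ((b - y) / (a - y))⁻¹ := by rw [inv_div]
  rw [turn, h2, Complex.arg_inv, if_neg h]
  ring

theorem continuousAt_turn {y a b : ℂ} (hy : y ∉ segment ℝ a b) :
    ContinuousAt (fun y => turn y a b) y := by
  have hs : IsClosed (segment ℝ a b) := by
    rw [segment_eq_image_lineMap]
    exact (isCompact_Icc.image (by fun_prop)).isClosed
  have he : (fun y => ((b - y) / (a - y)).arg) =ᶠ[nhds y] fun y => turn y a b := by
    filter_upwards [hs.isOpen_compl.mem_nhds hy] with z hz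
    exact (turn_eq_arg hz).symm
  refine ContinuousAt.congr ?_ he
  have ha : a - y ≠ 0 := fun h => hy (by rw [← sub_eq_zero.1 h]; exact left_mem_segment ℝ a b)
  have hc : ContinuousAt (fun y => (b - y) / (a - y)) y :=
    ContinuousAt.div (by fun_prop) (by fun_prop) ha
  exact ContinuousAt.comp (g := Complex.arg) (f := fun y => (b - y) / (a - y))
    (Complex.continuousAt_arg (ratio_mem_slitPlane hy)) hc

theorem ratio_im (y a b : ℂ) :
    ((b - y) / (a - y)).im = signedArea y a b / Complex.normSq (a - y) := by
  rw [Complex.div_im, signedArea_eq]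
  simp
  ring

theorem turn_lt_pi {y a b : ℂ} (hy : y ∉ segment ℝ a b) : turn y a b < Real.pi := by
  rw [turn_eq_arg hy]
  exact lt_of_le_of_ne (Complex.arg_le_pi _) (Complex.slitPlane_arg_ne_pi (ratio_mem_slitPlane hy))

theorem neg_pi_lt_turn {y a b : ℂ} (hy : y ∉ segment ℝ a b) : -Real.pi < turn y a b := by
  rw [turn_eq_arg hy]
  exact Complex.neg_pi_lt_arg _

theorem turn_nonneg_iff {y a b : ℂ} (hy : y ∉ segment ℝ a b) :
    0 ≤ turn y a b ↔ 0 ≤ signedArea y a b := by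
  have ha : a - y ≠ 0 := fun h => hy (by rw [← sub_eq_zero.1 h]; exact left_mem_segment ℝ a b)
  rw [turn_eq_arg hy, Complex.arg_nonneg_iff, ratio_im,
    le_div_iff₀ (Complex.normSq_pos.2 ha), zero_mul]

theorem turn_neg_iff {y a b : ℂ} (hy : y ∉ segment ℝ a b) :
    turn y a b < 0 ↔ signedArea y a b < 0 := by
  rw [← not_le, turn_nonneg_iff hy, not_le]

theorem signedArea_swap (y a b : ℂ) : signedArea y b a = -signedArea y a b := by
  simp only [signedArea_eq]; ring

theorem turn_pos_iff {y a b : ℂ} (hy : y ∉ segment ℝ a b) :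
    0 < turn y a b ↔ 0 < signedArea y a b := by
  have := turn_neg_iff (y := y) (a := b) (b := a) (by rwa [segment_symm])
  rwa [turn_swap, signedArea_swap, neg_lt_zero, neg_lt_zero] at this

/-- The product of the three ratios is `1`, so their arguments add up to `0` modulo `2π`. -/
theorem exists_turn_sum {y a b c : ℂ} (h1 : y ∉ segment ℝ a b) (h2 : y ∉ segment ℝ b c)
    (h3 : y ∉ segment ℝ c a) :
    ∃ n : ℤ, turn y a b + turn y b c + turn y c a = 2 * Real.pi * n := by
  have ha : a - y ≠ 0 := fun h => h1 (by rw [← sub_eq_zero.1 h]; exact left_mem_segment ℝ a b)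
  have hb : b - y ≠ 0 := fun h => h2 (by rw [← sub_eq_zero.1 h]; exact left_mem_segment ℝ b c)
  have hc : c - y ≠ 0 := fun h => h3 (by rw [← sub_eq_zero.1 h]; exact left_mem_segment ℝ c a)
  have key : ((turn y a b + turn y b c + turn y c a : ℝ) : Real.Angle) = ((0 : ℝ) : Real.Angle) := by
    rw [turn_eq_arg h1, turn_eq_arg h2, turn_eq_arg h3, Real.Angle.coe_add, Real.Angle.coe_add,
      ← Complex.arg_mul_coe_angle (div_ne_zero hb ha) (div_ne_zero hc hb),
      ← Complex.arg_mul_coe_angle (mul_ne_zero (div_ne_zero hb ha) (div_ne_zero hc hb))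
        (div_ne_zero ha hc)]
    have : (b - y) / (a - y) * ((c - y) / (b - y)) * ((a - y) / (c - y)) = 1 := by field_simp
    rw [this, Complex.arg_one]
  obtain ⟨n, hn⟩ := Real.Angle.angle_eq_iff_two_pi_dvd_sub.1 key
  exact ⟨n, by rw [← hn, sub_zero]⟩

theorem int_eq_of_bounds {n m : ℤ} {x : ℝ} (h : x = 2 * Real.pi * n)
    (h1 : 2 * Real.pi * (m - 1) < x) (h2 : x < 2 * Real.pi * (m + 1)) : x = 2 * Real.pi * m := by
  have hp := Real.two_pi_pos
  rw [h] at h1 h2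
  have h1' := lt_of_mul_lt_mul_left h1 hp.le
  have h2' := lt_of_mul_lt_mul_left h2 hp.le
  have a1 : m - 1 < n := by exact_mod_cast h1'
  have a2 : n < m + 1 := by exact_mod_cast h2'
  have : n = m := by omega
  rw [h, this]

/-- The defect is a multiple of `2π`. The areas spanned by the two parts are nonnegative multiples
of the whole one, so the three turns agree in sign and the defect is less than `2π` in absolute
value. -/
theorem turn_add_of_mem_segment {y a b m : ℂ} (hy : y ∉ segment ℝ a b) (hm : m ∈ segment ℝ a b) :
    turn y a m + turn y m b = turn y a b := by
  have h1 : y ∉ segment ℝ a m := fun h =>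
    hy ((convex_segment a b).segment_subset (left_mem_segment ℝ a b) hm h)
  have h2 : y ∉ segment ℝ m b := fun h =>
    hy ((convex_segment a b).segment_subset hm (right_mem_segment ℝ a b) h)
  have h3 : y ∉ segment ℝ b a := by rwa [segment_symm]
  obtain ⟨n, hn⟩ := exists_turn_sum h1 h2 h3
  obtain ⟨s, t, hs, ht, hst, rfl⟩ := hm
  have e1 : signedArea y a (s • a + t • b) = t * signedArea y a b := by
    obtain rfl : s = 1 - t := by linarith
    simp only [signedArea_eq]; simp; ring
  have e2 : signedArea y (s • a + t • b) b = s * signedArea y a b := by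
    obtain rfl : s = 1 - t := by linarith
    simp only [signedArea_eq]; simp; ring
  have hpi := Real.pi_pos
  have := turn_lt_pi h1
  have := turn_lt_pi h2
  have := turn_lt_pi h3
  have := neg_pi_lt_turn h1
  have := neg_pi_lt_turn h2
  have := neg_pi_lt_turn h3
  have key := int_eq_of_bounds (m := 0) hn
  rw [turn_swap y a b] at *
  suffices h : turn y a (s • a + t • b) + turn y (s • a + t • b) b + -turn y a b = 0 by linarith
  have goal : turn y a (s • a + t • b) + turn y (s • a + t • b) b + -turn y a b
      = 2 * Real.pi * ((0 : ℤ) : ℝ) := by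
    rcases lt_trichotomy 0 (signedArea y a b) with h | h | h
    · have := (turn_nonneg_iff h1).2 (by rw [e1]; positivity)
      have := (turn_nonneg_iff h2).2 (by rw [e2]; positivity)
      have := (turn_pos_iff hy).2 h
      apply key <;> push_cast <;> linarith
    · have b1 : turn y a (s • a + t • b) = 0 := by
        refine le_antisymm ?_ ((turn_nonneg_iff h1).2 (by rw [e1, ← h]; simp))
        rw [← not_lt, turn_pos_iff h1, e1, ← h]; simp
      have b2 : turn y (s • a + t • b) b = 0 := by
        refine le_antisymm ?_ ((turn_nonneg_iff h2).2 (by rw [e2, ← h]; simp))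
        rw [← not_lt, turn_pos_iff h2, e2, ← h]; simp
      have b3 : turn y a b = 0 := by
        refine le_antisymm ?_ ((turn_nonneg_iff hy).2 (by rw [← h]))
        rw [← not_lt, turn_pos_iff hy, ← h]; simp
      rw [b1, b2, b3]; simp
    · have c1 : turn y a (s • a + t • b) ≤ 0 := by
        rw [← not_lt, turn_pos_iff h1, e1, not_lt]
        exact mul_nonpos_of_nonneg_of_nonpos ht h.le
      have c2 : turn y (s • a + t • b) b ≤ 0 := by
        rw [← not_lt, turn_pos_iff h2, e2, not_lt]
        exact mul_nonpos_of_nonneg_of_nonpos hs h.le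
      have := (turn_neg_iff hy).2 h
      apply key <;> push_cast <;> linarith
  simpa using goal

open Classical in
/-- The winding number of the boundary of a positive triangle. -/
theorem sum_turn_triangle {t : Fin 3 → ℂ} (ht : 0 < area t) {y : ℂ}
    (hy : ∀ k, y ∉ segment ℝ (t k) (t (k + 1))) :
    ∑ k, turn y (t k) (t (k + 1)) =
      2 * Real.pi * (if y ∈ convexHull ℝ (Set.range t) then 1 else 0) := by
  have h0 := hy 0
  have h1 := hy 1
  have h2 := hy 2
  simp only [zero_add, Fin.reduceAdd] at h0 h1 h2
  obtain ⟨n, hn⟩ := exists_turn_sum h0 h1 h2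
  have hpi := Real.pi_pos
  have := turn_lt_pi h0
  have := turn_lt_pi h1
  have := turn_lt_pi h2
  have := neg_pi_lt_turn h0
  have := neg_pi_lt_turn h1
  have := neg_pi_lt_turn h2
  -- The three areas have a positive sum, so some turn is positive. Inside, all turns are
  -- nonnegative and the total lies in `(0, 3π)`, hence is `2π`. Outside, some turn is negative as
  -- well, the total lies in `(-2π, 2π)`, and hence is `0`.
  have hsum : signedArea y (t 0) (t 1) + signedArea y (t 1) (t 2) + signedArea y (t 2) (t 0)
      = area t := by
    simp only [area, signedArea_eq]; ring
  have hmem : y ∈ convexHull ℝ (Set.range t) ↔ 0 ≤ turn y (t 0) (t 1) ∧ 0 ≤ turn y (t 1) (t 2) ∧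
      0 ≤ turn y (t 2) (t 0) := by
    rw [mem_convexHull_iff_bary ht, turn_nonneg_iff h0, turn_nonneg_iff h1, turn_nonneg_iff h2]
    simp only [bary, le_div_iff₀ ht, zero_mul]
    constructor
    · exact fun h => ⟨h 2, h 0, h 1⟩
    · rintro ⟨a, b, c⟩ k
      fin_cases k
      exacts [b, c, a]
  simp only [Fin.sum_univ_three, zero_add, Fin.reduceAdd]
  split_ifs with h
  · obtain ⟨p0, p1, p2⟩ := hmem.1 h
    have : 0 < turn y (t 0) (t 1) ∨ 0 < turn y (t 1) (t 2) ∨ 0 < turn y (t 2) (t 0) := by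
      rw [turn_pos_iff h0, turn_pos_iff h1, turn_pos_iff h2]
      by_contra! hc
      linarith [hc.1, hc.2.1, hc.2.2]
    have := int_eq_of_bounds (m := 1) hn
      (by push_cast; rcases this with h | h | h <;> linarith) (by push_cast; linarith)
    simpa using this
  · have hneg : turn y (t 0) (t 1) < 0 ∨ turn y (t 1) (t 2) < 0 ∨ turn y (t 2) (t 0) < 0 := by
      by_contra! hc
      exact h (hmem.2 hc)
    have hpos : 0 < turn y (t 0) (t 1) ∨ 0 < turn y (t 1) (t 2) ∨ 0 < turn y (t 2) (t 0) := by
      rw [turn_pos_iff h0, turn_pos_iff h1, turn_pos_iff h2]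
      by_contra! hc
      linarith [hc.1, hc.2.1, hc.2.2]
    have := int_eq_of_bounds (m := 0) hn
      (by push_cast; rcases hpos with h | h | h <;> linarith)
      (by push_cast; rcases hneg with h | h | h <;> linarith)
    simpa using this

/-! ### Points off finitely many segments -/

theorem isClosed_segment (a b : ℂ) : IsClosed (segment ℝ a b) := by
  rw [segment_eq_image_lineMap]
  exact (isCompact_Icc.image (by fun_prop)).isClosed

/-- A segment lies in an affine subspace of dimension at most one, which is a null set of the plane.
-/
theorem dense_compl_segment (a b : ℂ) : Dense (segment ℝ a b)ᶜ := by
  rw [← interior_eq_empty_iff_dense_compl]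
  apply MeasureTheory.Measure.interior_eq_empty_of_null (μ := MeasureTheory.volume)
  refine MeasureTheory.measure_mono_null (t := (affineSpan ℝ ({a, b} : Set ℂ) : Set ℂ)) ?_ ?_
  · rw [← convexHull_pair]
    exact convexHull_subset_affineSpan _
  · apply MeasureTheory.Measure.addHaar_affineSubspace
    intro h
    have h1 := (collinear_iff_finrank_le_one (k := ℝ)).1 (collinear_pair ℝ a b)
    rw [← direction_affineSpan, h, AffineSubspace.direction_top, finrank_top,
      Complex.finrank_real_complex] at h1
    omega

theorem dense_compl_segments {ι : Type*} [Finite ι] (a b : ι → ℂ) :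
    Dense {y | ∀ i, y ∉ segment ℝ (a i) (b i)} := by
  have := dense_iInter_of_isOpen (fun i => (isClosed_segment (a i) (b i)).isOpen_compl)
    (fun i => dense_compl_segment (a i) (b i))
  convert this using 1
  ext y
  simp

/-! ### Power maps on sectors -/

theorem conj_mul_im_polar (z w : ℂ) : (conj z * w).im = ‖z‖ * ‖w‖ * Real.sin (w.arg - z.arg) := by
  conv_lhs => rw [← Complex.norm_mul_exp_arg_mul_I z, ← Complex.norm_mul_exp_arg_mul_I w]
  rw [Complex.exp_mul_I, Complex.exp_mul_I, Real.sin_sub]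
  simp only [map_mul, map_add, Complex.conj_ofReal, Complex.conj_I, Complex.mul_im, Complex.mul_re,
    Complex.add_re, Complex.add_im, ← Complex.ofReal_cos, ← Complex.ofReal_sin, Complex.ofReal_re,
    Complex.ofReal_im, Complex.neg_re, Complex.neg_im, Complex.I_re, Complex.I_im]
  ring

theorem signedArea_eq_conj (a b c : ℂ) : signedArea a b c = (conj (b - a) * (c - a)).im := rfl

/-- Were the order reversed, the difference of arguments would lie in `(-π, 0)`, where the sine is
negative. -/
theorem arg_le_arg {z w : ℂ} (hz : z ≠ 0) (hw : w ≠ 0) (hw0 : 0 ≤ w.arg)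
    (hzp : z.arg < Real.pi) (h : 0 ≤ (conj z * w).im) : z.arg ≤ w.arg := by
  by_contra! hlt
  rw [conj_mul_im_polar] at h
  have : Real.sin (w.arg - z.arg) < 0 :=
    Real.sin_neg_of_neg_of_neg_pi_lt (by linarith) (by linarith)
  have h2 : 0 < ‖z‖ * ‖w‖ := by positivity
  nlinarith

/-- The polar form of a power of a nonzero number. -/
theorem cpow_real_polar {z : ℂ} (hz : z ≠ 0) (r : ℝ) :
    z ^ (r : ℂ) = ((‖z‖ ^ r : ℝ) : ℂ) * Complex.exp (((r * z.arg : ℝ) : ℂ) * Complex.I) := by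
  rw [Complex.cpow_def_of_ne_zero hz, Complex.log, Real.rpow_def_of_pos (norm_pos_iff.2 hz),
    Complex.ofReal_exp, ← Complex.exp_add]
  congr 1
  push_cast
  ring

theorem conj_polar_mul_im (ρ σ x y : ℝ) :
    (conj ((ρ : ℂ) * Complex.exp ((x : ℂ) * Complex.I)) * ((σ : ℂ) *
      Complex.exp ((y : ℂ) * Complex.I))).im = ρ * σ * Real.sin (y - x) := by
  rw [Complex.exp_mul_I, Complex.exp_mul_I, Real.sin_sub]
  simp only [map_mul, map_add, Complex.conj_ofReal, Complex.conj_I, Complex.mul_im, Complex.mul_re,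
    Complex.add_re, Complex.add_im, ← Complex.ofReal_cos, ← Complex.ofReal_sin, Complex.ofReal_re,
    Complex.ofReal_im, Complex.neg_re, Complex.neg_im, Complex.I_re, Complex.I_im]
  ring

section Sector

variable {b : ℝ} {c : ℂ} {γ : ℝ}

/-- Points of the closed sector spanned by the positive real axis and `c`. -/
def sectorPt (b : ℝ) (c : ℂ) (s t : ℝ) : ℂ := s * b + t * c

theorem sectorPt_im (s t : ℝ) : (sectorPt b c s t).im = t * c.im := by simp [sectorPt]

theorem sectorPt_re (s t : ℝ) : (sectorPt b c s t).re = s * b + t * c.re := by simp [sectorPt]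

theorem sectorPt_ne_zero (hb : 0 < b) (hc : 0 < c.im) {s t : ℝ} (h : s ≠ 0 ∨ t ≠ 0) :
    sectorPt b c s t ≠ 0 := by
  intro h0
  have h1 := congrArg Complex.im h0
  have h2 := congrArg Complex.re h0
  rw [sectorPt_im] at h1
  rw [sectorPt_re] at h2
  have ht : t = 0 := by
    rcases mul_eq_zero.1 h1 with h | h
    · exact h
    · exact absurd h hc.ne'
  subst ht
  simp [hb.ne'] at h2
  simp [h2] at h

theorem arg_sectorPt_nonneg (hc : 0 < c.im) {s t : ℝ} (ht : 0 ≤ t) :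
    0 ≤ (sectorPt b c s t).arg := by
  rw [Complex.arg_nonneg_iff, sectorPt_im]; positivity

theorem conj_sectorPt_mul_im (s t s' t' : ℝ) :
    (conj (sectorPt b c s t) * sectorPt b c s' t').im = (s * t' - t * s') * (b * c.im) := by
  simp [sectorPt, Complex.mul_im]; ring

theorem arg_lt_pi_of_im_pos (hc : 0 < c.im) : c.arg < Real.pi :=
  lt_of_le_of_ne (Complex.arg_le_pi _) fun h => hc.ne' (Complex.arg_eq_pi_iff.1 h).2

theorem sectorPt_zero_one : sectorPt b c 0 1 = c := by simp [sectorPt]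

theorem arg_sectorPt_le (hb : 0 < b) (hc : 0 < c.im) {s t : ℝ} (hs : 0 ≤ s) (ht : 0 ≤ t)
    (h : s ≠ 0 ∨ t ≠ 0) : (sectorPt b c s t).arg ≤ c.arg := by
  have hc0 : c ≠ 0 := fun h => by simp [h] at hc
  rcases eq_or_lt_of_le ht with rfl | ht'
  · have : sectorPt b c s 0 = ((s * b : ℝ) : ℂ) := by simp [sectorPt]
    rw [this, Complex.arg_ofReal_of_nonneg (by positivity), Complex.arg_nonneg_iff]
    exact hc.le
  · refine arg_le_arg (sectorPt_ne_zero hb hc h) hc0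
      (Complex.arg_nonneg_iff.2 hc.le) (arg_lt_pi_of_im_pos ?_) ?_
    · rw [sectorPt_im]; positivity
    · have := conj_sectorPt_mul_im (b := b) (c := c) s t 0 1
      rw [sectorPt_zero_one] at this
      rw [this]
      have : 0 ≤ s * (b * c.im) := by positivity
      linarith

theorem arg_sectorPt_mono (hb : 0 < b) (hc : 0 < c.im) {s t s' t' : ℝ} (hs : 0 ≤ s) (ht : 0 ≤ t)
    (ht' : 0 ≤ t') (h : s ≠ 0 ∨ t ≠ 0) (h' : s' ≠ 0 ∨ t' ≠ 0)
    (hd : t * s' ≤ s * t') : (sectorPt b c s t).arg ≤ (sectorPt b c s' t').arg := by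
  refine arg_le_arg (sectorPt_ne_zero hb hc h) (sectorPt_ne_zero hb hc h')
    (arg_sectorPt_nonneg hc ht')
    ((arg_sectorPt_le hb hc hs ht h).trans_lt (arg_lt_pi_of_im_pos hc)) ?_
  rw [conj_sectorPt_mul_im]
  have : 0 < b * c.im := by positivity
  have : 0 ≤ s * t' - t * s' := by linarith
  positivity

theorem sectorPt_mem_slitPlane (hb : 0 < b) (hc : 0 < c.im) {s t : ℝ} (hs : 0 ≤ s) (ht : 0 ≤ t)
    (h : s ≠ 0 ∨ t ≠ 0) : sectorPt b c s t ∈ Complex.slitPlane := by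
  rw [Complex.mem_slitPlane_iff_arg]
  exact ⟨((arg_sectorPt_le hb hc hs ht h).trans_lt (arg_lt_pi_of_im_pos hc)).ne,
    sectorPt_ne_zero hb hc h⟩

theorem hasDerivAt_cpow_sectorPt {z : ℂ} (hz : z ∈ Complex.slitPlane) (v : ℂ) {f : ℝ → ℂ} {x : ℝ}
    (hf : HasDerivAt f v x) (hfx : f x = z) :
    HasDerivAt (fun x => f x ^ (γ : ℂ)) (γ * z ^ ((γ - 1 : ℝ) : ℂ) * v) x := by
  subst hfx
  have h : HasDerivAt (fun z : ℂ => z ^ (γ : ℂ)) (γ * f x ^ ((γ - 1 : ℝ) : ℂ)) (f x) := by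
    simpa using (hasDerivAt_id (f x)).cpow_const (c := (γ : ℂ)) hz
  exact HasDerivAt.comp x h hf

/-- The mixed derivative in the proof of `signedArea_cpow_pos_of_up`. -/
theorem conj_deriv_mul_deriv_pos (hb : 0 < b) (hc : 0 < c.im) (hγ : 0 < γ)
    (hγc : γ * c.arg < Real.pi) {s t s' t' : ℝ} (hs : 0 ≤ s) (ht : 0 ≤ t) (hs' : 0 ≤ s')
    (ht' : 0 ≤ t') (h : s ≠ 0 ∨ t ≠ 0) (h' : s' ≠ 0 ∨ t' ≠ 0) (hd : t * s' ≤ s * t') :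
    0 < (conj (γ * sectorPt b c s t ^ ((γ - 1 : ℝ) : ℂ) * b) *
      (γ * sectorPt b c s' t' ^ ((γ - 1 : ℝ) : ℂ) * c)).im := by
  have hc0 : c ≠ 0 := fun h => by simp [h] at hc
  set z := sectorPt b c s t
  set w := sectorPt b c s' t'
  have hz : z ≠ 0 := sectorPt_ne_zero hb hc h
  have hw : w ≠ 0 := sectorPt_ne_zero hb hc h'
  have e1 : (γ * z ^ ((γ - 1 : ℝ) : ℂ) * b : ℂ) = ((γ * ‖z‖ ^ (γ - 1) * b : ℝ) : ℂ) *
      Complex.exp ((((γ - 1) * z.arg : ℝ) : ℂ) * Complex.I) := by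
    rw [cpow_real_polar hz]; push_cast; ring
  have e2 : (γ * w ^ ((γ - 1 : ℝ) : ℂ) * c : ℂ) = ((γ * ‖w‖ ^ (γ - 1) * ‖c‖ : ℝ) : ℂ) *
      Complex.exp ((((γ - 1) * w.arg + c.arg : ℝ) : ℂ) * Complex.I) := by
    rw [cpow_real_polar hw]
    conv_lhs => rw [← Complex.norm_mul_exp_arg_mul_I c]
    push_cast
    rw [add_mul, Complex.exp_add]
    ring
  rw [e1, e2, conj_polar_mul_im]
  have hcp : 0 < c.arg := lt_of_le_of_ne (Complex.arg_nonneg_iff.2 hc.le)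
    fun h => hc.ne' (Complex.arg_eq_zero_iff.1 h.symm).2
  have b1 : z.arg ≤ w.arg := arg_sectorPt_mono hb hc hs ht ht' h h' hd
  have b2 : 0 ≤ z.arg := arg_sectorPt_nonneg hc ht
  have b3 : w.arg ≤ c.arg := arg_sectorPt_le hb hc hs' ht' h'
  have b4 := arg_lt_pi_of_im_pos hc
  -- The angle between the two derivatives is `arg c + (γ - 1) (arg w - arg z)` with `0 ≤ arg w -
  -- arg z ≤ arg c`. It lies between `arg c` and `γ * arg c`, both in `(0, π)`.
  have hsin : 0 < Real.sin ((γ - 1) * w.arg + c.arg - (γ - 1) * z.arg) := by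
    have e : (γ - 1) * w.arg + c.arg - (γ - 1) * z.arg = c.arg + (γ - 1) * (w.arg - z.arg) := by ring
    rw [e]
    rcases le_total 1 γ with h1 | h1
    · apply Real.sin_pos_of_pos_of_lt_pi
      · have := mul_nonneg (sub_nonneg.2 h1) (sub_nonneg.2 b1)
        linarith
      · have := mul_le_mul_of_nonneg_left (show w.arg - z.arg ≤ c.arg by linarith)
          (sub_nonneg.2 h1)
        linarith
    · apply Real.sin_pos_of_pos_of_lt_pi
      · have := mul_le_mul_of_nonneg_left (show w.arg - z.arg ≤ c.arg by linarith)
          (sub_nonneg.2 h1)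
        have := mul_pos hγ hcp
        linarith
      · have := mul_nonneg (sub_nonneg.2 h1) (sub_nonneg.2 b1)
        linarith
  have hz' := norm_pos_iff.2 hz
  have hw' := norm_pos_iff.2 hw
  have hc' := norm_pos_iff.2 hc0
  positivity

theorem hasDerivAt_sectorPt_left (s t x : ℝ) :
    HasDerivAt (fun x => sectorPt b c (s + x) t) (b : ℂ) x := by
  have h : HasDerivAt (fun x : ℝ => ((x : ℂ))) 1 x := Complex.ofRealCLM.hasDerivAt
  have := ((h.const_add (s : ℂ)).mul_const (b : ℂ)).add_const ((t : ℂ) * c)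
  simpa [sectorPt] using this

theorem hasDerivAt_sectorPt_right (s t x : ℝ) :
    HasDerivAt (fun x => sectorPt b c s (t + x)) c x := by
  have h : HasDerivAt (fun x : ℝ => ((x : ℂ))) 1 x := Complex.ofRealCLM.hasDerivAt
  have := ((h.const_add (t : ℂ)).mul_const c).const_add ((s : ℂ) * b)
  simpa [sectorPt] using this

theorem hasDerivAt_im {f : ℝ → ℂ} {f' : ℂ} {x : ℝ} (h : HasDerivAt f f' x) :
    HasDerivAt (fun x => (f x).im) f'.im x := by
  exact Complex.imCLM.hasFDerivAt.comp_hasDerivAt x h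

theorem pos_of_hasDerivAt_pos {f f' : ℝ → ℝ} (h : ∀ x ∈ Set.Icc (0 : ℝ) 1, HasDerivAt f (f' x) x)
    (hpos : ∀ x ∈ Set.Icc (0 : ℝ) 1, 0 < f' x) (h0 : f 0 = 0) : 0 < f 1 := by
  rw [← h0]
  refine strictMonoOn_of_deriv_pos (convex_Icc (0 : ℝ) 1)
    (fun x hx => (h x hx).continuousAt.continuousWithinAt) (fun x hx => ?_)
    (by simp) (by simp) one_pos
  have hx' := interior_subset hx
  rw [(h x hx').deriv]
  exact hpos x hx'

/-- The power map preserves the orientation of the triangles with sides parallel to those of the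
sector, and oriented alike. -/
theorem signedArea_cpow_pos_of_up (hb : 0 < b) (hc : 0 < c.im) (hγ : 0 < γ)
    (hγc : γ * c.arg < Real.pi) {s t : ℝ} (hs : 0 ≤ s) (ht : 0 ≤ t) :
    0 < signedArea (sectorPt b c s t ^ (γ : ℂ)) (sectorPt b c (s + 1) t ^ (γ : ℂ))
      (sectorPt b c s (t + 1) ^ (γ : ℂ)) := by
  have hc0 : c ≠ 0 := fun h => by simp [h] at hc
  have hcp : 0 < c.arg := lt_of_le_of_ne (Complex.arg_nonneg_iff.2 hc.le)
    fun h => hc.ne' (Complex.arg_eq_zero_iff.1 h.symm).2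
  -- At the apex of the sector the power need not be differentiable. There the two sides go to
  -- segments from the origin enclosing the angle `γ * arg c`, and the area is computed directly.
  by_cases h : s = 0 ∧ t = 0
  · obtain ⟨rfl, rfl⟩ := h
    have e0 : sectorPt b c 0 0 = 0 := by simp [sectorPt]
    have e1 : sectorPt b c (0 + 1) 0 = b := by simp [sectorPt]
    have e2 : sectorPt b c 0 (0 + 1) = c := by simp [sectorPt]
    rw [e0, e1, e2, Complex.zero_cpow (by exact_mod_cast hγ.ne'), signedArea_eq_conj, sub_zero,
      sub_zero, cpow_real_polar (by exact_mod_cast hb.ne'), cpow_real_polar hc0, conj_polar_mul_im,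
      Complex.arg_ofReal_of_nonneg hb.le]
    have := Real.sin_pos_of_pos_of_lt_pi (mul_pos hγ hcp) hγc
    have hb' : 0 < ‖(b : ℂ)‖ := by simp [hb.ne']
    have hc' := norm_pos_iff.2 hc0
    rw [mul_zero, sub_zero]
    positivity
  · replace h : s ≠ 0 ∨ t ≠ 0 := by tauto
    have hne : ∀ x ∈ Set.Icc (0 : ℝ) 1, s + x ≠ 0 ∨ t ≠ 0 := fun x hx => by
      by_contra! hh
      have := hx.1
      rcases h with h | h
      · exact h (by linarith)
      · exact h hh.2
    have hne' : ∀ x ∈ Set.Icc (0 : ℝ) 1, s ≠ 0 ∨ t + x ≠ 0 := fun x hx => by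
      by_contra! hh
      have := hx.1
      rcases h with h | h
      · exact h hh.1
      · exact h (by linarith)
    -- The area is the double integral over the unit square of the cross product of the derivative
    -- at `(s + x, t)` along the first side with the derivative at `(s, t + y)` along the second.
    -- The integrand is positive, and positivity is integrated in one variable at a time.
    have inner : ∀ x ∈ Set.Icc (0 : ℝ) 1,
        0 < (conj (γ * sectorPt b c (s + x) t ^ ((γ - 1 : ℝ) : ℂ) * b) *
          (sectorPt b c s (t + 1) ^ (γ : ℂ) - sectorPt b c s t ^ (γ : ℂ))).im := by
      intro x hx
      refine pos_of_hasDerivAt_pos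
        (f := fun y => (conj (γ * sectorPt b c (s + x) t ^ ((γ - 1 : ℝ) : ℂ) * b) *
          (sectorPt b c s (t + y) ^ (γ : ℂ) - sectorPt b c s t ^ (γ : ℂ))).im)
        (f' := fun y => (conj (γ * sectorPt b c (s + x) t ^ ((γ - 1 : ℝ) : ℂ) * b) *
          (γ * sectorPt b c s (t + y) ^ ((γ - 1 : ℝ) : ℂ) * c)).im) ?_ ?_ (by simp)
      · intro y hy
        exact hasDerivAt_im (((hasDerivAt_cpow_sectorPt
          (sectorPt_mem_slitPlane hb hc hs (add_nonneg ht hy.1) (hne' y hy)) c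
          (hasDerivAt_sectorPt_right s t y) rfl).sub_const _).const_mul _)
      · intro y hy
        have := hx.1
        have := hy.1
        refine conj_deriv_mul_deriv_pos hb hc hγ hγc (by positivity) ht hs (by positivity)
          (hne x hx) (hne' y hy) ?_
        nlinarith [mul_nonneg hs hy.1, mul_nonneg hx.1 ht, mul_nonneg hx.1 hy.1]
    refine pos_of_hasDerivAt_pos
      (f := fun x => (conj (sectorPt b c (s + x) t ^ (γ : ℂ) - sectorPt b c s t ^ (γ : ℂ)) *
        (sectorPt b c s (t + 1) ^ (γ : ℂ) - sectorPt b c s t ^ (γ : ℂ))).im)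
      (f' := fun x => (conj (γ * sectorPt b c (s + x) t ^ ((γ - 1 : ℝ) : ℂ) * b) *
          (sectorPt b c s (t + 1) ^ (γ : ℂ) - sectorPt b c s t ^ (γ : ℂ))).im) ?_ inner (by simp)
    intro x hx
    refine hasDerivAt_im (HasDerivAt.mul_const ?_ _)
    have := ((hasDerivAt_cpow_sectorPt (γ := γ)
          (sectorPt_mem_slitPlane hb hc (add_nonneg hs hx.1) ht (hne x hx)) (b : ℂ)
          (hasDerivAt_sectorPt_left s t x) rfl).sub_const (sectorPt b c s t ^ (γ : ℂ)))
    exact this.star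

/-- In a sector with angle at most `π / 2` both Cartesian coordinates are nonnegative and increase
with `s` and `t`. -/
theorem norm_sectorPt_le (hb : 0 < b) (hc : 0 < c.im) (hc' : 0 ≤ c.re) {s t s' t' : ℝ}
    (hs : 0 ≤ s) (ht : 0 ≤ t) (hs' : s ≤ s') (ht' : t ≤ t') :
    ‖sectorPt b c s t‖ ≤ ‖sectorPt b c s' t'‖ := by
  rw [Complex.norm_def, Complex.norm_def]
  apply Real.sqrt_le_sqrt
  rw [Complex.normSq_apply, Complex.normSq_apply, sectorPt_im, sectorPt_im, sectorPt_re,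
    sectorPt_re]
  have h1 : s * b + t * c.re ≤ s' * b + t' * c.re := by gcongr
  have h2 : t * c.im ≤ t' * c.im := by gcongr
  have h3 : 0 ≤ s * b + t * c.re := by positivity
  have h4 : 0 ≤ t * c.im := by positivity
  exact add_le_add (mul_self_le_mul_self h3 h1) (mul_self_le_mul_self h4 h2)

/-- The power map preserves the orientation of the triangles with sides parallel to those of the
sector, and oriented oppositely. -/
theorem signedArea_cpow_pos_of_down (hb : 0 < b) (hc : 0 < c.im) (hc' : 0 < c.re) (hγ : 0 < γ)
    (hγc : γ * c.arg < Real.pi) {s t : ℝ} (hs : 0 ≤ s) (ht : 0 ≤ t) :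
    0 < signedArea (sectorPt b c (s + 1) (t + 1) ^ (γ : ℂ)) (sectorPt b c s (t + 1) ^ (γ : ℂ))
      (sectorPt b c (s + 1) t ^ (γ : ℂ)) := by
  have ha0 : s + 1 ≠ 0 := by positivity
  have hb0 : t + 1 ≠ 0 := by positivity
  have nA : sectorPt b c (s + 1) (t + 1) ≠ 0 := sectorPt_ne_zero hb hc (Or.inl ha0)
  have nB : sectorPt b c s (t + 1) ≠ 0 := sectorPt_ne_zero hb hc (Or.inr hb0)
  have nC : sectorPt b c (s + 1) t ≠ 0 := sectorPt_ne_zero hb hc (Or.inl ha0)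
  have lB : ‖sectorPt b c s (t + 1)‖ ≤ ‖sectorPt b c (s + 1) (t + 1)‖ :=
    norm_sectorPt_le hb hc hc'.le hs (by positivity) (by linarith) le_rfl
  have lC : ‖sectorPt b c (s + 1) t‖ ≤ ‖sectorPt b c (s + 1) (t + 1)‖ :=
    norm_sectorPt_le hb hc hc'.le (by positivity) ht le_rfl (by linarith)
  have aBA : 0 < (conj (sectorPt b c (s + 1) (t + 1)) * sectorPt b c s (t + 1)).im := by
    rw [conj_sectorPt_mul_im]
    have : 0 < (t + 1) * (b * c.im) := by positivity
    linarith
  have aAC : 0 < (conj (sectorPt b c (s + 1) t) * sectorPt b c (s + 1) (t + 1)).im := by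
    rw [conj_sectorPt_mul_im]
    have : 0 < (s + 1) * (b * c.im) := by positivity
    linarith
  have gB : (sectorPt b c s (t + 1)).arg ≤ c.arg :=
    arg_sectorPt_le hb hc hs (by positivity) (Or.inr hb0)
  have gC : 0 ≤ (sectorPt b c (s + 1) t).arg := arg_sectorPt_nonneg hc ht
  have mA : (sectorPt b c (s + 1) (t + 1)).arg ≤ (sectorPt b c s (t + 1)).arg :=
    arg_sectorPt_mono hb hc (by positivity) (by positivity) (by positivity) (Or.inl ha0)
      (Or.inr hb0) (by nlinarith)
  have mC : (sectorPt b c (s + 1) t).arg ≤ (sectorPt b c (s + 1) (t + 1)).arg :=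
    arg_sectorPt_mono hb hc (by positivity) ht (by positivity) (Or.inl ha0)
      (Or.inl ha0) (by nlinarith)
  generalize sectorPt b c (s + 1) (t + 1) = A at *
  generalize sectorPt b c s (t + 1) = B at *
  generalize sectorPt b c (s + 1) t = C at *
  have sAB : A.arg < B.arg := lt_of_le_of_ne mA fun h => by
    rw [conj_mul_im_polar, h, sub_self, Real.sin_zero, mul_zero] at aBA
    exact lt_irrefl _ aBA
  have sCA : C.arg < A.arg := lt_of_le_of_ne mC fun h => by
    rw [conj_mul_im_polar, h, sub_self, Real.sin_zero, mul_zero] at aAC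
    exact lt_irrefl _ aAC
  have rA := norm_pos_iff.2 nA
  have rB := norm_pos_iff.2 nB
  have rC := norm_pos_iff.2 nC
  have lB' := Real.rpow_le_rpow rB.le lB hγ.le
  have lC' := Real.rpow_le_rpow rC.le lC hγ.le
  set x := γ * (B.arg - A.arg) with hx
  set y := γ * (A.arg - C.arg) with hy
  have hx0 : 0 < x := mul_pos hγ (by linarith)
  have hy0 : 0 < y := mul_pos hγ (by linarith)
  have hxy : x + y < Real.pi := by
    have : γ * (B.arg - C.arg) ≤ γ * c.arg := by gcongr; linarith
    have e : x + y = γ * (B.arg - C.arg) := by rw [hx, hy]; ring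
    linarith
  have sx := Real.sin_pos_of_pos_of_lt_pi hx0 (by linarith)
  have sy := Real.sin_pos_of_pos_of_lt_pi hy0 (by linarith)
  have cx : Real.cos x < 1 := by
    have := Real.cos_lt_cos_of_nonneg_of_le_pi (le_refl 0) (by linarith) hx0
    simpa using this
  have cy : Real.cos y < 1 := by
    have := Real.cos_lt_cos_of_nonneg_of_le_pi (le_refl 0) (by linarith) hy0
    simpa using this
  have pA := Real.rpow_pos_of_pos rA γ
  have pB := Real.rpow_pos_of_pos rB γ
  have pC := Real.rpow_pos_of_pos rC γ
  -- Seen from the origin, the triangle is the quadrilateral `0, C, A, B` (after taking powers)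
  -- minus the triangle `0, C, B`.
  have split : signedArea (A ^ (γ : ℂ)) (B ^ (γ : ℂ)) (C ^ (γ : ℂ)) =
      (conj (A ^ (γ : ℂ)) * B ^ (γ : ℂ)).im + (conj (C ^ (γ : ℂ)) * A ^ (γ : ℂ)).im -
        (conj (C ^ (γ : ℂ)) * B ^ (γ : ℂ)).im := by
    rw [signedArea_eq]
    simp only [Complex.mul_im, Complex.conj_re, Complex.conj_im]
    ring
  rw [split, cpow_real_polar nA, cpow_real_polar nB, cpow_real_polar nC, conj_polar_mul_im,
    conj_polar_mul_im, conj_polar_mul_im]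
  have e1 : γ * B.arg - γ * A.arg = x := by rw [hx]; ring
  have e2 : γ * A.arg - γ * C.arg = y := by rw [hy]; ring
  have e3 : γ * B.arg - γ * C.arg = x + y := by rw [hx, hy]; ring
  rw [e1, e2, e3, Real.sin_add]
  -- With `A, B, C` standing for the powers of the norms, the area is `B sin x (A - C cos y) + C sin
  -- y (A - B cos x)`. Both brackets are positive because `A` is the largest norm and the cosines
  -- are less than `1`.
  have k1 : ‖C‖ ^ γ * Real.cos y < ‖A‖ ^ γ := by nlinarith
  have k2 : ‖B‖ ^ γ * Real.cos x < ‖A‖ ^ γ := by nlinarith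
  have m1 := mul_pos (mul_pos pB sx) (sub_pos.2 k1)
  have m2 := mul_pos (mul_pos pC sy) (sub_pos.2 k2)
  nlinarith

end Sector

/-! ### Unfoldings and subdivided triangles -/

section Unfold

variable {d : ℕ} {f : Fin 3 → Pt d}

theorem linearIndependent_edges (hf : AffineIndependent ℝ f) (k : Fin 3) {s t : ℝ}
    (h : s • (f (k + 1) - f k) + t • (f (k + 2) - f k) = 0) : s = 0 ∧ t = 0 := by
  have e1 : k + 1 ≠ k := by fin_cases k <;> decide
  have e2 : k + 2 ≠ k := by fin_cases k <;> decide
  have e3 : k + 2 ≠ k + 1 := by fin_cases k <;> decide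
  have key := affineIndependent_iff.1 hf Finset.univ
    (fun l => if l = k then -(s + t) else if l = k + 1 then s else t)
    (by rw [Fin.sum_univ_three]; fin_cases k <;> simp)
    (by rw [Fin.sum_univ_three, ← h]; fin_cases k <;> simp <;> module)
  have h1 := key (k + 1) (Finset.mem_univ _)
  have h2 := key (k + 2) (Finset.mem_univ _)
  exact ⟨by simpa [e1] using h1, by simpa [e2, e3] using h2⟩

/-- The unfolding is Gram–Schmidt applied to the two edges at the corner: the first becomes the
positive real `b`, the second a point `c` of the upper half plane whose argument is the face angle.
-/
theorem exists_unfold_eq_sectorPt (hf : AffineIndependent ℝ f) (k : Fin 3) :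
    ∃ (b : ℝ) (c : ℂ), 0 < b ∧ 0 < c.im ∧ c.arg = MarkedDisk.faceAngle f k ∧ ∀ s t : ℝ,
      MarkedDisk.unfold f k (f k + s • (f (k + 1) - f k) + t • (f (k + 2) - f k)) =
        sectorPt b c s t := by
  set x := f (k + 1) - f k with hx
  set y := f (k + 2) - f k with hy
  have hli : ∀ s t : ℝ, s • x + t • y = 0 → s = 0 ∧ t = 0 := fun s t h =>
    linearIndependent_edges hf k h
  have hx0 : x ≠ 0 := fun h => by
    have := (hli 1 0 (by simp [h])).1
    norm_num at this
  set e₁ := ‖x‖⁻¹ • x with he₁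
  set y' := y - (inner ℝ e₁ y) • e₁ with hy'
  set e₂ := ‖y'‖⁻¹ • y' with he₂
  have hy0 : y' ≠ 0 := fun h => by
    have := (hli (-(inner ℝ e₁ y * ‖x‖⁻¹)) 1 (by
      rw [← h, hy', he₁, smul_smul]; simp only [neg_smul, one_smul]; abel)).2
    norm_num at this
  have nx := norm_pos_iff.2 hx0
  have ny := norm_pos_iff.2 hy0
  have he1 : inner ℝ e₁ e₁ = (1 : ℝ) := by
    rw [real_inner_self_eq_norm_sq, he₁, norm_smul, norm_inv, norm_norm, inv_mul_cancel₀ nx.ne']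
    norm_num
  have i1 : inner ℝ e₁ x = ‖x‖ := by
    rw [he₁, real_inner_smul_left, real_inner_self_eq_norm_sq]
    field_simp
  have hxe : x = ‖x‖ • e₁ := by rw [he₁, smul_smul, mul_inv_cancel₀ nx.ne', one_smul]
  have i2 : inner ℝ y' e₁ = (0 : ℝ) := by
    rw [hy', inner_sub_left, real_inner_smul_left, he1, real_inner_comm]; ring
  have i3 : inner ℝ e₂ x = (0 : ℝ) := by
    rw [hxe, he₂, real_inner_smul_left, real_inner_smul_right, i2]; ring
  have hyd : y = y' + (inner ℝ e₁ y) • e₁ := by rw [hy']; abel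
  have i4 : inner ℝ e₂ y = ‖y'‖ := by
    rw [he₂, real_inner_smul_left]
    conv_lhs => rw [hyd]
    rw [inner_add_right, real_inner_smul_right, i2, real_inner_self_eq_norm_sq]
    field_simp
    simp
  refine ⟨‖x‖, ⟨inner ℝ e₁ y, ‖y'‖⟩, nx, ny, ?_, ?_⟩
  · have hn : ‖(⟨inner ℝ e₁ y, ‖y'‖⟩ : ℂ)‖ = ‖y‖ := by
      rw [Complex.norm_def, Complex.normSq_mk]
      have pyth : ∀ r : ℝ, y = y' + r • e₁ → inner ℝ y y = r * r + ‖y'‖ * ‖y'‖ := by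
        intro r h
        have i5 : inner ℝ (r • e₁) (r • e₁) = r * r := by
          rw [real_inner_smul_left _ _ r, real_inner_smul_right _ _ r, he1]; ring
        have i6 : inner ℝ y' (r • e₁) = (0 : ℝ) := by rw [real_inner_smul_right _ _ r, i2, mul_zero]
        rw [h, inner_add_left, inner_add_right, inner_add_right, i5, real_inner_comm y' (r • e₁), i6,
          real_inner_self_eq_norm_mul_norm]
        ring
      rw [← pyth _ hyd, real_inner_self_eq_norm_mul_norm, Real.sqrt_mul_self (norm_nonneg _)]
    have hc0 : (⟨inner ℝ e₁ y, ‖y'‖⟩ : ℂ) ≠ 0 := fun h => ny.ne' (congrArg Complex.im h)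
    rw [Complex.arg_of_im_nonneg_of_ne_zero ny.le hc0, hn, MarkedDisk.faceAngle,
      EuclideanGeometry.angle, InnerProductGeometry.angle]
    congr 1
    change inner ℝ e₁ y / ‖y‖ = inner ℝ x y / (‖x‖ * ‖y‖)
    rw [he₁, real_inner_smul_left]
    field_simp
  · intro s t
    change (⟨inner ℝ e₁ (f k + s • x + t • y - f k), inner ℝ e₂ (f k + s • x + t • y - f k)⟩ : ℂ) = _
    have e : f k + s • x + t • y - f k = s • x + t • y := by abel
    rw [e, inner_add_right, inner_add_right, real_inner_smul_right, real_inner_smul_right,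
      real_inner_smul_right, real_inner_smul_right, i1, i3, i4]
    apply Complex.ext <;> simp [sectorPt]

/-- A corner child is a homothetic copy of ratio `1 / 2`, the middle child one of ratio `-1 / 2`.
The sign of `e` therefore tells whether a descendant lies parallel to its ancestor or is turned
upside down. -/
theorem exists_descend_eq (w : List (Option (Fin 3))) : ∀ t : Fin 3 → Pt d,
    ∃ (e : ℝ) (P : Pt d), e ≠ 0 ∧ ∀ l, descend t w l = P + e • t l := by
  induction w with
  | nil => exact fun t => ⟨1, 0, one_ne_zero, fun l => by simp [descend]⟩
  | cons k w ih =>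
    intro t
    obtain ⟨e, P, he, h⟩ := ih (child t k)
    cases k with
    | some k =>
      refine ⟨e / 2, P + (e / 2) • t k, by positivity, fun l => ?_⟩
      rw [descend, h]
      simp only [child, midpoint_eq_smul_add, invOf_eq_inv]
      module
    | none =>
      refine ⟨-(e / 2), P + (e / 2) • (t 0 + t 1 + t 2), by simpa using he, fun l => ?_⟩
      rw [descend, h]
      simp only [child, midpoint_eq_smul_add, invOf_eq_inv]
      fin_cases l <;> simp <;> module

theorem descend_append (v w : List (Option (Fin 3))) : ∀ t : Fin 3 → Pt d,
    descend t (v ++ w) = descend (descend t v) w := by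
  induction v with
  | nil => exact fun t => rfl
  | cons k v ih => exact fun t => ih (child t k)

theorem exists_sector_coords (k : Fin 3) {p : Pt d}
    (hp : p ∈ convexHull ℝ (Set.range f)) : ∃ s t : ℝ, 0 ≤ s ∧ 0 ≤ t ∧
      p = f k + s • (f (k + 1) - f k) + t • (f (k + 2) - f k) := by
  obtain ⟨w, hw, rfl⟩ := (mem_convexHull_range_iff f p).1 hp
  refine ⟨w (k + 1), w (k + 2), hw.1 _, hw.1 _, ?_⟩
  have h1 := hw.2
  rw [Fin.sum_univ_three] at h1 ⊢
  have h0 : w 0 = 1 - w 1 - w 2 := by linarith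
  fin_cases k <;> simp [h0] <;> module

end Unfold

theorem signedArea_mul (ω a b c : ℂ) :
    signedArea (ω * a) (ω * b) (ω * c) = ‖ω‖ ^ 2 * signedArea a b c := by
  rw [← Complex.normSq_eq_norm_sq]
  simp only [signedArea_eq, Complex.normSq_apply, Complex.mul_re, Complex.mul_im]
  ring

/-! ### Orientation of the faces in local coordinates -/

namespace MarkedDisk

variable {d : ℕ} {S : MarkedDisk d}

theorem faceAngle_nonneg (f : Fin 3 → Pt d) (k : Fin 3) : 0 ≤ faceAngle f k :=
  EuclideanGeometry.angle_nonneg _ _ _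

theorem gam_pos {f : Fin 3 → Pt d} (hf : f ∈ S.faces) {k : Fin 3} (h : 0 < faceAngle f k) :
    0 < S.gam (f k) := by
  have h1 : 0 < S.angleSum (f k) := by
    unfold angleSum
    refine Finset.sum_pos' (fun g _ => Finset.sum_nonneg fun l _ => ?_) ⟨f, hf, ?_⟩
    · split_ifs
      exacts [faceAngle_nonneg g l, le_rfl]
    · refine Finset.sum_pos' (fun l _ => ?_) ⟨k, Finset.mem_univ _, by simpa using h⟩
      split_ifs
      exacts [faceAngle_nonneg f l, le_rfl]
  have h2 : 0 < S.targetAngle (f k) := by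
    have := Real.pi_pos
    unfold targetAngle
    split_ifs <;> positivity
  exact div_pos h2 h1

/-- Rescaling the sector by `|e|` makes the triangle a unit one, upright for `e > 0` and inverted
for `e < 0`. For `γ = 1` the area is elementary and no bound on the angle is needed. -/
theorem area_sectorPt_cpow_pos {b : ℝ} {c : ℂ} {γ e s t : ℝ} (hb : 0 < b) (hc : 0 < c.im)
    (hγ : 0 < γ) (hfine : γ = 1 ∨ (c.arg < Real.pi / 2 ∧ γ * c.arg < Real.pi / 2)) (he : e ≠ 0)
    (hs : 0 ≤ s) (ht : 0 ≤ t) (hs' : 0 ≤ s + e) (ht' : 0 ≤ t + e) :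
    0 < signedArea (sectorPt b c s t ^ (γ : ℂ)) (sectorPt b c (s + e) t ^ (γ : ℂ))
      (sectorPt b c s (t + e) ^ (γ : ℂ)) := by
  have hpi := Real.pi_pos
  rcases hfine with rfl | ⟨h1, h2⟩
  · have : signedArea (sectorPt b c s t) (sectorPt b c (s + e) t) (sectorPt b c s (t + e)) =
        e ^ 2 * (b * c.im) := by
      simp only [signedArea_eq, sectorPt_im, sectorPt_re]; ring
    simp only [Complex.ofReal_one, Complex.cpow_one, this]
    positivity
  · have hre : 0 < c.re := by
      have hc0 : c ≠ 0 := fun h => by simp [h] at hc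
      have hcos := Real.cos_pos_of_mem_Ioo (x := c.arg)
        ⟨by linarith [Complex.arg_nonneg_iff.2 hc.le], h1⟩
      rw [Complex.cos_arg hc0] at hcos
      exact (div_pos_iff_of_pos_right (norm_pos_iff.2 hc0)).1 hcos
    have scale : ∀ {r : ℝ}, r ≠ 0 → ∀ a a' : ℝ,
        sectorPt (r * b) (r * c) (a / r) (a' / r) = sectorPt b c a a' := by
      intro r hr a a'
      have : (r : ℂ) ≠ 0 := by exact_mod_cast hr
      simp only [sectorPt]
      push_cast
      field_simp
    rcases lt_or_gt_of_ne he with hneg | hpos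
    · have hr : 0 < -e := by linarith
      -- For an inverted triangle the base point is `(s + e, t + e)`, the fourth corner of the
      -- parallelogram. The corner `(s, t)` is then the far one.
      have key := signedArea_cpow_pos_of_down (b := -e * b) (c := ((-e : ℝ) : ℂ) * c) (γ := γ)
        (by positivity) (by rw [Complex.im_ofReal_mul]; positivity)
        (by rw [Complex.re_ofReal_mul]; positivity) hγ
        (by rw [Complex.arg_real_mul _ hr]; linarith)
        (s := (s + e) / -e) (t := (t + e) / -e) (by positivity) (by positivity)
      have es : (s + e) / -e + 1 = s / -e := by field_simp; ring
      have et : (t + e) / -e + 1 = t / -e := by field_simp; ring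
      rwa [es, et, scale hr.ne', scale hr.ne', scale hr.ne'] at key
    · have key := signedArea_cpow_pos_of_up (b := e * b) (c := (e : ℂ) * c) (γ := γ)
        (by positivity) (by rw [Complex.im_ofReal_mul]; positivity) hγ
        (by rw [Complex.arg_real_mul _ hpos]; linarith)
        (s := s / e) (t := t / e) (by positivity) (by positivity)
      have es : s / e + 1 = (s + e) / e := by field_simp
      have et : t / e + 1 = (t + e) / e := by field_simp
      rwa [es, et, scale hpos.ne', scale hpos.ne', scale hpos.ne'] at key

/-- The triangles of the discrete conformal structure are positively oriented. -/
theorem area_z_pos (hS : S.FineAngles) (𝒜 : S.Atlas) {q : ℕ} (hq : 2 ≤ q) (j : S.Face q) :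
    0 < area (𝒜.z hq j) := by
  set f := j.1.1 with hf
  have hfm : f ∈ S.faces := j.1.2
  set k := 𝒜.assoc (S.ancestor hq j) with hk
  have hmem : ∀ l, S.verts j l ∈ convexHull ℝ (Set.range f) := fun l => descend_mem _ _ l
  have hdom : ∀ l, S.verts j l ∈ S.chartDomain 𝒜.ζ (f k) := by
    intro l
    apply 𝒜.assoc_spec (S.ancestor hq j)
    have : S.verts j = descend (S.verts (S.ancestor hq j)) (j.2.1.drop 2) := by
      rw [verts, verts, ancestor, ← descend_append, List.take_append_drop]
    rw [this]
    exact descend_mem _ _ l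
  obtain ⟨ω, hω, hφ⟩ := 𝒜.chart f hfm k f hfm k rfl
  have hz : ∀ l, 𝒜.z hq j l = ω * unfold f k (S.verts j l) ^ ((S.gam (f k) : ℝ) : ℂ) :=
    fun l => hφ _ ⟨hdom l, hmem l⟩
  obtain ⟨b, c, hb, hc, harg, hun⟩ := exists_unfold_eq_sectorPt (S.indep f hfm) k
  obtain ⟨e, P, he, hP⟩ := exists_descend_eq (j.2.1) f
  have hcp : 0 < c.arg := lt_of_le_of_ne (Complex.arg_nonneg_iff.2 hc.le)
    fun h => hc.ne' (Complex.arg_eq_zero_iff.1 h.symm).2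
  obtain ⟨s, t, hs, ht, h0⟩ := exists_sector_coords k (hmem k)
  obtain ⟨s1, t1, hs1, ht1, h1⟩ := exists_sector_coords k (hmem (k + 1))
  obtain ⟨s2, t2, hs2, ht2, h2⟩ := exists_sector_coords k (hmem (k + 2))
  have e1 : S.verts j (k + 1) = f k + (s + e) • (f (k + 1) - f k) + t • (f (k + 2) - f k) := by
    have : S.verts j (k + 1) = S.verts j k + e • (f (k + 1) - f k) := by
      rw [verts, hP, hP]; module
    rw [this, h0]; module
  have e2 : S.verts j (k + 2) = f k + s • (f (k + 1) - f k) + (t + e) • (f (k + 2) - f k) := by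
    have : S.verts j (k + 2) = S.verts j k + e • (f (k + 2) - f k) := by
      rw [verts, hP, hP]; module
    rw [this, h0]; module
  -- Sector coordinates are unique, so `s + e` and, below, `t + e` are coordinates of points of the
  -- face and hence nonnegative.
  have n1 := (linearIndependent_edges (S.indep f hfm) k (s := s1 - (s + e)) (t := t1 - t) (by
    have := h1.symm.trans e1
    rw [← sub_eq_zero] at this
    rw [← this]; module)).1
  have n2 := (linearIndependent_edges (S.indep f hfm) k (s := s2 - s) (t := t2 - (t + e)) (by
    have := h2.symm.trans e2
    rw [← sub_eq_zero] at this
    rw [← this]; module)).2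
  rw [area, ← signedArea_cyclic _ k, hz, hz, hz, signedArea_mul, hω, one_pow, one_mul, e1, e2, h0,
    hun, hun, hun]
  refine area_sectorPt_cpow_pos hb hc (gam_pos hfm (harg ▸ hcp)) ?_ he hs ht (by linarith)
    (by linarith)
  rw [harg]
  exact hS f hfm k

end MarkedDisk

section

variable {d : ℕ}

/-! ### Subdivision: covering and interpolation -/

theorem child_some_apply (t : Fin 3 → Pt d) (k l : Fin 3) :
    child t (some k) l = midpoint ℝ (t k) (t l) := rfl

theorem child_none_apply (t : Fin 3 → Pt d) (l : Fin 3) :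
    child t none l = midpoint ℝ (t (l + 1)) (t (l + 2)) := rfl

theorem midpoint_eq_half {E : Type*} [AddCommGroup E] [Module ℝ E] (x y : E) :
    midpoint ℝ x y = (1 / 2 : ℝ) • (x + y) := by
  rw [midpoint_eq_smul_add, invOf_eq_inv, one_div]

/-- A weight of at least `1 / 2` puts the point in the corner triangle there, with weights `2 w l`
decreased by `1` at that corner. If all weights are below `1 / 2`, the point is in the middle
triangle with weights `1 - 2 w l`. -/
theorem hull_subset_iUnion_child (t : Fin 3 → Pt d) {p : Pt d}
    (hp : p ∈ convexHull ℝ (Set.range t)) : ∃ k, p ∈ convexHull ℝ (Set.range (child t k)) := by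
  obtain ⟨w, ⟨hw0, hw1⟩, rfl⟩ := (mem_convexHull_range_iff t p).1 hp
  rw [Fin.sum_univ_three] at hw1
  by_cases h : ∃ k, 1 / 2 ≤ w k
  · obtain ⟨k, hk⟩ := h
    refine ⟨some k, (mem_convexHull_range_iff _ _).2
      ⟨fun l => 2 * w l - if l = k then 1 else 0, ⟨fun l => ?_, ?_⟩, ?_⟩⟩
    · dsimp only
      split_ifs with hl
      · subst hl; linarith
      · have := hw0 l; linarith
    · simp only [Fin.sum_univ_three]
      fin_cases k <;> simp <;> linarith
    · have h0 : w 0 = 1 - w 1 - w 2 := by linarith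
      simp only [Fin.sum_univ_three, child_some_apply, midpoint_eq_half]
      fin_cases k <;> simp [h0] <;> module
  · push Not at h
    refine ⟨none, (mem_convexHull_range_iff _ _).2 ⟨fun l => 1 - 2 * w l, ⟨fun l => ?_, ?_⟩, ?_⟩⟩
    · have := h l; linarith
    · simp only [Fin.sum_univ_three]; linarith
    · have h0 : w 0 = 1 - w 1 - w 2 := by linarith
      simp only [Fin.sum_univ_three, child_none_apply, midpoint_eq_half]
      simp [h0]
      module

theorem exists_mem_hull_descend (q : ℕ) : ∀ (t : Fin 3 → Pt d) {p : Pt d},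
    p ∈ convexHull ℝ (Set.range t) →
      ∃ w : List (Option (Fin 3)), w.length = q ∧ p ∈ convexHull ℝ (Set.range (descend t w)) := by
  induction q with
  | zero => exact fun t p hp => ⟨[], rfl, hp⟩
  | succ q ih =>
    intro t p hp
    obtain ⟨k, hk⟩ := hull_subset_iUnion_child t hp
    obtain ⟨w, hw, hp'⟩ := ih (child t k) hk
    exact ⟨k :: w, by simp [hw], hp'⟩

/-! ### Independence of linear interpolation from the chosen face -/

theorem weights_unique_of_affineIndependent {f : Fin 3 → Pt d} (hf : AffineIndependent ℝ f)
    {w w' : Fin 3 → ℝ} (hw : ∑ l, w l = 1) (hw' : ∑ l, w' l = 1)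
    (h : ∑ l, w l • f l = ∑ l, w' l • f l) : w = w' := by
  ext k
  refine sub_eq_zero.1 (affineIndependent_iff.1 hf Finset.univ (fun l => w l - w' l) ?_ ?_ k
    (Finset.mem_univ k))
  · rw [Finset.sum_sub_distrib, hw, hw', sub_self]
  · simp only [sub_smul]
    rw [Finset.sum_sub_distrib, h, sub_self]

/-- Linear interpolation of vertex values over the triangles of the family `F` is well defined. -/
def SameInterp (F : Set (Fin 3 → Pt d)) : Prop :=
  ∀ f ∈ F, ∀ g ∈ F, ∀ w ∈ stdSimplex ℝ (Fin 3), ∀ w' ∈ stdSimplex ℝ (Fin 3),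
    ∑ l, w l • f l = ∑ l, w' l • g l → ∀ u : Pt d → ℂ, ∑ l, w l • u (f l) = ∑ l, w' l • u (g l)

/-- The points having representations in both faces with equal interpolated values form a convex set
containing the common vertices, hence all of the intersection. Uniqueness of barycentric weights
passes from these representations to the given ones. -/
theorem MarkedDisk.sameInterp_faces (S : MarkedDisk d) : SameInterp (S.faces : Set (Fin 3 → Pt d)) := by
  intro f hf g hg w hw w' hw' h u
  have hf' := S.indep f hf
  have hg' := S.indep g hg
  rcases eq_or_ne f g with rfl | hne
  · rw [weights_unique_of_affineIndependent hf' hw.2 hw'.2 h]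
  · have hC : convexHull ℝ (Set.range f ∩ Set.range g) ⊆ {p | ∃ w ∈ stdSimplex ℝ (Fin 3),
        ∃ w' ∈ stdSimplex ℝ (Fin 3), p = ∑ l, w l • f l ∧ p = ∑ l, w' l • g l ∧
          ∑ l, w l • u (f l) = ∑ l, w' l • u (g l)} := by
      apply convexHull_min
      · rintro _ ⟨⟨k, rfl⟩, ⟨l, hl⟩⟩
        refine ⟨Pi.single k 1, single_mem_stdSimplex ℝ k, Pi.single l 1,
          single_mem_stdSimplex ℝ l, ?_, ?_, ?_⟩ <;> simp [Pi.single_apply, ite_smul, hl]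
      · rintro _ ⟨w₁, h₁, w₁', h₁', rfl, e₁, i₁⟩ _ ⟨w₂, h₂, w₂', h₂', rfl, e₂, i₂⟩ a b ha hb hab
        refine ⟨a • w₁ + b • w₂, convex_stdSimplex ℝ _ h₁ h₂ ha hb hab, a • w₁' + b • w₂',
          convex_stdSimplex ℝ _ h₁' h₂' ha hb hab, ?_, ?_, ?_⟩
        · simp only [Pi.add_apply, Pi.smul_apply, smul_eq_mul, add_smul, mul_smul,
            Finset.sum_add_distrib, ← Finset.smul_sum]
        · rw [e₁, e₂]
          simp only [Pi.add_apply, Pi.smul_apply, smul_eq_mul, add_smul, mul_smul,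
            Finset.sum_add_distrib, ← Finset.smul_sum]
        · simp only [Pi.add_apply, Pi.smul_apply, smul_eq_mul, add_smul, mul_smul,
            Finset.sum_add_distrib, ← Finset.smul_sum]
          rw [i₁, i₂]
    obtain ⟨v, hv, v', hv', e, e', i⟩ := hC (S.inter f hf g hg hne
      ⟨(mem_convexHull_range_iff f _).2 ⟨w, hw, rfl⟩,
        (mem_convexHull_range_iff g _).2 ⟨w', hw', h⟩⟩)
    rw [weights_unique_of_affineIndependent hf' hw.2 hv.2 e,
      weights_unique_of_affineIndependent hg' hw'.2 hv'.2 (h.symm.trans e'), i]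

/-- The weight of a vertex of weight `x` after one subdivision. -/
def cornerWeight (x : ℝ) : ℝ := max 0 (2 * x - 1)

/-- The weight of the midpoint of two vertices of weights `x`, `y` after one subdivision. -/
def midWeight (x y : ℝ) : ℝ := max 0 (min (min (2 * x) (2 * y)) (2 * (x + y) - 1))

theorem midWeight_comm (x y : ℝ) : midWeight x y = midWeight y x := by
  rw [midWeight, midWeight, min_comm (2 * x), add_comm]

theorem midWeight_zero_left (y : ℝ) : midWeight 0 y = 0 := by
  rw [midWeight, max_eq_left]
  exact (min_le_left _ _).trans ((min_le_left _ _).trans (by simp))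

/-- The weights with respect to `t` of a point with weights `w` with respect to `child t k`. -/
def parentWeight (w : Fin 3 → ℝ) : Option (Fin 3) → Fin 3 → ℝ
  | some k => fun l => (w l + if l = k then 1 else 0) / 2
  | none => fun l => (1 - w l) / 2

theorem parentWeight_mem {w : Fin 3 → ℝ} (hw : w ∈ stdSimplex ℝ (Fin 3)) (k : Option (Fin 3)) :
    parentWeight w k ∈ stdSimplex ℝ (Fin 3) := by
  have h1 := hw.2
  rw [Fin.sum_univ_three] at h1
  cases k with
  | none =>
    refine ⟨fun l => ?_, ?_⟩
    · have : w l ≤ 1 := by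
        rw [← hw.2]; exact Finset.single_le_sum (fun i _ => hw.1 i) (Finset.mem_univ l)
      simp only [parentWeight]; linarith
    · simp only [parentWeight, Fin.sum_univ_three]; linarith
  | some k =>
    refine ⟨fun l => ?_, ?_⟩
    · have := hw.1 l
      simp only [parentWeight]; split_ifs <;> linarith
    · simp only [parentWeight, Fin.sum_univ_three]
      fin_cases k <;> simp <;> linarith

theorem sum_parentWeight {w : Fin 3 → ℝ} (hw : w ∈ stdSimplex ℝ (Fin 3)) (k : Option (Fin 3))
    (t : Fin 3 → Pt d) : ∑ l, parentWeight w k l • t l = ∑ l, w l • child t k l := by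
  have h1 := hw.2
  rw [Fin.sum_univ_three] at h1
  have h0 : w 0 = 1 - w 1 - w 2 := by linarith
  cases k with
  | none =>
    simp only [parentWeight, Fin.sum_univ_three, child_none_apply, midpoint_eq_half]
    simp [h0]
    module
  | some k =>
    simp only [parentWeight, Fin.sum_univ_three, child_some_apply, midpoint_eq_half]
    fin_cases k <;> simp [h0] <;> module

/-- The subdivided interpolation is expressed by the hat functions of the new vertices in the
coordinates of the parent, in a form that does not depend on the child. Each midpoint occurs for two
ordered pairs, hence the division by `2`. -/
theorem sum_child_eq_weights {w : Fin 3 → ℝ} (hw : w ∈ stdSimplex ℝ (Fin 3)) (k : Option (Fin 3))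
    (t : Fin 3 → Pt d) (u : Pt d → ℂ) : ∑ l, w l • u (child t k l) =
      ∑ i, ∑ j, (if i = j then cornerWeight (parentWeight w k i) else
        midWeight (parentWeight w k i) (parentWeight w k j) / 2) • u (midpoint ℝ (t i) (t j)) := by
  have h1 := hw.2
  rw [Fin.sum_univ_three] at h1
  have p0 := hw.1 0
  have p1 := hw.1 1
  have p2 := hw.1 2
  have c10 : midpoint ℝ (t 1) (t 0) = midpoint ℝ (t 0) (t 1) := midpoint_comm _ _
  have c20 : midpoint ℝ (t 2) (t 0) = midpoint ℝ (t 0) (t 2) := midpoint_comm _ _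
  have c21 : midpoint ℝ (t 2) (t 1) = midpoint ℝ (t 1) (t 2) := midpoint_comm _ _
  have cz : ∀ x : ℝ, 2 * x - 1 ≤ 0 → cornerWeight x = 0 := fun x hx => max_eq_left hx
  have cp : ∀ x y : ℝ, 0 ≤ y → 2 * x - 1 = y → cornerWeight x = y := fun x y hy hx => by
    rw [cornerWeight, hx, max_eq_right hy]
  have mz : ∀ x y : ℝ, 2 * (x + y) - 1 ≤ 0 → midWeight x y = 0 := fun x y h =>
    max_eq_left ((min_le_right _ _).trans h)
  have ml : ∀ x y : ℝ, 0 ≤ y → y ≤ x → 1 / 2 ≤ x → midWeight x y = 2 * y := fun x y h h' h'' => by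
    rw [midWeight, min_eq_right (by linarith : 2 * y ≤ 2 * x),
      min_eq_left (by linarith : 2 * y ≤ 2 * (x + y) - 1), max_eq_right (by linarith)]
  have mm : ∀ x y : ℝ, x ≤ 1 / 2 → y ≤ 1 / 2 → 0 ≤ 2 * (x + y) - 1 →
      midWeight x y = 2 * (x + y) - 1 := fun x y h h' h'' => by
    rw [midWeight, min_eq_right (le_min (by linarith) (by linarith)), max_eq_right h'']
  cases k with
  | none =>
    simp only [Fin.sum_univ_three, child_none_apply, parentWeight]
    rw [midWeight_comm ((1 - w 1) / 2) ((1 - w 0) / 2),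
      midWeight_comm ((1 - w 2) / 2) ((1 - w 0) / 2), midWeight_comm ((1 - w 2) / 2) ((1 - w 1) / 2),
      cz ((1 - w 0) / 2) (by linarith), cz ((1 - w 1) / 2) (by linarith),
      cz ((1 - w 2) / 2) (by linarith),
      mm ((1 - w 0) / 2) ((1 - w 1) / 2) (by linarith) (by linarith) (by linarith),
      mm ((1 - w 0) / 2) ((1 - w 2) / 2) (by linarith) (by linarith) (by linarith),
      mm ((1 - w 1) / 2) ((1 - w 2) / 2) (by linarith) (by linarith) (by linarith), c10, c20, c21]
    have h0 : w 0 = 1 - w 1 - w 2 := by linarith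
    simp [c20, h0]
    ring
  | some k =>
    have h0 : w 0 = 1 - w 1 - w 2 := by linarith
    fin_cases k <;>
    simp only [Fin.sum_univ_three, child_some_apply, parentWeight, Fin.isValue, Fin.zero_eta,
      Fin.mk_one, Fin.reduceFinMk, Fin.reduceEq, if_true, if_false, add_zero, midpoint_self,
      zero_ne_one, one_ne_zero, c10, c20, c21]
    · rw [midWeight_comm (w 1 / 2), midWeight_comm (w 2 / 2) ((w 0 + 1) / 2),
        midWeight_comm (w 2 / 2) (w 1 / 2), cp ((w 0 + 1) / 2) (w 0) p0 (by ring),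
        cz (w 1 / 2) (by linarith), cz (w 2 / 2) (by linarith),
        ml ((w 0 + 1) / 2) (w 1 / 2) (by linarith) (by linarith) (by linarith),
        ml ((w 0 + 1) / 2) (w 2 / 2) (by linarith) (by linarith) (by linarith),
        mz (w 1 / 2) (w 2 / 2) (by linarith)]
      simp
      ring
    · rw [midWeight_comm (w 0 / 2) ((w 1 + 1) / 2), midWeight_comm (w 2 / 2) ((w 1 + 1) / 2),
        midWeight_comm (w 2 / 2) (w 0 / 2), cp ((w 1 + 1) / 2) (w 1) p1 (by ring),
        cz (w 0 / 2) (by linarith), cz (w 2 / 2) (by linarith),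
        ml ((w 1 + 1) / 2) (w 0 / 2) (by linarith) (by linarith) (by linarith),
        ml ((w 1 + 1) / 2) (w 2 / 2) (by linarith) (by linarith) (by linarith),
        mz (w 0 / 2) (w 2 / 2) (by linarith)]
      simp
      ring
    · rw [midWeight_comm (w 0 / 2) ((w 2 + 1) / 2), midWeight_comm (w 1 / 2) ((w 2 + 1) / 2),
        midWeight_comm (w 1 / 2) (w 0 / 2), cp ((w 2 + 1) / 2) (w 2) p2 (by ring),
        cz (w 0 / 2) (by linarith), cz (w 1 / 2) (by linarith),
        ml ((w 2 + 1) / 2) (w 0 / 2) (by linarith) (by linarith) (by linarith),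
        ml ((w 2 + 1) / 2) (w 1 / 2) (by linarith) (by linarith) (by linarith),
        mz (w 0 / 2) (w 1 / 2) (by linarith)]
      simp
      ring

theorem sum_eq_sum_comp {V : Finset (Pt d)} {f : Fin 3 → Pt d} (hf : Function.Injective f)
    (hV : ∀ l, f l ∈ V) {h : Pt d → ℂ} (h0 : ∀ a, a ∉ Set.range f → h a = 0) :
    ∑ a ∈ V, h a = ∑ l, h (f l) := by
  classical
  rw [← Finset.sum_image (s := Finset.univ) (g := f) (f := h) (fun a _ b _ hab => hf hab)]
  symm
  refine Finset.sum_subset (fun a ha => ?_) (fun a _ ha => h0 a fun ⟨l, hl⟩ => ha ?_)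
  · obtain ⟨l, -, rfl⟩ := Finset.mem_image.1 ha
    exact hV l
  · exact Finset.mem_image.2 ⟨l, Finset.mem_univ _, hl⟩

/-- The triangles of the subdivision of the triangles of a family. -/
def subdivision (F : Set (Fin 3 → Pt d)) : Set (Fin 3 → Pt d) := {g | ∃ f ∈ F, ∃ k, g = child f k}

theorem descend_injective {f : Fin 3 → Pt d} (hf : Function.Injective f)
    (w : List (Option (Fin 3))) : Function.Injective (descend f w) := by
  obtain ⟨e, P, he, h⟩ := exists_descend_eq w f
  intro a b hab
  rw [h, h] at hab
  exact hf (smul_right_injective _ he (add_left_cancel hab))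

-- A vertex of weight zero contributes nothing to the hat functions. The sum can therefore run over
-- any finite set containing the vertices of the face, which allows faces with different vertices to
-- be compared.
open Classical in
theorem sum_child_eq_intrinsic {w : Fin 3 → ℝ} (hw : w ∈ stdSimplex ℝ (Fin 3))
    (k : Option (Fin 3)) {f : Fin 3 → Pt d} (hf : Function.Injective f) (u : Pt d → ℂ)
    {V : Finset (Pt d)} (hV : ∀ l, f l ∈ V) {lam : Pt d → ℝ}
    (hlam : ∀ l, lam (f l) = parentWeight w k l) (hlam0 : ∀ a, a ∉ Set.range f → lam a = 0) :
    ∑ l, w l • u (child f k l) = ∑ a ∈ V, ∑ b ∈ V,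
      (if a = b then cornerWeight (lam a) else midWeight (lam a) (lam b) / 2) •
        u (midpoint ℝ a b) := by
  have c0 : cornerWeight 0 = 0 := by simp [cornerWeight]
  rw [sum_child_eq_weights hw, sum_eq_sum_comp hf hV]
  · refine Finset.sum_congr rfl fun i _ => ?_
    rw [sum_eq_sum_comp hf hV]
    · refine Finset.sum_congr rfl fun j _ => ?_
      simp only [hlam, hf.eq_iff]
    · intro a ha
      have : f i ≠ a := fun h => ha ⟨i, h⟩
      rw [if_neg this, hlam0 a ha, midWeight_comm, midWeight_zero_left]; simp
  · intro a ha
    refine Finset.sum_eq_zero fun b _ => ?_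
    rw [hlam0 a ha, c0, midWeight_zero_left]; simp

-- Testing the hypothesis on the indicator function of each vertex shows that the two parent
-- representations induce the same weight function `lam` on points. The intrinsic formula depends on
-- `lam` only.
open Classical in
theorem SameInterp.subdivision {F : Set (Fin 3 → Pt d)} (hF : SameInterp F)
    (hinj : ∀ f ∈ F, Function.Injective f) : SameInterp (subdivision F) := by
  rintro _ ⟨f, hf, k, rfl⟩ _ ⟨g, hg, k', rfl⟩ w hw w' hw' h u
  rw [← sum_parentWeight hw, ← sum_parentWeight hw'] at h
  have key := hF f hf g hg _ (parentWeight_mem hw k) _ (parentWeight_mem hw' k') h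
  set lam : Pt d → ℝ := fun a => ∑ l, if f l = a then parentWeight w k l else 0 with hlam
  have hlam' : lam = fun a => ∑ l, if g l = a then parentWeight w' k' l else 0 := by
    ext a
    have := key (fun b => if b = a then 1 else 0)
    simp only [smul_ite, Complex.real_smul, mul_one, smul_zero] at this
    apply Complex.ofReal_injective
    simpa only [hlam, Complex.ofReal_sum, apply_ite Complex.ofReal, Complex.ofReal_zero] using this
  rw [sum_child_eq_intrinsic (V := Finset.univ.image f ∪ Finset.univ.image g) (lam := lam) hw k
      (hinj f hf) u (by simp) (fun l => by simp [hlam, (hinj f hf).eq_iff])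
      (fun a ha => Finset.sum_eq_zero fun l _ => if_neg fun hl => ha ⟨l, hl⟩),
    sum_child_eq_intrinsic (V := Finset.univ.image f ∪ Finset.univ.image g) (lam := lam) hw' k'
      (hinj g hg) u (by simp) (fun l => by simp [hlam', (hinj g hg).eq_iff])
      (fun a ha => by rw [hlam']; exact Finset.sum_eq_zero fun l _ => if_neg fun hl => ha ⟨l, hl⟩)]

theorem SameInterp.descend (q : ℕ) : ∀ {F : Set (Fin 3 → Pt d)}, SameInterp F →
    (∀ f ∈ F, Function.Injective f) →
    SameInterp {g | ∃ f ∈ F, ∃ w : List (Option (Fin 3)), w.length = q ∧ g = descend f w} := by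
  induction q with
  | zero =>
    intro F hF _
    convert hF using 1
    ext g
    constructor
    · rintro ⟨f, hf, w, hw, rfl⟩
      rw [List.length_eq_zero_iff.1 hw]
      exact hf
    · exact fun h => ⟨g, h, [], rfl, rfl⟩
  | succ q ih =>
    intro F hF hinj
    have := ih (hF.subdivision hinj) (by
      rintro _ ⟨f, hf, k, rfl⟩
      exact descend_injective (hinj f hf) [k])
    convert this using 1
    ext g
    constructor
    · rintro ⟨f, hf, w, hw, rfl⟩
      cases w with
      | nil => simp at hw
      | cons k w => exact ⟨child f k, ⟨f, hf, k, rfl⟩, w, by simpa using hw, rfl⟩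
    · rintro ⟨_, ⟨f, hf, k, rfl⟩, w, hw, rfl⟩
      exact ⟨f, hf, k :: w, by simpa using hw, rfl⟩

theorem MarkedDisk.interp_eq (S : MarkedDisk d) {q : ℕ} (i j : S.Face q) {w w' : Fin 3 → ℝ}
    (hw : w ∈ stdSimplex ℝ (Fin 3)) (hw' : w' ∈ stdSimplex ℝ (Fin 3))
    (h : ∑ l, w l • S.verts i l = ∑ l, w' l • S.verts j l) (u : Pt d → ℂ) :
    ∑ l, w l • u (S.verts i l) = ∑ l, w' l • u (S.verts j l) :=
  S.sameInterp_faces.descend q (fun f hf => (S.indep f hf).injective) _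
    ⟨i.1.1, i.1.2, i.2.1, i.2.2, rfl⟩ _ ⟨j.1.1, j.1.2, j.2.1, j.2.2, rfl⟩ w hw w' hw' h u

theorem MarkedDisk.exists_face (S : MarkedDisk d) (q : ℕ) {p : Pt d} (hp : p ∈ S.carrier) :
    ∃ j : S.Face q, p ∈ convexHull ℝ (Set.range (S.verts j)) := by
  obtain ⟨f, hf, hp⟩ := Set.mem_iUnion₂.1 hp
  obtain ⟨w, hw, hp'⟩ := exists_mem_hull_descend q f hp
  exact ⟨(⟨f, hf⟩, ⟨w, hw⟩), hp'⟩

end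

section

variable {d : ℕ}

/-! ### Sums over directed edges -/

/-- The sum of `F` over the directed edges of a triangle. -/
def edgeSum (F : Pt d → Pt d → ℝ) (t : Fin 3 → Pt d) : ℝ := ∑ k, F (t k) (t (k + 1))

/-- The sum of `F` over the two halves of a directed edge. -/
def halvesSum (F : Pt d → Pt d → ℝ) (a b : Pt d) : ℝ :=
  F a (midpoint ℝ a b) + F (midpoint ℝ a b) b

theorem halvesSum_antisymm {F : Pt d → Pt d → ℝ} (hF : ∀ a b, F b a = -F a b) (a b : Pt d) :
    halvesSum F b a = -halvesSum F a b := by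
  rw [halvesSum, halvesSum, midpoint_comm b a, hF _ b, hF a]
  ring

theorem iterate_halvesSum_antisymm {F : Pt d → Pt d → ℝ} (hF : ∀ a b, F b a = -F a b) (q : ℕ) :
    ∀ a b, halvesSum^[q] F b a = -halvesSum^[q] F a b := by
  induction q with
  | zero => exact hF
  | succ q ih =>
    rw [Function.iterate_succ_apply']
    exact halvesSum_antisymm ih

/-- The three sides of the middle triangle are also traversed, in the opposite direction, by the
corner triangles. Only the halves of the outer edges survive. -/
theorem sum_edgeSum_child {F : Pt d → Pt d → ℝ} (hF : ∀ a b, F b a = -F a b) (t : Fin 3 → Pt d) :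
    ∑ k, edgeSum F (child t k) = edgeSum (halvesSum F) t := by
  have c10 : midpoint ℝ (t 1) (t 0) = midpoint ℝ (t 0) (t 1) := midpoint_comm _ _
  have c20 : midpoint ℝ (t 2) (t 0) = midpoint ℝ (t 0) (t 2) := midpoint_comm _ _
  have c21 : midpoint ℝ (t 2) (t 1) = midpoint ℝ (t 1) (t 2) := midpoint_comm _ _
  rw [Fintype.sum_option]
  simp only [edgeSum, halvesSum, Fin.sum_univ_three, child_some_apply, child_none_apply, zero_add,
    Fin.reduceAdd, midpoint_self, c10, c20, c21]
  rw [hF (midpoint ℝ (t 0) (t 2)) (midpoint ℝ (t 1) (t 2)),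
    hF (midpoint ℝ (t 0) (t 1)) (midpoint ℝ (t 0) (t 2)),
    hF (midpoint ℝ (t 0) (t 1)) (midpoint ℝ (t 1) (t 2))]
  ring

instance (q : ℕ) : Fintype {w : List (Option (Fin 3)) // w.length = q} :=
  inferInstanceAs (Fintype (List.Vector (Option (Fin 3)) q))

/-- A word of length `q + 1` is a letter followed by a word of length `q`. -/
def wordCons (q : ℕ) : Option (Fin 3) × {w : List (Option (Fin 3)) // w.length = q} ≃
    {w : List (Option (Fin 3)) // w.length = q + 1} where
  toFun x := ⟨x.1 :: x.2.1, by simp [x.2.2]⟩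
  invFun w := (w.1.head (fun h => by have := w.2; simp [h] at this), ⟨w.1.tail, by simp [w.2]⟩)
  left_inv x := by simp
  right_inv w := by simp

theorem sum_edgeSum_descend (q : ℕ) : ∀ {F : Pt d → Pt d → ℝ} (_ : ∀ a b, F b a = -F a b)
    (t : Fin 3 → Pt d), ∑ w : {w : List (Option (Fin 3)) // w.length = q},
      edgeSum F (descend t w.1) = edgeSum (halvesSum^[q] F) t := by
  induction q with
  | zero =>
    intro F _ t
    have : Unique {w : List (Option (Fin 3)) // w.length = 0} :=
      ⟨⟨⟨[], rfl⟩⟩, fun w => Subtype.ext (List.length_eq_zero_iff.1 w.2)⟩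
    rw [Fintype.sum_unique]
    rw [List.length_eq_zero_iff.1 (default : {w : List (Option (Fin 3)) // w.length = 0}).2]
    rfl
  | succ q ih =>
    intro F hF t
    rw [← (wordCons q).sum_comp, Fintype.sum_prod_type]
    have h : ∀ k ∈ Finset.univ, ∑ w : {w : List (Option (Fin 3)) // w.length = q},
        edgeSum F (descend t (wordCons q (k, w)).1) = edgeSum (halvesSum^[q] F) (child t k) :=
      fun k _ => ih hF (child t k)
    rw [Finset.sum_congr rfl h, sum_edgeSum_child (iterate_halvesSum_antisymm hF q),
      Function.iterate_succ_apply']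

namespace MarkedDisk

variable (S : MarkedDisk d)

theorem m_pos : 0 < S.m := by
  rw [← S.c_three, ← S.c_zero]
  exact S.c_strictMono (by decide)

-- By consistent orientation every directed edge occurs once. Edges present in both directions
-- cancel in pairs, and the remaining ones are exactly the boundary edges.
open Classical in
theorem sum_edgeSum_faces {F : Pt d → Pt d → ℝ} (hF : ∀ a b, F b a = -F a b) :
    ∑ f ∈ S.faces, edgeSum F f = ∑ n ∈ Finset.range S.m, F (S.bd n) (S.bd (n + 1)) := by
  set D : Finset (Pt d × Pt d) :=
    (S.faces ×ˢ (Finset.univ : Finset (Fin 3))).image fun x => (x.1 x.2, x.1 (x.2 + 1)) with hD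
  have hmem : ∀ a b, (a, b) ∈ D ↔ ∃ f ∈ S.faces, IsDirEdge f a b := by
    intro a b
    simp only [hD, Finset.mem_image, Finset.mem_product, Finset.mem_univ, and_true, Prod.exists,
      Prod.mk.injEq, IsDirEdge]
    constructor
    · rintro ⟨f, k, hf, h1, h2⟩
      exact ⟨f, hf, k, h1, h2⟩
    · rintro ⟨f, hf, k, h1, h2⟩
      exact ⟨f, k, hf, h1, h2⟩
  have e1 : ∑ f ∈ S.faces, edgeSum F f = ∑ e ∈ D, F e.1 e.2 := by
    rw [hD, Finset.sum_image, Finset.sum_product]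
    · rfl
    · rintro ⟨f, k⟩ hf ⟨g, l⟩ hg h
      simp only [Finset.coe_product, Finset.coe_univ, Set.mem_prod, Finset.mem_coe, Set.mem_univ,
        and_true] at hf hg
      simp only [Prod.mk.injEq] at h
      have hfg : f = g := S.oriented f hf g hg _ _ ⟨k, rfl, rfl⟩ ⟨l, h.1.symm, h.2.symm⟩
      subst hfg
      rw [(S.indep f hf).injective h.1]
  rw [e1, ← Finset.sum_filter_add_sum_filter_not D (fun e => e.swap ∈ D)]
  have e2 : ∑ e ∈ D with e.swap ∈ D, F e.1 e.2 = 0 := by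
    refine Finset.sum_involution (fun e _ => e.swap) ?_ ?_ ?_ ?_
    · rintro ⟨a, b⟩ _
      simp [hF a b]
    · rintro ⟨a, b⟩ _ h1 h2
      simp only [Prod.swap_prod_mk, Prod.mk.injEq] at h2
      obtain ⟨rfl, -⟩ := h2
      have := hF b b
      exact h1 (by simp only; linarith)
    · rintro ⟨a, b⟩ h
      simpa [and_comm] using h
    · rintro ⟨a, b⟩ _
      rfl
  rw [e2, zero_add]
  have e3 : (D.filter fun e => ¬ e.swap ∈ D) =
      (Finset.range S.m).image fun n : ℕ => (S.bd n, S.bd (n + 1)) := by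
    have : NeZero S.m := ⟨S.m_pos.ne'⟩
    ext ⟨a, b⟩
    simp only [Finset.mem_filter, Prod.swap_prod_mk, hmem, Finset.mem_image, Finset.mem_range,
      Prod.mk.injEq]
    rw [S.bd_spec]
    constructor
    · rintro ⟨i, h1, h2⟩
      exact ⟨i.val, ZMod.val_lt i, by simpa using h1, by simpa using h2⟩
    · rintro ⟨n, _, h1, h2⟩
      exact ⟨n, h1, h2⟩
  rw [e3, Finset.sum_image]
  intro a ha b hb h
  simp only [Prod.mk.injEq] at h
  have := S.bd_injective h.1
  rw [ZMod.natCast_eq_natCast_iff'] at this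
  rwa [Nat.mod_eq_of_lt (by simpa using ha), Nat.mod_eq_of_lt (by simpa using hb)] at this

/-! ### The subdivided boundary -/

theorem bdVertex_zero (n : ℕ) : S.bdVertex 0 n = S.bd n := by
  simp [bdVertex, Nat.mod_one]

theorem bdVertex_mul (q n : ℕ) : S.bdVertex q (n * 2 ^ q) = S.bd n := by
  simp [bdVertex]

/-- The parameter may reach `1` here instead of passing to the next boundary edge of `S`. Both ends
of an edge of the subdivision are thus expressed on the same edge of `S`. -/
theorem bdVertex_add_one (q n : ℕ) : S.bdVertex q (n + 1) =
    AffineMap.lineMap (S.bd ((n / 2 ^ q : ℕ) : ZMod S.m)) (S.bd ((n / 2 ^ q : ℕ) + 1 : ZMod S.m))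
      (((n % 2 ^ q : ℕ) + 1 : ℝ) / 2 ^ q) := by
  have hp : 0 < 2 ^ q := by positivity
  have hlt := Nat.mod_lt n hp
  have hdm := Nat.div_add_mod n (2 ^ q)
  rcases Nat.lt_or_ge (n % 2 ^ q + 1) (2 ^ q) with h | h
  · have h1 : (n + 1) / 2 ^ q = n / 2 ^ q := by
      conv_lhs => rw [← hdm, add_assoc, Nat.mul_add_div hp, Nat.div_eq_of_lt h, add_zero]
    have h2 : (n + 1) % 2 ^ q = n % 2 ^ q + 1 := by
      rw [Nat.add_mod, Nat.mod_eq_of_lt (a := n % 2 ^ q + 1 % 2 ^ q)]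
      · rcases Nat.lt_or_ge 1 (2 ^ q) with h3 | h3
        · rw [Nat.mod_eq_of_lt h3]
        · omega
      · rcases Nat.lt_or_ge 1 (2 ^ q) with h3 | h3
        · rwa [Nat.mod_eq_of_lt h3]
        · omega
    rw [bdVertex, h1, h2]
    push_cast
    rfl
  · have h0 : n % 2 ^ q + 1 = 2 ^ q := by omega
    have h1 : n + 1 = (n / 2 ^ q + 1) * 2 ^ q := by rw [add_mul, one_mul, mul_comm]; omega
    have h2 : ((n % 2 ^ q : ℕ) + 1 : ℝ) = 2 ^ q := by exact_mod_cast h0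
    rw [h1, bdVertex_mul, h2, div_self (by positivity), AffineMap.lineMap_apply_one]
    push_cast
    rfl

theorem bdVertex_succ_two_mul (q n : ℕ) : S.bdVertex (q + 1) (2 * n) = S.bdVertex q n := by
  rw [bdVertex, bdVertex, pow_succ', Nat.mul_div_mul_left _ _ two_pos,
    Nat.mul_mod_mul_left]
  congr 1
  push_cast
  rw [pow_succ']
  field_simp

theorem bdVertex_succ_two_mul_add_one (q n : ℕ) : S.bdVertex (q + 1) (2 * n + 1) =
    midpoint ℝ (S.bdVertex q n) (S.bdVertex q (n + 1)) := by
  rw [bdVertex_add_one, bdVertex_add_one, pow_succ' 2 q, Nat.mul_div_mul_left _ _ two_pos,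
    Nat.mul_mod_mul_left, bdVertex, midpoint_eq_half]
  simp only [AffineMap.lineMap_apply_module]
  have e : (((2 * (n % 2 ^ q) : ℕ) : ℝ) + 1) / 2 ^ (q + 1) =
      (((n % 2 ^ q : ℕ) : ℝ) / 2 ^ q + (((n % 2 ^ q : ℕ) : ℝ) + 1) / 2 ^ q) / 2 := by
    push_cast
    rw [pow_succ']
    field_simp
    ring
  rw [e]
  module

theorem sum_bdVertex_succ (F : Pt d → Pt d → ℝ) (q N : ℕ) :
    ∑ n ∈ Finset.range (2 * N), F (S.bdVertex (q + 1) n) (S.bdVertex (q + 1) (n + 1)) =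
      ∑ n ∈ Finset.range N, halvesSum F (S.bdVertex q n) (S.bdVertex q (n + 1)) := by
  induction N with
  | zero => rfl
  | succ N ih =>
    rw [mul_add, mul_one, Finset.sum_range_succ, Finset.sum_range_succ, ih, Finset.sum_range_succ,
      bdVertex_succ_two_mul_add_one, bdVertex_succ_two_mul,
      show 2 * N + 1 + 1 = 2 * (N + 1) by ring, bdVertex_succ_two_mul, halvesSum, add_assoc]

theorem sum_bdVertex (q : ℕ) : ∀ F : Pt d → Pt d → ℝ,
    ∑ n ∈ Finset.range (S.m * 2 ^ q), F (S.bdVertex q n) (S.bdVertex q (n + 1)) =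
      ∑ n ∈ Finset.range S.m, (halvesSum^[q] F) (S.bd n) (S.bd (n + 1)) := by
  induction q with
  | zero =>
    intro F
    rw [pow_zero, mul_one]
    refine Finset.sum_congr rfl fun n _ => ?_
    rw [bdVertex_zero, bdVertex_zero]
    push_cast
    rfl
  | succ q ih =>
    intro F
    rw [pow_succ', mul_left_comm, sum_bdVertex_succ, ih (halvesSum F), Function.iterate_succ_apply]

/-- A discrete Stokes formula. Cancellation inside each face of `S` and then between faces reduces
the left side to the sum of `halvesSum^[q] F` over the boundary edges of `S`, and refining the
boundary unfolds the right side to the same sum. -/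
theorem sum_edges (q : ℕ) {F : Pt d → Pt d → ℝ} (hF : ∀ a b, F b a = -F a b) :
    ∑ j : S.Face q, ∑ k, F (S.verts j k) (S.verts j (k + 1)) =
      ∑ n ∈ Finset.range (S.m * 2 ^ q), F (S.bdVertex q n) (S.bdVertex q (n + 1)) := by
  rw [sum_bdVertex, ← S.sum_edgeSum_faces (iterate_halvesSum_antisymm hF q),
    Fintype.sum_prod_type, ← Finset.sum_coe_sort S.faces]
  exact Finset.sum_congr rfl fun f _ => sum_edgeSum_descend q hF f.1

/-- If a boundary edge is the `k`-th edge of a face, its first half belongs to the corner child at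
`k` and its second half to the one at `k + 1`, again as the `k`-th edge. -/
theorem exists_face_of_bdVertex (q : ℕ) : ∀ n < S.m * 2 ^ q, ∃ (j : S.Face q) (k : Fin 3),
    S.verts j k = S.bdVertex q n ∧ S.verts j (k + 1) = S.bdVertex q (n + 1) := by
  induction q with
  | zero =>
    intro n _
    obtain ⟨⟨f, hf, k, h1, h2⟩, -⟩ := (S.bd_spec (S.bd n) (S.bd (n + 1))).2 ⟨n, rfl, rfl⟩
    refine ⟨(⟨f, hf⟩, ⟨[], rfl⟩), k, ?_, ?_⟩
    · rw [bdVertex_zero]; exact h1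
    · rw [bdVertex_zero]; push_cast; exact h2
  | succ q ih =>
    intro n hn
    obtain ⟨⟨f, w⟩, k, h1, h2⟩ := ih (n / 2) (by rw [pow_succ, ← mul_assoc] at hn; omega)
    have hc : ∀ l : Option (Fin 3), ∃ j : S.Face (q + 1),
        S.verts j = child (S.verts (q := q) (f, w)) l :=
      fun l => ⟨(f, ⟨w.1 ++ [l], by simp [w.2]⟩), descend_append w.1 [l] f.1⟩
    rcases Nat.mod_two_eq_zero_or_one n with h | h
    · have hn2 : n = 2 * (n / 2) := by omega
      obtain ⟨j, hj⟩ := hc (some k)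
      refine ⟨j, k, ?_, ?_⟩
      · rw [hj, child_some_apply, h1, midpoint_self, hn2, bdVertex_succ_two_mul, ← hn2]
      · rw [hj, child_some_apply, h1, h2, hn2, bdVertex_succ_two_mul_add_one, ← hn2]
    · have hn2 : n = 2 * (n / 2) + 1 := by omega
      obtain ⟨j, hj⟩ := hc (some (k + 1))
      refine ⟨j, k, ?_, ?_⟩
      · rw [hj, child_some_apply, h1, h2]
        conv_rhs => rw [hn2, bdVertex_succ_two_mul_add_one, midpoint_comm]
      · rw [hj, child_some_apply, h2, midpoint_self]
        conv_rhs => rw [hn2, show 2 * (n / 2) + 1 + 1 = 2 * (n / 2 + 1) by ring,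
          bdVertex_succ_two_mul]

theorem mem_segment_iff_halves (a b p : Pt d) : p ∈ segment ℝ a b ↔
    p ∈ segment ℝ a (midpoint ℝ a b) ∨ p ∈ segment ℝ (midpoint ℝ a b) b := by
  constructor
  · rintro ⟨s, t, hs, ht, hst, rfl⟩
    obtain rfl : s = 1 - t := by linarith
    rcases le_total t (1 / 2) with h | h
    · refine Or.inl ⟨1 - 2 * t, 2 * t, by linarith, by linarith, by ring, ?_⟩
      rw [midpoint_eq_half]; module
    · refine Or.inr ⟨2 - 2 * t, 2 * t - 1, by linarith, by linarith, by ring, ?_⟩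
      rw [midpoint_eq_half]; module
  · have hm : midpoint ℝ a b ∈ segment ℝ a b :=
      (convex_segment a b).midpoint_mem (left_mem_segment ℝ a b) (right_mem_segment ℝ a b)
    rintro (h | h)
    · exact (convex_segment a b).segment_subset (left_mem_segment ℝ a b) hm h
    · exact (convex_segment a b).segment_subset hm (right_mem_segment ℝ a b) h

theorem mem_boundary_iff (q : ℕ) (p : Pt d) : p ∈ S.boundary ↔
    ∃ n < S.m * 2 ^ q, p ∈ segment ℝ (S.bdVertex q n) (S.bdVertex q (n + 1)) := by
  induction q with
  | zero =>
    have : NeZero S.m := ⟨S.m_pos.ne'⟩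
    simp only [boundary, Set.mem_iUnion, bdVertex_zero, pow_zero, mul_one]
    push_cast
    constructor
    · rintro ⟨i, hi⟩
      exact ⟨i.val, ZMod.val_lt i, by simpa using hi⟩
    · rintro ⟨n, _, h⟩
      exact ⟨n, h⟩
  | succ q ih =>
    rw [ih]
    constructor
    · rintro ⟨n, hn, h⟩
      rcases (mem_segment_iff_halves _ _ _).1 h with h | h
      · refine ⟨2 * n, by rw [pow_succ, ← mul_assoc]; omega, ?_⟩
        rwa [bdVertex_succ_two_mul, bdVertex_succ_two_mul_add_one]
      · refine ⟨2 * n + 1, by rw [pow_succ, ← mul_assoc]; omega, ?_⟩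
        rwa [show 2 * n + 1 + 1 = 2 * (n + 1) by ring, bdVertex_succ_two_mul,
          bdVertex_succ_two_mul_add_one]
    · rintro ⟨n, hn, h⟩
      refine ⟨n / 2, by rw [pow_succ, ← mul_assoc] at hn; omega, (mem_segment_iff_halves _ _ _).2 ?_⟩
      rw [← bdVertex_succ_two_mul_add_one, ← bdVertex_succ_two_mul S q (n / 2),
        ← bdVertex_succ_two_mul S q (n / 2 + 1)]
      rcases Nat.mod_two_eq_zero_or_one n with h2 | h2
      · left
        rwa [show 2 * (n / 2) = n by omega]
      · right
        rwa [show 2 * (n / 2) + 1 = n by omega, show 2 * (n / 2 + 1) = n + 1 by omega]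

end MarkedDisk

end

/-! ### The target triangle -/

theorem corner_re_im (k : Fin 3) : corner k =
    ⟨Real.cos (2 * Real.pi * (k : ℕ) / 3), Real.sin (2 * Real.pi * (k : ℕ) / 3)⟩ := by
  have : (2 * Real.pi * Complex.I * ((k : ℕ) : ℂ) / 3) =
      ((2 * Real.pi * (k : ℕ) / 3 : ℝ) : ℂ) * Complex.I := by push_cast; ring
  rw [corner, this]
  apply Complex.ext
  · exact Complex.exp_ofReal_mul_I_re _
  · exact Complex.exp_ofReal_mul_I_im _

theorem area_corner_pos : 0 < area corner := by
  have c1 : Real.cos (2 * Real.pi / 3) = -(1 / 2) := by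
    rw [show 2 * Real.pi / 3 = Real.pi - Real.pi / 3 by ring, Real.cos_pi_sub, Real.cos_pi_div_three]
  have s1 : Real.sin (2 * Real.pi / 3) = √3 / 2 := by
    rw [show 2 * Real.pi / 3 = Real.pi - Real.pi / 3 by ring, Real.sin_pi_sub, Real.sin_pi_div_three]
  have c2 : Real.cos (2 * Real.pi * 2 / 3) = -(1 / 2) := by
    rw [show 2 * Real.pi * 2 / 3 = Real.pi / 3 + Real.pi by ring, Real.cos_add_pi,
      Real.cos_pi_div_three]
  have s2 : Real.sin (2 * Real.pi * 2 / 3) = -(√3 / 2) := by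
    rw [show 2 * Real.pi * 2 / 3 = Real.pi / 3 + Real.pi by ring, Real.sin_add_pi,
      Real.sin_pi_div_three]
  rw [area, signedArea_eq, corner_re_im, corner_re_im, corner_re_im]
  simp only [Fin.val_zero, Fin.val_one, Fin.val_two, Nat.cast_zero, Nat.cast_one, Nat.cast_ofNat,
    mul_zero, zero_div, mul_one, Real.cos_zero, Real.sin_zero, c1, s1, c2, s2]
  have : 0 < √3 := Real.sqrt_pos.2 (by norm_num)
  linarith

/-- The weights of the point with parameter `x` on the `k`-th side of a triangle. -/
def sideWeight (k : Fin 3) (x : ℝ) (l : Fin 3) : ℝ :=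
  if l = k then 1 - x else if l = k + 1 then x else 0

theorem sum_sideWeight_smul {E : Type*} [AddCommGroup E] [Module ℝ E] (t : Fin 3 → E) (k : Fin 3)
    (x : ℝ) : ∑ l, sideWeight k x l • t l = AffineMap.lineMap (t k) (t (k + 1)) x := by
  rw [AffineMap.lineMap_apply_module, Fin.sum_univ_three]
  fin_cases k <;> simp [sideWeight]
  abel

theorem sum_sideWeight (k : Fin 3) (x : ℝ) : ∑ l, sideWeight k x l = 1 := by
  rw [Fin.sum_univ_three]
  fin_cases k <;> simp [sideWeight]

theorem sideWeight_mem (k : Fin 3) {x : ℝ} (hx : x ∈ Set.Icc (0 : ℝ) 1) :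
    sideWeight k x ∈ stdSimplex ℝ (Fin 3) := by
  refine ⟨fun l => ?_, sum_sideWeight k x⟩
  unfold sideWeight
  split_ifs
  exacts [sub_nonneg.2 hx.2, hx.1, le_rfl]

/-- The closed sides of a triangle overlap only at corners, where the end of one side is the start
of the next. -/
theorem sideWeight_injective {k k' : Fin 3} {x x' : ℝ} (h : sideWeight k x = sideWeight k' x') :
    (k = k' ∧ x = x') ∨ (k' = k + 1 ∧ x = 1 ∧ x' = 0) ∨ (k = k' + 1 ∧ x = 0 ∧ x' = 1) := by
  have h0 := congrFun h 0
  have h1 := congrFun h 1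
  have h2 := congrFun h 2
  fin_cases k <;> fin_cases k' <;> simp [sideWeight] at h0 h1 h2 ⊢
  all_goals first | assumption | exact ⟨by linarith, by linarith⟩

theorem lineMap_corner_mem_target (k : Fin 3) {x : ℝ} (hx : x ∈ Set.Icc (0 : ℝ) 1) :
    AffineMap.lineMap (corner k) (corner (k + 1)) x ∈ target :=
  (mem_convexHull_range_iff _ _).2 ⟨_, sideWeight_mem k hx, (sum_sideWeight_smul _ _ _).symm⟩

theorem lineMap_corner_mem_frontier (k : Fin 3) {x : ℝ} (hx : x ∈ Set.Icc (0 : ℝ) 1) :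
    AffineMap.lineMap (corner k) (corner (k + 1)) x ∈ frontier target := by
  refine ⟨subset_closure (lineMap_corner_mem_target k hx),
    notMem_interior_hull area_corner_pos (k := k + 2) ?_⟩
  rw [← sum_sideWeight_smul, bary_sum_smul area_corner_pos (sum_sideWeight k x)]
  fin_cases k <;> simp [sideWeight]

theorem isClosed_target : IsClosed target := isClosed_hull corner

/-! ### Positive piecewise linear maps to the triangle -/

namespace MarkedDisk

variable {d : ℕ} (S : MarkedDisk d)

/-- The image of a face under the vertex map `u`. -/
def img {q : ℕ} (u : Pt d → ℂ) (j : S.Face q) (l : Fin 3) : ℂ := u (S.verts j l)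

/-- The map `Φ` interpolates the vertex values `u`, takes the faces of `S^q` to positively oriented
triangles, and runs along the sides of the target triangle on the boundary. -/
structure PositiveMap (q : ℕ) (u : Pt d → ℂ) (Φ : S.carrier → ℂ) : Prop where
  area_pos : ∀ j : S.Face q, 0 < area (S.img u j)
  interp : ∀ (j : S.Face q) (p : S.carrier), ∀ w ∈ stdSimplex ℝ (Fin 3),
    (p : Pt d) = ∑ l, w l • S.verts j l → Φ p = ∑ l, w l • S.img u j l
  sides : ∀ k : Fin 3, ∃ lam : ℕ → ℝ,
    StrictMonoOn lam (Set.Icc (S.c k.castSucc * 2 ^ q) (S.c k.succ * 2 ^ q)) ∧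
    lam (S.c k.castSucc * 2 ^ q) = 0 ∧ lam (S.c k.succ * 2 ^ q) = 1 ∧
    ∀ n ∈ Set.Icc (S.c k.castSucc * 2 ^ q) (S.c k.succ * 2 ^ q),
      u (S.bdVertex q n) = AffineMap.lineMap (corner k) (corner (k + 1)) (lam n)

theorem c_lt (k : Fin 3) (q : ℕ) : S.c k.castSucc * 2 ^ q < S.c k.succ * 2 ^ q :=
  Nat.mul_lt_mul_of_pos_right (S.c_strictMono Fin.castSucc_lt_succ) (by positivity)

theorem exists_block (q : ℕ) {n : ℕ} (hn : n < S.m * 2 ^ q) :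
    ∃ k : Fin 3, n ∈ Set.Ico (S.c k.castSucc * 2 ^ q) (S.c k.succ * 2 ^ q) := by
  rcases lt_or_ge n (S.c 1 * 2 ^ q) with h1 | h1
  · exact ⟨0, by simp [S.c_zero], h1⟩
  rcases lt_or_ge n (S.c 2 * 2 ^ q) with h2 | h2
  · exact ⟨1, h1, h2⟩
  · exact ⟨2, h2, by rw [← S.c_three] at hn; exact hn⟩

theorem sum_blocks (q : ℕ) (g : ℕ → ℝ) : ∑ n ∈ Finset.range (S.m * 2 ^ q), g n =
    ∑ k : Fin 3, ∑ n ∈ Finset.Ico (S.c k.castSucc * 2 ^ q) (S.c k.succ * 2 ^ q), g n := by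
  have h0 : S.c 0 * 2 ^ q ≤ S.c 1 * 2 ^ q := (S.c_lt 0 q).le
  have h1 : S.c 1 * 2 ^ q ≤ S.c 2 * 2 ^ q := (S.c_lt 1 q).le
  have h2 : S.c 2 * 2 ^ q ≤ S.c 3 * 2 ^ q := (S.c_lt 2 q).le
  rw [Fin.sum_univ_three]
  change _ = ∑ n ∈ Finset.Ico (S.c 0 * 2 ^ q) (S.c 1 * 2 ^ q), g n +
    ∑ n ∈ Finset.Ico (S.c 1 * 2 ^ q) (S.c 2 * 2 ^ q), g n +
    ∑ n ∈ Finset.Ico (S.c 2 * 2 ^ q) (S.c 3 * 2 ^ q), g n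
  rw [Finset.sum_Ico_consecutive g h0 h1, Finset.sum_Ico_consecutive g (h0.trans h1) h2,
    Finset.range_eq_Ico, S.c_three, S.c_zero, zero_mul]

theorem bdVertex_block_start (q : ℕ) (k : Fin 3) :
    S.bdVertex q (S.c k.castSucc * 2 ^ q) = S.marked k := by
  rw [bdVertex_mul]; rfl

theorem bdVertex_block_end (q : ℕ) (k : Fin 3) :
    S.bdVertex q (S.c k.succ * 2 ^ q) = S.marked (k + 1) := by
  rw [bdVertex_mul, marked]
  fin_cases k
  · rfl
  · rfl
  · change S.bd ((S.c 3 : ℕ) : ZMod S.m) = S.bd ((S.c 0 : ℕ) : ZMod S.m)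
    rw [S.c_three, S.c_zero, ZMod.natCast_self, Nat.cast_zero]

namespace PositiveMap

variable {S} {q : ℕ} {u : Pt d → ℂ} {Φ : S.carrier → ℂ}

theorem lam_mem {k : Fin 3} {lam : ℕ → ℝ}
    (h : StrictMonoOn lam (Set.Icc (S.c k.castSucc * 2 ^ q) (S.c k.succ * 2 ^ q)))
    (h0 : lam (S.c k.castSucc * 2 ^ q) = 0) (h1 : lam (S.c k.succ * 2 ^ q) = 1) {n : ℕ}
    (hn : n ∈ Set.Icc (S.c k.castSucc * 2 ^ q) (S.c k.succ * 2 ^ q)) :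
    lam n ∈ Set.Icc (0 : ℝ) 1 := by
  have hle := (S.c_lt k q).le
  constructor
  · rw [← h0]; exact h.monotoneOn ⟨le_rfl, hle⟩ hn hn.1
  · rw [← h1]; exact h.monotoneOn hn ⟨hle, le_rfl⟩ hn.2

theorem turn_self (y a : ℂ) : turn y a a = 0 := by
  have := turn_swap y a a
  linarith

/-- The boundary of the surface winds around `y` as the boundary of the target triangle does. -/
theorem sum_turn_boundary (H : S.PositiveMap q u Φ) {y : ℂ}
    (hy : ∀ k, y ∉ segment ℝ (corner k) (corner (k + 1))) :
    ∑ n ∈ Finset.range (S.m * 2 ^ q), turn y (u (S.bdVertex q n)) (u (S.bdVertex q (n + 1))) =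
      ∑ k, turn y (corner k) (corner (k + 1)) := by
  rw [S.sum_blocks q]
  refine Finset.sum_congr rfl fun k _ => ?_
  obtain ⟨lam, hmono, h0, h1, hu⟩ := H.sides k
  set a := S.c k.castSucc * 2 ^ q
  set b := S.c k.succ * 2 ^ q
  have hab : a ≤ b := (S.c_lt k q).le
  have hsub : ∀ n, a ≤ n → n ≤ b → segment ℝ (corner k) (u (S.bdVertex q n)) ⊆
      segment ℝ (corner k) (corner (k + 1)) := by
    intro n hn hn'
    refine (convex_segment _ _).segment_subset (left_mem_segment ℝ _ _) ?_
    rw [hu n ⟨hn, hn'⟩, segment_eq_image_lineMap]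
    exact ⟨_, lam_mem hmono h0 h1 ⟨hn, hn'⟩, rfl⟩
  -- Along one side the turns telescope: each boundary value lies between `corner k` and the next
  -- one, so their turns add.
  have key : ∀ n, a ≤ n → n ≤ b → ∑ i ∈ Finset.Ico a n,
      turn y (u (S.bdVertex q i)) (u (S.bdVertex q (i + 1))) =
        turn y (corner k) (u (S.bdVertex q n)) := by
    intro n hn
    induction n, hn using Nat.le_induction with
    | base =>
      intro _
      rw [Finset.Ico_self, Finset.sum_empty, hu a ⟨le_rfl, hab⟩, h0, AffineMap.lineMap_apply_zero,
        turn_self]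
    | succ n hn ih =>
      intro hn'
      have hnb : n ≤ b := by omega
      rw [Finset.sum_Ico_succ_top hn, ih hnb]
      refine turn_add_of_mem_segment (fun h => hy k (hsub _ (by omega) hn' h)) ?_
      have m0 := lam_mem hmono h0 h1 ⟨hn, hnb⟩
      have m1 : lam n < lam (n + 1) :=
        hmono ⟨hn, hnb⟩ ⟨by omega, hn'⟩ (Nat.lt_succ_self n)
      have m2 : 0 < lam (n + 1) := m0.1.trans_lt m1
      -- Measured from `corner k`, the earlier point is at the fraction `lam n / lam (n + 1)` of the
      -- way to the later one.
      refine ⟨1 - lam n / lam (n + 1), lam n / lam (n + 1), ?_, div_nonneg m0.1 m2.le, by ring, ?_⟩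
      · rw [sub_nonneg, div_le_one m2]; exact m1.le
      · rw [hu n ⟨hn, hnb⟩, hu (n + 1) ⟨by omega, hn'⟩]
        simp only [AffineMap.lineMap_apply_module]
        have e : lam n = lam n / lam (n + 1) * lam (n + 1) := by field_simp
        conv_rhs => rw [e]
        module
  rw [key b hab le_rfl, hu b ⟨hab, le_rfl⟩, h1, AffineMap.lineMap_apply_one]

/-- Points lying on no image of an edge and on no side of the target triangle. -/
def Generic (S : MarkedDisk d) (q : ℕ) (u : Pt d → ℂ) : Set ℂ :=
  {y | (∀ (j : S.Face q) (k : Fin 3), y ∉ segment ℝ (S.img u j k) (S.img u j (k + 1))) ∧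
    ∀ k, y ∉ segment ℝ (corner k) (corner (k + 1))}

theorem dense_generic (S : MarkedDisk d) (q : ℕ) (u : Pt d → ℂ) : Dense (Generic S q u) := by
  have := dense_compl_segments (ι := (S.Face q × Fin 3) ⊕ Fin 3)
    (fun i => i.elim (fun x => S.img u x.1 x.2) corner)
    (fun i => i.elim (fun x => S.img u x.1 (x.2 + 1)) fun k => corner (k + 1))
  convert this using 1
  ext y
  simp [Generic]

open Classical in
/-- A generic point is covered once if it lies in the target triangle, and otherwise not at all. -/
theorem card_cover (H : S.PositiveMap q u Φ) {y : ℂ} (hy : y ∈ Generic S q u) :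
    (Finset.univ.filter fun j : S.Face q => y ∈ convexHull ℝ (Set.range (S.img u j))).card =
      if y ∈ target then 1 else 0 := by
  -- The turn over all directed edges is evaluated twice: along the boundary it is the winding of
  -- the target triangle, face by face it is `2π` for each face covering `y`.
  have h1 := S.sum_edges q (F := fun a b => turn y (u a) (u b)) (fun a b => turn_swap _ _ _)
  rw [H.sum_turn_boundary hy.2, sum_turn_triangle area_corner_pos hy.2] at h1
  have h2 : ∀ j : S.Face q, ∑ k, turn y (u (S.verts j k)) (u (S.verts j (k + 1))) =
      2 * Real.pi * (if y ∈ convexHull ℝ (Set.range (S.img u j)) then 1 else 0) :=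
    fun j => sum_turn_triangle (H.area_pos j) (hy.1 j)
  rw [Finset.sum_congr rfl fun j _ => h2 j, ← Finset.mul_sum, Finset.sum_boole] at h1
  have h3 := mul_left_cancel₀ Real.two_pi_pos.ne' h1
  have h4 : (if y ∈ target then (1 : ℝ) else 0) = ((if y ∈ target then 1 else 0 : ℕ) : ℝ) := by
    split_ifs <;> simp
  exact_mod_cast h3.trans h4

theorem eq_of_generic (H : S.PositiveMap q u Φ) {y : ℂ} (hy : y ∈ Generic S q u) {i j : S.Face q}
    (hi : y ∈ convexHull ℝ (Set.range (S.img u i))) (hj : y ∈ convexHull ℝ (Set.range (S.img u j))) :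
    i = j := by
  classical
  have h := H.card_cover hy
  have h1 : (Finset.univ.filter fun j : S.Face q =>
      y ∈ convexHull ℝ (Set.range (S.img u j))).card ≤ 1 := by
    rw [h]; split_ifs <;> simp
  exact Finset.card_le_one.1 h1 i (by simpa using hi) j (by simpa using hj)

theorem mem_target_of_generic (H : S.PositiveMap q u Φ) {y : ℂ} (hy : y ∈ Generic S q u)
    {j : S.Face q} (hj : y ∈ convexHull ℝ (Set.range (S.img u j))) : y ∈ target := by
  classical
  by_contra hT
  have h := H.card_cover hy
  rw [if_neg hT, Finset.card_eq_zero, Finset.filter_eq_empty_iff] at h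
  exact h (Finset.mem_univ j) hj

theorem exists_face_of_generic (H : S.PositiveMap q u Φ) {y : ℂ} (hy : y ∈ Generic S q u)
    (hT : y ∈ target) : ∃ j : S.Face q, y ∈ convexHull ℝ (Set.range (S.img u j)) := by
  classical
  have h := H.card_cover hy
  rw [if_pos hT] at h
  obtain ⟨j, hj⟩ := Finset.card_pos.1 (by rw [h]; exact one_pos)
  exact ⟨j, by simpa using hj⟩

/-- An open set meeting the image of a face contains a generic point of the image. -/
theorem exists_generic (H : S.PositiveMap q u Φ) (j : S.Face q) {U : Set ℂ} {y : ℂ}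
    (hU : U ∈ nhds y) (hy : y ∈ convexHull ℝ (Set.range (S.img u j))) :
    ∃ z ∈ Generic S q u, z ∈ U ∧ z ∈ convexHull ℝ (Set.range (S.img u j)) := by
  have h1 := hull_subset_closure_interior (H.area_pos j) hy
  obtain ⟨x, hx, hx'⟩ := mem_closure_iff_nhds.1 h1 _ (interior_mem_nhds.2 hU)
  obtain ⟨z, hz, hz'⟩ := (dense_generic S q u).inter_open_nonempty _
    (isOpen_interior.inter isOpen_interior) ⟨x, hx, hx'⟩
  exact ⟨z, hz', interior_subset hz.1, interior_subset hz.2⟩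

/-- A point of an image triangle outside the closed target would have nearby generic points in the
same image triangle and outside the target, contradicting the count. -/
theorem img_subset_target (H : S.PositiveMap q u Φ) (j : S.Face q) :
    convexHull ℝ (Set.range (S.img u j)) ⊆ target := by
  intro y hy
  by_contra hT
  obtain ⟨z, hz, hzT, hzj⟩ := H.exists_generic j (isClosed_target.isOpen_compl.mem_nhds hT) hy
  exact hzT (H.mem_target_of_generic hz hzj)

theorem target_subset_iUnion (H : S.PositiveMap q u Φ) :
    target ⊆ ⋃ j : S.Face q, convexHull ℝ (Set.range (S.img u j)) := by
  have hcl : IsClosed (⋃ j : S.Face q, convexHull ℝ (Set.range (S.img u j))) :=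
    isClosed_iUnion_of_finite fun j => isClosed_hull _
  refine (hull_subset_closure_interior area_corner_pos).trans ?_
  refine closure_minimal ?_ hcl
  refine ((dense_generic S q u).open_subset_closure_inter isOpen_interior).trans
    (closure_minimal ?_ hcl)
  rintro y ⟨hy, hy'⟩
  exact Set.mem_iUnion.2 (H.exists_face_of_generic hy' (interior_subset hy))

theorem map_mem_hull (H : S.PositiveMap q u Φ) {j : S.Face q} {p : S.carrier}
    (hp : (p : Pt d) ∈ convexHull ℝ (Set.range (S.verts j))) :
    Φ p ∈ convexHull ℝ (Set.range (S.img u j)) := by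
  obtain ⟨w, hw, e⟩ := (mem_convexHull_range_iff _ _).1 hp
  exact (mem_convexHull_range_iff _ _).2 ⟨w, hw, H.interp j p w hw e⟩

theorem injOn_face (H : S.PositiveMap q u Φ) {j : S.Face q} {p p' : S.carrier}
    (hp : (p : Pt d) ∈ convexHull ℝ (Set.range (S.verts j)))
    (hp' : (p' : Pt d) ∈ convexHull ℝ (Set.range (S.verts j))) (h : Φ p = Φ p') : p = p' := by
  obtain ⟨w, hw, e⟩ := (mem_convexHull_range_iff _ _).1 hp
  obtain ⟨w', hw', e'⟩ := (mem_convexHull_range_iff _ _).1 hp'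
  rw [H.interp j p w hw e, H.interp j p' w' hw' e'] at h
  have := weights_unique (H.area_pos j) hw.2 hw'.2 h
  subst this
  exact Subtype.ext (e.trans e'.symm)

theorem map_notMem_segment (H : S.PositiveMap q u Φ) {j : S.Face q} {p : S.carrier} {k : Fin 3}
    (hp : (p : Pt d) ∈ convexHull ℝ (Set.range (S.verts j)))
    (hk : (p : Pt d) ∉ segment ℝ (S.verts j k) (S.verts j (k + 1))) :
    Φ p ∉ segment ℝ (S.img u j k) (S.img u j (k + 1)) := by
  intro h
  apply hk
  rw [segment_eq_image_lineMap] at h ⊢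
  obtain ⟨x, hx, hx'⟩ := h
  obtain ⟨w, hw, e⟩ := (mem_convexHull_range_iff _ _).1 hp
  rw [H.interp j p w hw e, ← sum_sideWeight_smul] at hx'
  have := weights_unique (H.area_pos j) (sum_sideWeight k x) hw.2 hx'
  exact ⟨x, hx, by rw [← sum_sideWeight_smul, this, e]⟩

end PositiveMap

end MarkedDisk

/-! ### Local covering and injectivity off the boundary -/

namespace MarkedDisk

namespace PositiveMap

variable {d : ℕ} {S : MarkedDisk d} {q : ℕ} {u : Pt d → ℂ} {Φ : S.carrier → ℂ}

open Classical in
/-- The total angle, seen from `y`, of the edges of the faces containing `p` that do not contain `p`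
themselves. -/
def linkTurn (u : Pt d → ℂ) (q : ℕ) (p : S.carrier) (y : ℂ) : ℝ :=
  ∑ j : S.Face q with (p : Pt d) ∈ convexHull ℝ (Set.range (S.verts j)), ∑ k,
    if (p : Pt d) ∈ segment ℝ (S.verts j k) (S.verts j (k + 1)) then 0
    else turn y (S.img u j k) (S.img u j (k + 1))

-- The turns of the edges through `p` cancel, because none of these edges is on the boundary and
-- only faces containing `p` have them. Adding them back completes the contour of every image
-- triangle around `p`, and each contour counts `2π` or `0`.
open Classical in
theorem linkTurn_eq_card (H : S.PositiveMap q u Φ) {p : S.carrier} (hp : (p : Pt d) ∉ S.boundary)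
    {y : ℂ} (hy : y ∈ Generic S q u) : linkTurn u q p y = 2 * Real.pi *
      ((Finset.univ.filter fun j : S.Face q => (p : Pt d) ∈ convexHull ℝ (Set.range (S.verts j)) ∧
        y ∈ convexHull ℝ (Set.range (S.img u j))).card : ℝ) := by
  set F : Pt d → Pt d → ℝ := fun a b =>
    if (p : Pt d) ∈ segment ℝ a b then turn y (u a) (u b) else 0 with hF
  have hanti : ∀ a b, F b a = -F a b := by
    intro a b
    simp only [hF, segment_symm ℝ b a, turn_swap y (u a) (u b)]
    split_ifs <;> simp
  have h0 : ∑ j : S.Face q with (p : Pt d) ∈ convexHull ℝ (Set.range (S.verts j)),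
      ∑ k, F (S.verts j k) (S.verts j (k + 1)) = 0 := by
    have h1 := S.sum_edges q hanti
    have h2 : ∑ n ∈ Finset.range (S.m * 2 ^ q), F (S.bdVertex q n) (S.bdVertex q (n + 1)) = 0 := by
      refine Finset.sum_eq_zero fun n hn => if_neg fun h => hp ?_
      exact (S.mem_boundary_iff q _).2 ⟨n, Finset.mem_range.1 hn, h⟩
    rw [h2] at h1
    rw [← h1]
    refine Finset.sum_subset (Finset.filter_subset _ _) fun j _ hj => ?_
    refine Finset.sum_eq_zero fun k _ => if_neg fun h => hj ?_
    rw [Finset.mem_filter]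
    exact ⟨Finset.mem_univ _, (convex_convexHull ℝ _).segment_subset
      (subset_convexHull ℝ _ (Set.mem_range_self k))
      (subset_convexHull ℝ _ (Set.mem_range_self (k + 1))) h⟩
  rw [← add_zero (linkTurn u q p y), ← h0, linkTurn, ← Finset.sum_add_distrib]
  have h3 : ∀ j : S.Face q, (∑ k, if (p : Pt d) ∈ segment ℝ (S.verts j k) (S.verts j (k + 1)) then 0
      else turn y (S.img u j k) (S.img u j (k + 1))) + ∑ k, F (S.verts j k) (S.verts j (k + 1)) =
      2 * Real.pi * (if y ∈ convexHull ℝ (Set.range (S.img u j)) then 1 else 0) := by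
    intro j
    rw [← sum_turn_triangle (H.area_pos j) (hy.1 j), ← Finset.sum_add_distrib]
    refine Finset.sum_congr rfl fun k _ => ?_
    simp only [hF]
    split_ifs <;> simp [img]
  rw [Finset.sum_congr rfl fun j _ => h3 j, ← Finset.mul_sum, Finset.sum_boole,
    Finset.filter_filter]

open Classical in
/-- Near the image of a point off the boundary, the faces containing the point cover the plane. -/
theorem star_mem_nhds (H : S.PositiveMap q u Φ) {p : S.carrier} (hp : (p : Pt d) ∉ S.boundary) :
    {y | ∃ j : S.Face q, (p : Pt d) ∈ convexHull ℝ (Set.range (S.verts j)) ∧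
      y ∈ convexHull ℝ (Set.range (S.img u j))} ∈ nhds (Φ p) := by
  set C := {y | ∃ j : S.Face q, (p : Pt d) ∈ convexHull ℝ (Set.range (S.verts j)) ∧
      y ∈ convexHull ℝ (Set.range (S.img u j))} with hC
  have hCclosed : IsClosed C := by
    have : C = ⋃ j : {j : S.Face q // (p : Pt d) ∈ convexHull ℝ (Set.range (S.verts j))},
        convexHull ℝ (Set.range (S.img u j.1)) := by
      ext y; simp [hC]
    rw [this]
    exact isClosed_iUnion_of_finite fun j => isClosed_hull _
  -- Only the link edges, those of faces around `p` that miss `p`, enter `linkTurn`. Their images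
  -- avoid the image of `p`, so `linkTurn` is continuous on a ball around it.
  set U : Set ℂ := {y | ∀ x : {x : S.Face q × Fin 3 //
    (p : Pt d) ∈ convexHull ℝ (Set.range (S.verts x.1)) ∧
      (p : Pt d) ∉ segment ℝ (S.verts x.1 x.2) (S.verts x.1 (x.2 + 1))},
    y ∉ segment ℝ (S.img u x.1.1 x.1.2) (S.img u x.1.1 (x.1.2 + 1))} with hU
  have hUopen : IsOpen U := by
    have : U = ⋂ x : {x : S.Face q × Fin 3 //
        (p : Pt d) ∈ convexHull ℝ (Set.range (S.verts x.1)) ∧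
        (p : Pt d) ∉ segment ℝ (S.verts x.1 x.2) (S.verts x.1 (x.2 + 1))},
        (segment ℝ (S.img u x.1.1 x.1.2) (S.img u x.1.1 (x.1.2 + 1)))ᶜ := by
      ext y; simp [hU]
    rw [this]
    exact isOpen_iInter_of_finite fun x => (isClosed_segment _ _).isOpen_compl
  have hyU : Φ p ∈ U := fun x => H.map_notMem_segment x.2.1 x.2.2
  obtain ⟨r, hr, hB⟩ := Metric.isOpen_iff.1 hUopen _ hyU
  set B := Metric.ball (Φ p) r
  have hcont : ContinuousOn (linkTurn u q p) B := by
    intro y hy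
    apply ContinuousAt.continuousWithinAt
    unfold linkTurn
    refine tendsto_finsetSum _ fun j hj => tendsto_finsetSum _ fun k _ => ?_
    by_cases h : (p : Pt d) ∈ segment ℝ (S.verts j k) (S.verts j (k + 1))
    · simp only [if_pos h]
      exact tendsto_const_nhds
    · simp only [if_neg h]
      exact continuousAt_turn (hB hy ⟨(j, k), (Finset.mem_filter.1 hj).2, h⟩)
  have hcard := fun {y : ℂ} (hy : y ∈ Generic S q u) => H.linkTurn_eq_card hp hy
  obtain ⟨j₀, hj₀⟩ := S.exists_face q p.2
  obtain ⟨y₀, hg₀, hB₀, hy₀⟩ := H.exists_generic j₀ (Metric.ball_mem_nhds (Φ p) hr)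
    (H.map_mem_hull hj₀)
  have hpi := Real.pi_pos
  have hW₀ : 2 * Real.pi ≤ linkTurn u q p y₀ := by
    rw [hcard hg₀]
    refine le_mul_of_one_le_right (by positivity) ?_
    have : 0 < (Finset.univ.filter fun j : S.Face q =>
        (p : Pt d) ∈ convexHull ℝ (Set.range (S.verts j)) ∧
        y₀ ∈ convexHull ℝ (Set.range (S.img u j))).card :=
      Finset.card_pos.2 ⟨j₀, by simpa using ⟨hj₀, hy₀⟩⟩
    exact_mod_cast this
  have hgen : ∀ y ∈ B, y ∈ Generic S q u → y ∈ C := by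
    intro y hy hyg
    by_contra hyC
    have hW : linkTurn u q p y = 0 := by
      rw [hcard hyg, Finset.filter_eq_empty_iff.2 fun j _ h => hyC ⟨j, h⟩]
      simp
    -- If a generic point of the ball were missed, `linkTurn` would go from `0` to at least `2π` and
    -- so take the value `π`. A generic point nearby would have a value strictly between `0` and
    -- `2π`, not an integer multiple of `2π`.
    obtain ⟨z, hz, hzW⟩ := (convex_ball (Φ p) r).isPreconnected.intermediate_value hy hB₀ hcont
      (show Real.pi ∈ Set.Icc _ _ from ⟨by rw [hW]; exact hpi.le, by linarith⟩)
    have hn : B ∩ linkTurn u q p ⁻¹' Set.Ioo 0 (2 * Real.pi) ∈ nhds z := by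
      refine Filter.inter_mem (Metric.isOpen_ball.mem_nhds hz) ?_
      refine (hcont.continuousAt (Metric.isOpen_ball.mem_nhds hz)).preimage_mem_nhds ?_
      rw [hzW]
      exact Ioo_mem_nhds hpi (by linarith)
    obtain ⟨x, hx, hxg⟩ := (dense_generic S q u).inter_nhds_nonempty hn
    have hx2 := hxg.2
    rw [Set.mem_preimage, hcard hx] at hx2
    generalize (Finset.univ.filter fun j : S.Face q =>
        (p : Pt d) ∈ convexHull ℝ (Set.range (S.verts j)) ∧
        x ∈ convexHull ℝ (Set.range (S.img u j))).card = N at hx2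
    have h1 : (0 : ℝ) < N := pos_of_mul_pos_right hx2.1 (by positivity)
    have h2 : (N : ℝ) < 1 := by
      by_contra! h
      have := le_mul_of_one_le_right (by positivity : (0 : ℝ) ≤ 2 * Real.pi) h
      linarith [hx2.2]
    have h1' : 0 < N := by exact_mod_cast h1
    have h2' : N < 1 := by exact_mod_cast h2
    omega
  refine Filter.mem_of_superset (Metric.ball_mem_nhds (Φ p) hr) ?_
  refine ((dense_generic S q u).open_subset_closure_inter Metric.isOpen_ball).trans
    (closure_minimal ?_ hCclosed)
  exact fun y hy => hgen y hy.1 hy.2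

/-- The faces around `p` cover a neighbourhood of the common image, so they share a generic point
with the image of a face containing `p'`. Generic points are covered once, so that face also
contains `p`, and the map is injective on it. -/
theorem eq_of_notMem_boundary (H : S.PositiveMap q u Φ) {p p' : S.carrier}
    (hp : (p : Pt d) ∉ S.boundary) (h : Φ p = Φ p') : p = p' := by
  obtain ⟨i, hi⟩ := S.exists_face q p'.2
  have hn := H.star_mem_nhds hp
  rw [h] at hn
  obtain ⟨z, hz, ⟨j, hj, hzj⟩, hzi⟩ := H.exists_generic i hn (H.map_mem_hull hi)
  obtain rfl := H.eq_of_generic hz hzi hzj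
  exact H.injOn_face hj hi h

theorem mem_interior_of_notMem_boundary (H : S.PositiveMap q u Φ) {p : S.carrier}
    (hp : (p : Pt d) ∉ S.boundary) : Φ p ∈ interior target := by
  rw [mem_interior_iff_mem_nhds]
  refine Filter.mem_of_superset (H.star_mem_nhds hp) ?_
  rintro y ⟨j, -, hy⟩
  exact H.img_subset_target j hy

/-- The position on the boundary of the target triangle of the image of a boundary point. -/
theorem exists_boundary_param (H : S.PositiveMap q u Φ) {p : S.carrier}
    (hp : (p : Pt d) ∈ S.boundary) : ∃ (k : Fin 3) (n : ℕ) (s : ℝ),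
      n ∈ Set.Ico (S.c k.castSucc * 2 ^ q) (S.c k.succ * 2 ^ q) ∧ s ∈ Set.Icc (0 : ℝ) 1 ∧
      (p : Pt d) = AffineMap.lineMap (S.bdVertex q n) (S.bdVertex q (n + 1)) s ∧
      Φ p = AffineMap.lineMap (u (S.bdVertex q n)) (u (S.bdVertex q (n + 1))) s := by
  obtain ⟨n, hn, h⟩ := (S.mem_boundary_iff q _).1 hp
  obtain ⟨k, hk⟩ := S.exists_block q hn
  rw [segment_eq_image_lineMap] at h
  obtain ⟨s, hs, hs'⟩ := h
  refine ⟨k, n, s, hk, hs, hs'.symm, ?_⟩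
  obtain ⟨j, l, h1, h2⟩ := S.exists_face_of_bdVertex q n hn
  rw [← h1, ← h2, ← sum_sideWeight_smul] at hs'
  rw [H.interp j p _ (sideWeight_mem l hs) hs'.symm, sum_sideWeight_smul, img, img, h1, h2]

theorem boundary_param_side {k : Fin 3} {lam : ℕ → ℝ} {n : ℕ} {s : ℝ}
    (hu : ∀ n ∈ Set.Icc (S.c k.castSucc * 2 ^ q) (S.c k.succ * 2 ^ q),
      u (S.bdVertex q n) = AffineMap.lineMap (corner k) (corner (k + 1)) (lam n))
    (hn : n ∈ Set.Ico (S.c k.castSucc * 2 ^ q) (S.c k.succ * 2 ^ q)) :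
    AffineMap.lineMap (u (S.bdVertex q n)) (u (S.bdVertex q (n + 1))) s =
      AffineMap.lineMap (corner k) (corner (k + 1))
        (AffineMap.lineMap (lam n) (lam (n + 1)) s : ℝ) := by
  rw [hu n ⟨hn.1, hn.2.le⟩, hu (n + 1) ⟨hn.1.trans (Nat.le_succ n), hn.2⟩]
  simp only [AffineMap.lineMap_apply_module, smul_eq_mul]
  module

theorem lineMap_mem_Icc {a b s : ℝ} (hab : a ≤ b) (hs : s ∈ Set.Icc (0 : ℝ) 1) :
    (AffineMap.lineMap a b s : ℝ) ∈ Set.Icc a b := by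
  rw [AffineMap.lineMap_apply_module]
  simp only [smul_eq_mul]
  constructor <;> nlinarith [hs.1, hs.2]

theorem eq_one_of_lineMap_ge {a b s : ℝ} (hab : a < b) (hs : s ∈ Set.Icc (0 : ℝ) 1)
    (h : b ≤ AffineMap.lineMap a b s) : s = 1 := by
  rw [AffineMap.lineMap_apply_module] at h
  simp only [smul_eq_mul] at h
  refine le_antisymm hs.2 ?_
  nlinarith

theorem eq_zero_of_lineMap_le {a b s : ℝ} (hab : a < b) (hs : s ∈ Set.Icc (0 : ℝ) 1)
    (h : AffineMap.lineMap a b s ≤ a) : s = 0 := by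
  rw [AffineMap.lineMap_apply_module] at h
  simp only [smul_eq_mul] at h
  refine le_antisymm ?_ hs.1
  nlinarith

theorem map_mem_frontier (H : S.PositiveMap q u Φ) {p : S.carrier}
    (hp : (p : Pt d) ∈ S.boundary) : Φ p ∈ frontier target := by
  obtain ⟨k, n, s, hn, hs, -, h⟩ := H.exists_boundary_param hp
  obtain ⟨lam, hmono, h0, h1, hu⟩ := H.sides k
  rw [h, boundary_param_side hu hn]
  have i0 : n ∈ Set.Icc (S.c k.castSucc * 2 ^ q) (S.c k.succ * 2 ^ q) := ⟨hn.1, hn.2.le⟩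
  have i1 : n + 1 ∈ Set.Icc (S.c k.castSucc * 2 ^ q) (S.c k.succ * 2 ^ q) :=
    ⟨hn.1.trans (Nat.le_succ n), hn.2⟩
  have hle : lam n ≤ lam (n + 1) := hmono.monotoneOn i0 i1 (Nat.le_succ n)
  have := lineMap_mem_Icc hle hs
  exact lineMap_corner_mem_frontier k
    ⟨(lam_mem hmono h0 h1 i0).1.trans this.1, this.2.trans (lam_mem hmono h0 h1 i1).2⟩

/-! ### Injectivity on the boundary -/

section Block

variable {k : Fin 3} {lam : ℕ → ℝ} {n : ℕ} {s : ℝ}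

theorem lineMap_eq_marked_succ
    (hmono : StrictMonoOn lam (Set.Icc (S.c k.castSucc * 2 ^ q) (S.c k.succ * 2 ^ q)))
    (h1 : lam (S.c k.succ * 2 ^ q) = 1)
    (hn : n ∈ Set.Ico (S.c k.castSucc * 2 ^ q) (S.c k.succ * 2 ^ q)) (hs : s ∈ Set.Icc (0 : ℝ) 1)
    (h : (AffineMap.lineMap (lam n) (lam (n + 1)) s : ℝ) = 1) :
    AffineMap.lineMap (S.bdVertex q n) (S.bdVertex q (n + 1)) s = S.marked (k + 1) := by
  have i0 : n ∈ Set.Icc (S.c k.castSucc * 2 ^ q) (S.c k.succ * 2 ^ q) := ⟨hn.1, hn.2.le⟩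
  have i1 : n + 1 ∈ Set.Icc (S.c k.castSucc * 2 ^ q) (S.c k.succ * 2 ^ q) :=
    ⟨hn.1.trans (Nat.le_succ n), hn.2⟩
  have i2 : S.c k.succ * 2 ^ q ∈ Set.Icc (S.c k.castSucc * 2 ^ q) (S.c k.succ * 2 ^ q) :=
    ⟨(S.c_lt k q).le, le_rfl⟩
  have hlt : lam n < lam (n + 1) := hmono i0 i1 (Nat.lt_succ_self n)
  have hle : lam (n + 1) ≤ 1 := h1 ▸ hmono.monotoneOn i1 i2 hn.2
  obtain rfl := eq_one_of_lineMap_ge hlt hs (by rw [h]; exact hle)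
  rw [AffineMap.lineMap_apply_one] at h ⊢
  rw [hmono.injOn i1 i2 (h.trans h1.symm), bdVertex_block_end]

theorem lineMap_eq_marked
    (hmono : StrictMonoOn lam (Set.Icc (S.c k.castSucc * 2 ^ q) (S.c k.succ * 2 ^ q)))
    (h0 : lam (S.c k.castSucc * 2 ^ q) = 0)
    (hn : n ∈ Set.Ico (S.c k.castSucc * 2 ^ q) (S.c k.succ * 2 ^ q)) (hs : s ∈ Set.Icc (0 : ℝ) 1)
    (h : (AffineMap.lineMap (lam n) (lam (n + 1)) s : ℝ) = 0) :
    AffineMap.lineMap (S.bdVertex q n) (S.bdVertex q (n + 1)) s = S.marked k := by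
  have i0 : n ∈ Set.Icc (S.c k.castSucc * 2 ^ q) (S.c k.succ * 2 ^ q) := ⟨hn.1, hn.2.le⟩
  have i1 : n + 1 ∈ Set.Icc (S.c k.castSucc * 2 ^ q) (S.c k.succ * 2 ^ q) :=
    ⟨hn.1.trans (Nat.le_succ n), hn.2⟩
  have i2 : S.c k.castSucc * 2 ^ q ∈ Set.Icc (S.c k.castSucc * 2 ^ q) (S.c k.succ * 2 ^ q) :=
    ⟨le_rfl, (S.c_lt k q).le⟩
  have hlt : lam n < lam (n + 1) := hmono i0 i1 (Nat.lt_succ_self n)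
  have hle : 0 ≤ lam n := h0 ▸ hmono.monotoneOn i2 i0 hn.1
  obtain rfl := eq_zero_of_lineMap_le hlt hs (by rw [h]; exact hle)
  rw [AffineMap.lineMap_apply_zero] at h ⊢
  rw [hmono.injOn i0 i2 (h.trans h0.symm), bdVertex_block_start]

/-- The parameter intervals of different edges have disjoint interiors by strict monotonicity. Equal
parameters on different edges therefore occur only at a shared endpoint. -/
theorem lineMap_eq_of_le {n' : ℕ} {s' : ℝ}
    (hmono : StrictMonoOn lam (Set.Icc (S.c k.castSucc * 2 ^ q) (S.c k.succ * 2 ^ q)))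
    (hn : n ∈ Set.Ico (S.c k.castSucc * 2 ^ q) (S.c k.succ * 2 ^ q)) (hs : s ∈ Set.Icc (0 : ℝ) 1)
    (hn' : n' ∈ Set.Ico (S.c k.castSucc * 2 ^ q) (S.c k.succ * 2 ^ q))
    (hs' : s' ∈ Set.Icc (0 : ℝ) 1) (hle : n ≤ n')
    (h : (AffineMap.lineMap (lam n) (lam (n + 1)) s : ℝ) =
      AffineMap.lineMap (lam n') (lam (n' + 1)) s') :
    AffineMap.lineMap (S.bdVertex q n) (S.bdVertex q (n + 1)) s =
      AffineMap.lineMap (S.bdVertex q n') (S.bdVertex q (n' + 1)) s' := by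
  have i0 : n ∈ Set.Icc (S.c k.castSucc * 2 ^ q) (S.c k.succ * 2 ^ q) := ⟨hn.1, hn.2.le⟩
  have i1 : n + 1 ∈ Set.Icc (S.c k.castSucc * 2 ^ q) (S.c k.succ * 2 ^ q) :=
    ⟨hn.1.trans (Nat.le_succ n), hn.2⟩
  have i0' : n' ∈ Set.Icc (S.c k.castSucc * 2 ^ q) (S.c k.succ * 2 ^ q) := ⟨hn'.1, hn'.2.le⟩
  have i1' : n' + 1 ∈ Set.Icc (S.c k.castSucc * 2 ^ q) (S.c k.succ * 2 ^ q) :=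
    ⟨hn'.1.trans (Nat.le_succ n'), hn'.2⟩
  have hlt : lam n < lam (n + 1) := hmono i0 i1 (Nat.lt_succ_self n)
  have hlt' : lam n' < lam (n' + 1) := hmono i0' i1' (Nat.lt_succ_self n')
  rcases eq_or_lt_of_le hle with rfl | hlt2
  · rw [AffineMap.lineMap_injective ℝ hlt.ne h]
  · have h1 : lam (n + 1) ≤ lam n' := hmono.monotoneOn i1 i0' hlt2
    have h2 := (lineMap_mem_Icc hlt.le hs).2
    have h3 := (lineMap_mem_Icc hlt'.le hs').1
    obtain rfl := eq_one_of_lineMap_ge hlt hs (by rw [h]; exact h1.trans h3)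
    obtain rfl := eq_zero_of_lineMap_le hlt' hs' (by rw [← h]; exact h2.trans h1)
    rw [AffineMap.lineMap_apply_one, AffineMap.lineMap_apply_zero] at h ⊢
    rw [hmono.injOn i1 i0' h]

end Block

theorem eq_of_mem_boundary (H : S.PositiveMap q u Φ) {p p' : S.carrier}
    (hp : (p : Pt d) ∈ S.boundary) (hp' : (p' : Pt d) ∈ S.boundary) (h : Φ p = Φ p') : p = p' := by
  obtain ⟨k, n, s, hn, hs, hps, hΦ⟩ := H.exists_boundary_param hp
  obtain ⟨k', n', s', hn', hs', hps', hΦ'⟩ := H.exists_boundary_param hp'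
  obtain ⟨lam, hmono, h0, h1, hu⟩ := H.sides k
  obtain ⟨lam', hmono', h0', h1', hu'⟩ := H.sides k'
  rw [hΦ, hΦ', boundary_param_side hu hn, boundary_param_side hu' hn', ← sum_sideWeight_smul,
    ← sum_sideWeight_smul] at h
  apply Subtype.ext
  rcases sideWeight_injective (weights_unique area_corner_pos (sum_sideWeight _ _)
    (sum_sideWeight _ _) h) with ⟨rfl, hx⟩ | ⟨rfl, hx, hx'⟩ | ⟨rfl, hx, hx'⟩
  -- The two parametrizations of this side were chosen independently. They agree because the corners
  -- are distinct.
  · have hlam : ∀ i ∈ Set.Icc (S.c k.castSucc * 2 ^ q) (S.c k.succ * 2 ^ q), lam i = lam' i := by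
      intro i hi
      have e := (hu i hi).symm.trans (hu' i hi)
      have hne : corner k ≠ corner (k + 1) := fun hc => by
        have h4 := weights_unique area_corner_pos (sum_sideWeight k 0) (sum_sideWeight k 1)
          (by rw [sum_sideWeight_smul, sum_sideWeight_smul, hc]; simp)
        have := congrFun h4 k
        simp [sideWeight] at this
      exact AffineMap.lineMap_injective ℝ hne e
    rw [← hlam n' ⟨hn'.1, hn'.2.le⟩, ← hlam (n' + 1) ⟨hn'.1.trans (Nat.le_succ n'), hn'.2⟩] at hx
    rw [hps, hps']
    rcases le_total n n' with hle | hle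
    · exact lineMap_eq_of_le hmono hn hs hn' hs' hle hx
    · exact (lineMap_eq_of_le hmono hn' hs' hn hs hle hx.symm).symm
  · rw [hps, hps', lineMap_eq_marked_succ hmono h1 hn hs hx,
      lineMap_eq_marked hmono' h0' hn' hs' hx']
  · rw [hps, hps', lineMap_eq_marked hmono h0 hn hs hx,
      lineMap_eq_marked_succ hmono' h1' hn' hs' hx']

/-! ### The homeomorphism onto the target triangle -/

theorem injective (H : S.PositiveMap q u Φ) : Function.Injective Φ := by
  intro p p' h
  by_cases hp : (p : Pt d) ∈ S.boundary
  · by_cases hp' : (p' : Pt d) ∈ S.boundary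
    · exact H.eq_of_mem_boundary hp hp' h
    · exact (H.eq_of_notMem_boundary hp' h.symm).symm
  · exact H.eq_of_notMem_boundary hp h

theorem map_mem_target (H : S.PositiveMap q u Φ) (p : S.carrier) : Φ p ∈ target := by
  obtain ⟨j, hj⟩ := S.exists_face q p.2
  exact H.img_subset_target j (H.map_mem_hull hj)

theorem sum_verts_mem (j : S.Face q) {w : Fin 3 → ℝ} (hw : w ∈ stdSimplex ℝ (Fin 3)) :
    ∑ l, w l • S.verts j l ∈ S.carrier := by
  refine Set.mem_iUnion₂.2 ⟨j.1.1, j.1.2, ?_⟩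
  exact (convex_convexHull ℝ _).sum_mem (fun l _ => hw.1 l) hw.2 fun l _ => descend_mem _ _ l

theorem surjOn_target (H : S.PositiveMap q u Φ) {y : ℂ} (hy : y ∈ target) : ∃ p, Φ p = y := by
  obtain ⟨j, hj⟩ := Set.mem_iUnion.1 (H.target_subset_iUnion hy)
  obtain ⟨w, hw, rfl⟩ := (mem_convexHull_range_iff _ _).1 hj
  exact ⟨⟨_, sum_verts_mem j hw⟩, H.interp j _ w hw rfl⟩

/-- The preimage of a closed set is a finite union of images, under barycentric coordinates, of
compact subsets of the simplex. No gluing along edges is needed. -/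
theorem continuous (H : S.PositiveMap q u Φ) : Continuous Φ := by
  rw [continuous_iff_isClosed]
  intro K hK
  have hcl : ∀ j : S.Face q, IsClosed ((fun w : Fin 3 → ℝ => ∑ l, w l • S.verts j l) ''
      (stdSimplex ℝ (Fin 3) ∩ (fun w : Fin 3 → ℝ => ∑ l, w l • S.img u j l) ⁻¹' K)) := fun j =>
    (((isCompact_stdSimplex ℝ (Fin 3)).inter_right (hK.preimage (by fun_prop))).image
      (by fun_prop)).isClosed
  have e : Φ ⁻¹' K = ((↑) : S.carrier → Pt d) ⁻¹' ⋃ j : S.Face q,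
      (fun w : Fin 3 → ℝ => ∑ l, w l • S.verts j l) ''
      (stdSimplex ℝ (Fin 3) ∩ (fun w : Fin 3 → ℝ => ∑ l, w l • S.img u j l) ⁻¹' K) := by
    ext p
    simp only [Set.mem_preimage, Set.mem_iUnion, Set.mem_image, Set.mem_inter_iff]
    constructor
    · intro hp
      obtain ⟨j, hj⟩ := S.exists_face q p.2
      obtain ⟨w, hw, e⟩ := (mem_convexHull_range_iff _ _).1 hj
      exact ⟨j, w, ⟨hw, by rw [← H.interp j p w hw e]; exact hp⟩, e.symm⟩
    · rintro ⟨j, w, ⟨hw, hK'⟩, e⟩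
      rw [H.interp j p w hw e.symm]
      exact hK'
  rw [e]
  exact (isClosed_iUnion_of_finite hcl).preimage continuous_subtype_val

theorem isCompact_carrier (S : MarkedDisk d) : IsCompact S.carrier :=
  S.faces.isCompact_biUnion fun f _ => (Set.finite_range f).isCompact_convexHull _

theorem exists_homeomorph (H : S.PositiveMap q u Φ) :
    ∃ e : S.carrier ≃ₜ target, ∀ p, ((e p : target) : ℂ) = Φ p := by
  have : CompactSpace S.carrier := isCompact_iff_compactSpace.1 (isCompact_carrier S)
  have hbij : Function.Bijective fun p => (⟨Φ p, H.map_mem_target p⟩ : target) :=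
    ⟨fun p p' h => H.injective (congrArg Subtype.val h), fun y => by
      obtain ⟨p, hp⟩ := H.surjOn_target y.2
      exact ⟨p, Subtype.ext hp⟩⟩
  have hc : Continuous (Equiv.ofBijective _ hbij) :=
    H.continuous.subtype_mk H.map_mem_target
  exact ⟨hc.homeoOfEquivCompactToT2, fun p => rfl⟩

/-- Surjectivity onto the frontier holds because points off the boundary are sent to the interior of
the target. -/
theorem bijOn_boundary (H : S.PositiveMap q u Φ) :
    Set.BijOn Φ {p | (p : Pt d) ∈ S.boundary} (frontier target) := by
  refine ⟨fun p hp => H.map_mem_frontier hp, H.injective.injOn, fun y hy => ?_⟩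
  obtain ⟨p, rfl⟩ := H.surjOn_target (isClosed_target.frontier_subset hy)
  refine ⟨p, ?_, rfl⟩
  by_contra hp
  exact hy.2 (H.mem_interior_of_notMem_boundary hp)

end PositiveMap

end MarkedDisk

namespace MarkedDisk

/-! ### Real affine maps of the plane -/

/-- The linear part of `affineForm`. -/
def linearForm (α β : ℂ) : ℂ →ₗ[ℝ] ℂ :=
  LinearMap.mulLeft ℝ α + LinearMap.mulLeft ℝ β ∘ₗ Complex.conjAe.toLinearMap

theorem linearForm_apply (α β z : ℂ) : linearForm α β z = α * z + β * conj z := rfl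

/-- `affineForm` as an affine map. -/
def affineFormMap (α β δ : ℂ) : ℂ →ᵃ[ℝ] ℂ :=
  (linearForm α β).toAffineMap + AffineMap.const ℝ ℂ δ

theorem affineFormMap_apply (α β δ z : ℂ) : affineFormMap α β δ z = affineForm α β δ z := rfl

theorem affineFormMap_linear (α β δ : ℂ) : (affineFormMap α β δ).linear = linearForm α β := by
  simp [affineFormMap]

theorem map_sum_weights (A : ℂ →ᵃ[ℝ] ℂ) {w : Fin 3 → ℝ} (hw : ∑ l, w l = 1) (z : Fin 3 → ℂ) :
    A (∑ l, w l • z l) = ∑ l, w l • A (z l) := by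
  have h : ∀ y, A y = A.linear y + A 0 := fun y => congrFun (AffineMap.decomp A) y
  rw [h, map_sum]
  simp only [h (z _), smul_add, map_smul, Finset.sum_add_distrib, ← Finset.sum_smul, hw, one_smul]

theorem det_linearForm (α β : ℂ) : LinearMap.det (linearForm α β) = ‖α‖ ^ 2 - ‖β‖ ^ 2 := by
  rw [← LinearMap.det_toMatrix Complex.basisOneI, Matrix.det_fin_two, ← Complex.normSq_eq_norm_sq,
    ← Complex.normSq_eq_norm_sq]
  simp [LinearMap.toMatrix_apply, linearForm_apply, Complex.normSq_apply]
  ring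

theorem signedArea_affineForm (α β δ a b c : ℂ) :
    signedArea (affineForm α β δ a) (affineForm α β δ b) (affineForm α β δ c) =
      (‖α‖ ^ 2 - ‖β‖ ^ 2) * signedArea a b c := by
  rw [← Complex.normSq_eq_norm_sq, ← Complex.normSq_eq_norm_sq]
  simp only [signedArea_eq, affineForm, Complex.normSq_apply, Complex.add_re, Complex.add_im,
    Complex.mul_re, Complex.mul_im, Complex.conj_re, Complex.conj_im]
  ring

/-- An eigenvector `v` of the adjoint composed with the map satisfies `‖A v‖ = σ ‖v‖`, and the
triangle inequality bounds `‖α v + β conj v‖` on both sides. -/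
theorem singularValues_linearForm_mem {α β : ℂ} {n : ℕ} (hn : n < 2) :
    (linearForm α β).singularValues n ∈ Set.Icc (‖α‖ - ‖β‖) (‖α‖ + ‖β‖) := by
  set σ := (linearForm α β).singularValues n
  have hσ : 0 ≤ σ := LinearMap.singularValues_nonneg _ _
  have he := (linearForm α β).hasEigenvalue_adjoint_comp_self_sq_singularValues
    (n := n) (by rw [Complex.finrank_real_complex]; exact hn)
  obtain ⟨v, hv⟩ := he.exists_hasEigenvector
  have hv0 : 0 < ‖v‖ := norm_pos_iff.2 hv.2
  have h1 : (LinearMap.adjoint (linearForm α β)) (linearForm α β v) = (σ ^ 2) • v := hv.apply_eq_smul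
  have h2 : ‖linearForm α β v‖ ^ 2 = σ ^ 2 * ‖v‖ ^ 2 := by
    rw [← real_inner_self_eq_norm_sq, ← real_inner_self_eq_norm_sq v, ← LinearMap.adjoint_inner_left,
      h1, real_inner_smul_left]
  have h3 : ‖linearForm α β v‖ = σ * ‖v‖ := by
    rw [← mul_pow] at h2
    exact (pow_left_inj₀ (norm_nonneg _) (by positivity) two_ne_zero).1 h2
  have h4 : ‖linearForm α β v‖ ≤ (‖α‖ + ‖β‖) * ‖v‖ := by
    rw [linearForm_apply]
    refine (norm_add_le _ _).trans (le_of_eq ?_)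
    rw [norm_mul, norm_mul, Complex.norm_conj]; ring
  have h5 : (‖α‖ - ‖β‖) * ‖v‖ ≤ ‖linearForm α β v‖ := by
    rw [linearForm_apply]
    have := norm_sub_le_norm_add (α * v) (β * conj v)
    rw [norm_mul, norm_mul, Complex.norm_conj] at this
    linarith
  rw [h3] at h4 h5
  exact ⟨le_of_mul_le_mul_right h5 hv0, le_of_mul_le_mul_right h4 hv0⟩

theorem norm_lt_of_dilatation {K : ℝ} (hK : 1 ≤ K) {α β : ℂ}
    (h : ‖β‖ ≤ (K - 1) / (K + 1) * ‖α‖) (hα : α ≠ 0) : ‖β‖ < ‖α‖ := by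
  refine h.trans_lt (mul_lt_of_lt_one_left (norm_pos_iff.2 hα) ?_)
  rw [div_lt_one (by linarith)]
  linarith

/-- The dilatation bound rearranges to `|α| + |β| ≤ K (|α| - |β|)`, which compares the bounds for
the two singular values. -/
theorem distortion_linearForm_le {K : ℝ} (hK : 1 ≤ K) {α β : ℂ}
    (h : ‖β‖ ≤ (K - 1) / (K + 1) * ‖α‖) (hα : α ≠ 0) : distortion (linearForm α β) ≤ K := by
  have hlt := norm_lt_of_dilatation hK h hα
  have h0 := singularValues_linearForm_mem (α := α) (β := β) (n := 0) (by norm_num)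
  have h1 := singularValues_linearForm_mem (α := α) (β := β) (n := 1) (by norm_num)
  have hp : 0 < (linearForm α β).singularValues 1 := lt_of_lt_of_le (sub_pos.2 hlt) h1.1
  rw [distortion, div_le_iff₀ hp]
  refine h0.2.trans (le_trans ?_ (mul_le_mul_of_nonneg_left h1.1 (by linarith)))
  rw [div_mul_eq_mul_div, le_div_iff₀ (by linarith)] at h
  linarith

/-! ### Solutions of the equations -/

variable {d : ℕ} {S : MarkedDisk d} {𝒜 : S.Atlas} {q : ℕ} {hq : 2 ≤ q} {K : S.Face q → ℝ}
  {α β δ : S.Face q → ℂ} {u : Pt d → ℂ}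

theorem exists_vert_eq_marked (S : MarkedDisk d) (q : ℕ) (k : Fin 3) :
    ∃ (j : S.Face q) (l : Fin 3), S.verts j l = S.marked k := by
  have hlt : S.c k.castSucc * 2 ^ q < S.m * 2 ^ q := by
    refine Nat.mul_lt_mul_of_pos_right ?_ (by positivity)
    rw [← S.c_three]
    exact S.c_strictMono (Fin.castSucc_lt_last k)
  obtain ⟨j, l, hj, -⟩ := S.exists_face_of_bdVertex q _ hlt
  rw [bdVertex_block_start] at hj
  exact ⟨j, l, hj⟩

namespace Equations

theorem affineForm_sum (h : Equations 𝒜 hq K α β δ u) (j : S.Face q) {w : Fin 3 → ℝ}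
    (hw : ∑ l, w l = 1) : affineForm (α j) (β j) (δ j) (∑ l, w l • 𝒜.z hq j l) =
      ∑ l, w l • S.img u j l := by
  rw [← affineFormMap_apply, map_sum_weights _ hw]
  refine Finset.sum_congr rfl fun l _ => ?_
  rw [affineFormMap_apply, h.compat, img]

theorem area_img_pos (h : Equations 𝒜 hq K α β δ u) (hS : S.FineAngles) (hK : ∀ j, 1 ≤ K j)
    (j : S.Face q) : 0 < area (S.img u j) := by
  have hlt := norm_lt_of_dilatation (hK j) (h.dist_bound j).1 (h.dist_bound j).2
  rw [area, img, img, img, ← h.compat j 0, ← h.compat j 1, ← h.compat j 2, signedArea_affineForm]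
  refine mul_pos ?_ (area_z_pos hS 𝒜 hq j)
  have := norm_nonneg (β j)
  nlinarith

theorem apply_marked (h : Equations 𝒜 hq K α β δ u) (k : Fin 3) : u (S.marked k) = corner k := by
  obtain ⟨j, l, hj⟩ := S.exists_vert_eq_marked q k
  rw [← h.corners j l k hj, h.compat, hj]

/-- Weak monotonicity improves to strict monotonicity: equal consecutive values would collapse an
edge of a face, whose image triangle would then have area zero. -/
theorem exists_side_param (h : Equations 𝒜 hq K α β δ u) (hpos : ∀ j : S.Face q, 0 < area (S.img u j))
    (k : Fin 3) : ∃ lam : ℕ → ℝ,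
    StrictMonoOn lam (Set.Icc (S.c k.castSucc * 2 ^ q) (S.c k.succ * 2 ^ q)) ∧
    lam (S.c k.castSucc * 2 ^ q) = 0 ∧ lam (S.c k.succ * 2 ^ q) = 1 ∧
    ∀ n ∈ Set.Icc (S.c k.castSucc * 2 ^ q) (S.c k.succ * 2 ^ q),
      u (S.bdVertex q n) = AffineMap.lineMap (corner k) (corner (k + 1)) (lam n) := by
  classical
  obtain ⟨lam₀, hmono₀, hlam₀⟩ := h.sides k
  have ha := h.apply_marked k
  rw [← S.bdVertex_block_start q k] at ha
  have hb := h.apply_marked (k + 1)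
  rw [← S.bdVertex_block_end q k] at hb
  have hab := S.c_lt k q
  have hbm : S.c k.succ * 2 ^ q ≤ S.m * 2 ^ q := by
    refine Nat.mul_le_mul_right _ ?_
    rw [← S.c_three]
    exact S.c_strictMono.monotone (Fin.le_last _)
  set a := S.c k.castSucc * 2 ^ q
  set b := S.c k.succ * 2 ^ q
  -- The given parameters are controlled only strictly between the marked vertices. They are
  -- completed by `0` and `1` at the ends, where `u` takes the corner values.
  set lam : ℕ → ℝ := fun n => if n = a then 0 else if n = b then 1 else lam₀ n with hlam
  have la : lam a = 0 := if_pos rfl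
  have lb : lam b = 1 := by simp [hlam, hab.ne']
  have lm : ∀ n ∈ Set.Ioo a b, lam n = lam₀ n := fun n hn => by
    simp [hlam, hn.1.ne', hn.2.ne]
  have hu : ∀ n ∈ Set.Icc a b, u (S.bdVertex q n) =
      AffineMap.lineMap (corner k) (corner (k + 1)) (lam n) := by
    intro n hn
    rcases eq_or_lt_of_le hn.1 with rfl | h1
    · rw [la, AffineMap.lineMap_apply_zero, ha]
    rcases eq_or_lt_of_le hn.2 with rfl | h2
    · rw [lb, AffineMap.lineMap_apply_one, hb]
    · rw [lm n ⟨h1, h2⟩, (hlam₀ n ⟨h1, h2⟩).2.2, AffineMap.lineMap_apply_module]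
      simp
  have hle : ∀ n, a ≤ n → n + 1 ≤ b → lam n ≤ lam (n + 1) := by
    intro n h1 h2
    rcases eq_or_lt_of_le h1 with rfl | h1
    · rw [la]
      rcases eq_or_lt_of_le h2 with h2 | h2
      · rw [h2, lb]; exact zero_le_one
      · rw [lm _ ⟨Nat.lt_succ_self _, h2⟩]
        exact (hlam₀ _ ⟨Nat.lt_succ_self _, h2⟩).1
    · rw [lm n ⟨h1, h2⟩]
      rcases eq_or_lt_of_le h2 with h2' | h2'
      · rw [h2', lb]; exact (hlam₀ n ⟨h1, h2⟩).2.1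
      · rw [lm _ ⟨h1.trans (Nat.lt_succ_self _), h2'⟩]
        exact hmono₀ ⟨h1, h2⟩ ⟨h1.trans (Nat.lt_succ_self _), h2'⟩ (Nat.le_succ n)
  have hne : ∀ n, a ≤ n → n + 1 ≤ b → lam n ≠ lam (n + 1) := by
    intro n h1 h2 heq
    have e : u (S.bdVertex q n) = u (S.bdVertex q (n + 1)) := by
      rw [hu n ⟨h1, by omega⟩, hu (n + 1) ⟨by omega, h2⟩, heq]
    obtain ⟨j, l, hj, hj'⟩ := S.exists_face_of_bdVertex q n (by omega)
    have hp := hpos j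
    rw [area, ← signedArea_cyclic _ l, img, img, hj, hj', e, signedArea_eq] at hp
    simp at hp
  have hlt : ∀ n, a ≤ n → n + 1 ≤ b → lam n < lam (n + 1) := fun n h1 h2 =>
    lt_of_le_of_ne (hle n h1 h2) (hne n h1 h2)
  refine ⟨lam, ?_, la, lb, hu⟩
  intro x hx y hy hxy
  obtain ⟨y, rfl⟩ : ∃ m, y = x + m + 1 := ⟨y - x - 1, by omega⟩
  clear hxy
  induction y with
  | zero => exact hlt x hx.1 hy.2
  | succ y ih =>
    have hy2 := hy.2
    refine (ih ⟨by have := hx.1; omega, by omega⟩).trans (hlt _ (by have := hx.1; omega) hy.2)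

theorem positiveMap (h : Equations 𝒜 hq K α β δ u) (hS : S.FineAngles) (hK : ∀ j, 1 ≤ K j)
    {Φ : S.carrier → ℂ} (hΦ : HasPieces 𝒜 hq α β δ Φ) : S.PositiveMap q u Φ where
  area_pos := h.area_img_pos hS hK
  interp j p w hw e := by rw [hΦ j p w hw e, h.affineForm_sum j hw.2]
  sides := h.exists_side_param (h.area_img_pos hS hK)

/-- Every point lies in some face, which forces the value and gives uniqueness. A value defined
through one chosen representation agrees with every other face by `interp_eq`. -/
theorem existsUnique_hasPieces (h : Equations 𝒜 hq K α β δ u) :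
    ∃! Φ : S.carrier → ℂ, HasPieces 𝒜 hq α β δ Φ := by
  have hex : ∀ p : S.carrier, ∃ (j : S.Face q) (w : Fin 3 → ℝ), w ∈ stdSimplex ℝ (Fin 3) ∧
      (p : Pt d) = ∑ l, w l • S.verts j l := fun p => by
    obtain ⟨j, hj⟩ := S.exists_face q p.2
    obtain ⟨w, hw, e⟩ := (mem_convexHull_range_iff _ _).1 hj
    exact ⟨j, w, hw, e⟩
  choose j w hw e using hex
  refine ⟨fun p => ∑ l, w p l • u (S.verts (j p) l), fun i p w' hw' e' => ?_, fun Ψ hΨ => ?_⟩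
  · rw [h.affineForm_sum i hw'.2]
    exact S.interp_eq _ _ (hw p) hw' ((e p).symm.trans e') u
  · ext1 p
    rw [hΨ (j p) p (w p) (hw p) (e p), h.affineForm_sum (j p) (hw p).2]
    rfl

end Equations

theorem apply_vertPt {Φ : S.carrier → ℂ} (H : S.PositiveMap q u Φ) (j : S.Face q) (l : Fin 3) :
    Φ (S.vertPt j l) = S.img u j l := by
  have := H.interp j (S.vertPt j l) (Pi.single l 1) (single_mem_stdSimplex ℝ l)
    (by simp [vertPt, Pi.single_apply, ite_smul])
  simpa [Pi.single_apply, ite_mul] using this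

theorem Equations.isQCSimplicialHomeo (h : Equations 𝒜 hq K α β δ u) (hS : S.FineAngles)
    (hK : ∀ j, 1 ≤ K j) {Φ : S.carrier → ℂ} (hΦ : HasPieces 𝒜 hq α β δ Φ) :
    IsQCSimplicialHomeo 𝒜 hq K Φ := by
  have H := h.positiveMap hS hK hΦ
  refine ⟨⟨H.continuous, ?_, H.bijOn_boundary, ?_⟩, H.exists_homeomorph, ?_, ?_⟩
  · intro j p w hw e
    simp only [apply_vertPt H]
    exact H.interp j p w hw e
  · intro k p hp
    obtain ⟨j, l, hj⟩ := S.exists_vert_eq_marked q k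
    have e : p = S.vertPt j l := Subtype.ext (hp.trans hj.symm)
    rw [e, apply_vertPt H, img, hj, h.apply_marked]
  · intro j
    simp only [apply_vertPt H]
    exact H.area_pos j
  · intro j
    refine ⟨affineFormMap (α j) (β j) (δ j), fun A' => ⟨fun hA' => ?_, ?_⟩, ?_, ?_⟩
    -- The local triangle is nondegenerate, so every `y` is an affine combination of its vertices
    -- and an affine map is determined by its values there.
    · ext1 y
      rw [← sum_bary_smul (area_z_pos hS 𝒜 hq j) y, map_sum_weights _ (sum_bary
        (area_z_pos hS 𝒜 hq j) y), affineFormMap_apply, h.affineForm_sum j (sum_bary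
        (area_z_pos hS 𝒜 hq j) y)]
      simp only [hA', apply_vertPt H]
    · rintro rfl l
      rw [affineFormMap_apply, h.compat, apply_vertPt H, img]
    · have hlt := norm_lt_of_dilatation (hK j) (h.dist_bound j).1 (h.dist_bound j).2
      rw [affineFormMap_linear, det_linearForm]
      have := norm_nonneg (β j)
      nlinarith
    · rw [affineFormMap_linear]
      exact distortion_linearForm_le (hK j) (h.dist_bound j).1 (h.dist_bound j).2

end MarkedDisk

end PolyUnif

end

theorem mainTheorem5 {d : ℕ} (S : PolyUnif.MarkedDisk d) (hS : S.FineAngles) (𝒜 : S.Atlas)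
    (q : ℕ) (hq : 2 ≤ q) (K : S.Face q → ℝ) (hK : ∀ j, 1 ≤ K j)
    (α β δ : S.Face q → ℂ) (u : PolyUnif.Pt d → ℂ)
    (h : PolyUnif.MarkedDisk.Equations 𝒜 hq K α β δ u) :
    (∃! Φ : S.carrier → ℂ, PolyUnif.MarkedDisk.HasPieces 𝒜 hq α β δ Φ) ∧
      ∀ Φ : S.carrier → ℂ, PolyUnif.MarkedDisk.HasPieces 𝒜 hq α β δ Φ →
        PolyUnif.MarkedDisk.IsQCSimplicialHomeo 𝒜 hq K Φ := by
  exact ⟨h.existsUnique_hasPieces, fun _ hΦ => h.isQCSimplicialHomeo hS hK hΦ⟩
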